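/- **Theorem (weighted trace theorem on the half-space).** *Notation.* Let $d\ge 1$, $\mathbb R^{d+1}_+=\{(x,t)\in\mathbb R^d\times\mathbb R: t>0\}$, $0<s<1$, $1\le p<\infty$. For $A\in C^1(\overline{\mathbb R^{d+1}_+},\mathbb R^{d+1})$ let $dA$ be its exterior derivative ($A$ being viewed as a $1$-form), with pointwise norm $|dA(X)|=\sup_{|v|,|w|\le 1}|dA(X)[v,w]|$, let $\nabla_A U=\nabla U+iAU$ be the weak covariant gradient of $U\in W^{1,1}_{\mathrm{loc}}(\mathbb R^{d+1}_+,\mathbb C)$, and let $A^{\shortparallel}(x)=(A_1,\dots,A_d)(x,0)$ for $x\in\mathbb R^d$. For $\gamma\in\mathbb R$, $W^{1,p}_{A,\gamma}(\mathbb R^{d+1}_+)$ is the space of all $U\in W^{1,1}_{\mathrm{loc}}(\mathbb R^{d+1}_+,\mathbb C)$ with $$\|U\|_{W^{1,p}_{A,\gamma}}^p=\iint_{\mathbb R^{d+1}_+}\bigl(|U(x,t)|^p+|\nabla_AU(x,t)|^p\bigr)\,t^{\gamma}\,dx\,dt<\infty .$$ $W^{s,p}_{A^{\shortparallel}}(\mathbb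 R^d)$ is the space of all $u\in L^p(\mathbb R^d,\mathbb C)$ with $$|u|_{W^{s,p}_{A^{\shortparallel}}}^p=\iint_{\mathbb R^d\times\mathbb R^d}\frac{|e^{iI_{A^{\shortparallel}}(x,y)}u(y)-u(x)|^p}{|y-x|^{d+sp}}\,dx\,dy<\infty,\qquad I_{A^{\shortparallel}}(x,y)=\int_0^1A^{\shortparallel}((1-\tau)x+\tau y)\cdot(y-x)\,d\tau,$$ normed by $\|u\|^p=\|u\|_{L^p}^p+|u|^p_{W^{s,p}_{A^{\shortparallel}}}$. *Statement.* There is a constant $C=C_{d,s,p}>0$ depending only on $d,s,p$ such that for every $A\in C^1(\overline{\mathbb R^{d+1}_+},\mathbb R^{d+1})$ and every $\beta\ge0$ with $\|dA\|_{L^\infty(\mathbb R^{d+1}_+)}\le\beta$ there is a continuous linear trace mapping $$\operatorname{Tr}:W^{1,p}_{A,(1-s)p-1}(\mathbb R^{d+1}_+)\to W^{s,p}_{A^{\shortparallel}}(\mathbb R^d)$$ with the following properties. 1. Every $U\in C^1_c(\overline{\mathbb R^{d+1}_+},\mathbb C)$ belongs to $W^{1,p}_{A,(1-s)p-1}(\mathbb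 R^{d+1}_+)$ and $\operatorname{Tr}U=U(\cdot,0)$. 2. For every $U\in W^{1,p}_{A,(1-s)p-1}(\mathbb R^{d+1}_+)$, with $u=\operatorname{Tr}U$, $$|u|^p_{W^{s,p}_{A^{\shortparallel}}(\mathbb R^d)}+\beta^{\frac{sp}2}\|u\|^p_{L^p(\mathbb R^d)}\le C\iint_{\mathbb R^{d+1}_+}\frac{|\nabla_AU(x,t)|^p+\beta^{\frac p2}|U(x,t)|^p}{t^{1-(1-s)p}}\,dx\,dt .$$ 3. There is a continuous linear mapping $\operatorname{Ext}:W^{s,p}_{A^{\shortparallel}}(\mathbb R^d)\to W^{1,p}_{A,(1-s)p-1}(\mathbb R^{d+1}_+)$ such that $\operatorname{Tr}\circ\operatorname{Ext}$ is the identity and, if $\beta>0$, for every $u\in W^{s,p}_{A^{\shortparallel}}(\mathbb R^d)$, with $U=\operatorname{Ext}u$, $$\iint_{\mathbb R^{d+1}_+}\frac{|\nabla_AU(x,t)|^p+\beta^{\frac p2}|U(x,t)|^p}{t^{1-(1-s)p}}\,dx\,dt\le C\Bigl(|u|^p_{W^{s,p}_{A^{\shortparallel}}(\mathbb R^d)}+\beta^{\frac{sp}2}\|u\|^p_{L^p(\mathbb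 R^d)}\Bigr).$$ -/

import Mathlib

open MeasureTheory Set
open scoped ENNReal NNReal ContDiff

noncomputable section

namespace MagneticTrace

/-- `ℝⁿ` with its Euclidean norm. -/
abbrev Rn (n : ℕ) : Type := EuclideanSpace ℝ (Fin n)

/-- `ℂⁿ` with its Hermitian norm. -/
abbrev Cn (n : ℕ) : Type := EuclideanSpace ℂ (Fin n)

/-- The open half-space `ℝ^{d+1}_+ = {(x, t) : t > 0}`; `t` is the last coordinate. -/
def halfSpace (d : ℕ) : Set (Rn (d + 1)) := {X | 0 < X (Fin.last d)}

/-- The closed half-space `{(x, t) : t ≥ 0}`. -/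
def closedHalfSpace (d : ℕ) : Set (Rn (d + 1)) := {X | 0 ≤ X (Fin.last d)}

/-- The boundary point `(x, 0)` of the half-space. -/
def bdry {d : ℕ} (x : Rn d) : Rn (d + 1) :=
  WithLp.toLp 2 (Fin.snoc (α := fun _ => ℝ) (fun j => x j) 0)

/-- The field `A`, viewed as the differential 1-form `v ↦ A(X) · v`. -/
def oneForm {n : ℕ} (A : Rn n → Rn n) (X : Rn n) : Rn n [⋀^Fin 1]→L[ℝ] ℝ :=
  ContinuousAlternatingMap.ofSubsingleton ℝ (Rn n) ℝ (0 : Fin 1) (innerSL ℝ (A X))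

/-- The magnetic field `dA`, as a field of alternating 2-forms (with their operator norm). -/
def magneticField {n : ℕ} (A : Rn n → Rn n) : Rn n → Rn n [⋀^Fin 2]→L[ℝ] ℝ :=
  extDeriv (oneForm A)

/-- The parallel component on the boundary, `A^∥(x) = (A₁, …, A_d)(x, 0)`. -/
def parallel {d : ℕ} (A : Rn (d + 1) → Rn (d + 1)) (x : Rn d) : Rn d :=
  WithLp.toLp 2 fun j => A (bdry x) j.castSucc

/-- The potential `I_a(x, y) = ∫₀¹ a((1 - τ) x + τ y) · (y - x) dτ`. -/
def intPot {n : ℕ} (a : Rn n → Rn n) (x y : Rn n) : ℝ :=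
  ∫ τ in (0 : ℝ)..1, inner ℝ (a ((1 - τ) • x + τ • y)) (y - x)

/-- The covariant difference `e^{i I_a(x, y)} u(y) - u(x)`, with `z = (x, y)`. -/
def covDiff {n : ℕ} (a : Rn n → Rn n) (u : Rn n → ℂ) (z : Rn n × Rn n) : ℂ :=
  Complex.exp (Complex.I * (intPot a z.1 z.2 : ℂ)) * u z.2 - u z.1

/-! ### The first-order weighted magnetic Sobolev space on the half-space -/

/-- Lebesgue measure on the open half-space. -/
abbrev halfMeasure (d : ℕ) : Measure (Rn (d + 1)) := volume.restrict (halfSpace d)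

/-- The weighted measure `t^γ dx dt` on the open half-space. -/
def weightedMeasure (d : ℕ) (γ : ℝ) : Measure (Rn (d + 1)) :=
  (halfMeasure d).withDensity fun X => ENNReal.ofReal (X (Fin.last d) ^ γ)

/-- `U ∈ W^{1,1}_loc(ℝ^{d+1}_+)` with weak gradient `G`. -/
structure HasWeakGradient {d : ℕ} (U : Rn (d + 1) → ℂ) (G : Rn (d + 1) → Cn (d + 1)) : Prop where
  locInt : LocallyIntegrableOn U (halfSpace d)
  locInt_grad : LocallyIntegrableOn G (halfSpace d)
  integral_eq : ∀ φ : Rn (d + 1) → ℝ, ContDiff ℝ ∞ φ → HasCompactSupport φ →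
    tsupport φ ⊆ halfSpace d → ∀ j : Fin (d + 1),
      ∫ X in halfSpace d, fderiv ℝ φ X (EuclideanSpace.single j 1) • U X =
        -∫ X in halfSpace d, φ X • G X j

open Classical in
/-- The weak gradient of `U` (unique up to null sets when it exists). -/
def weakGradient {d : ℕ} (U : Rn (d + 1) → ℂ) : Rn (d + 1) → Cn (d + 1) :=
  if h : ∃ G, HasWeakGradient U G then h.choose else 0

/-- The weak covariant gradient `∇_A U = ∇U + i A U`. -/
def covGradient {d : ℕ} (A : Rn (d + 1) → Rn (d + 1)) (U : Rn (d + 1) → ℂ) :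
    Rn (d + 1) → Cn (d + 1) := fun X =>
  weakGradient U X + WithLp.toLp 2 fun j => Complex.I * (A X j : ℂ) * U X

theorem isOpen_halfSpace (d : ℕ) : IsOpen (halfSpace d) := by
  unfold halfSpace
  exact isOpen_lt continuous_const (by fun_prop)

theorem measurableSet_halfSpace (d : ℕ) : MeasurableSet (halfSpace d) :=
  (isOpen_halfSpace d).measurableSet

theorem measurable_weight (d : ℕ) (γ : ℝ) :
    Measurable fun X : Rn (d + 1) => ENNReal.ofReal (X (Fin.last d) ^ γ) := by
  fun_prop

theorem weightedMeasure_ac (d : ℕ) (γ : ℝ) : weightedMeasure d γ ≪ halfMeasure d :=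
  withDensity_absolutelyContinuous _ _

theorem ac_weightedMeasure (d : ℕ) (γ : ℝ) : halfMeasure d ≪ weightedMeasure d γ := by
  refine withDensity_absolutelyContinuous' (measurable_weight d γ).aemeasurable ?_
  filter_upwards [ae_restrict_mem (measurableSet_halfSpace d)] with X hX
  have : 0 < X (Fin.last d) ^ γ := Real.rpow_pos_of_pos hX γ
  simpa using this

theorem HasWeakGradient.integrable_left {d : ℕ} {U : Rn (d + 1) → ℂ}
    {G : Rn (d + 1) → Cn (d + 1)} (h : HasWeakGradient U G) {φ : Rn (d + 1) → ℝ}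
    (hφ : ContDiff ℝ ∞ φ) (hc : HasCompactSupport φ) (hs : tsupport φ ⊆ halfSpace d)
    (v : Rn (d + 1)) : IntegrableOn (fun X => fderiv ℝ φ X v • U X) (halfSpace d) := by
  have hcont : Continuous fun X => fderiv ℝ φ X v :=
    (hφ.continuous_fderiv (by simp)).clm_apply continuous_const
  have hsub : Function.support (fun X => fderiv ℝ φ X v • U X) ⊆ tsupport φ := by
    intro X hX
    refine support_fderiv_subset ℝ (f := φ) ?_
    intro h0
    apply hX
    simp [h0]
  have hK : IntegrableOn (fun X => fderiv ℝ φ X v • U X) (tsupport φ) :=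
    ((h.locInt.integrableOn_compact_subset hs hc).continuousOn_smul
      hcont.continuousOn hc)
  exact ((integrableOn_iff_integrable_of_support_subset hsub).1 hK).integrableOn

theorem HasWeakGradient.integrable_right {d : ℕ} {U : Rn (d + 1) → ℂ}
    {G : Rn (d + 1) → Cn (d + 1)} (h : HasWeakGradient U G) {φ : Rn (d + 1) → ℝ}
    (hφ : ContDiff ℝ ∞ φ) (hc : HasCompactSupport φ) (hs : tsupport φ ⊆ halfSpace d)
    (j : Fin (d + 1)) : IntegrableOn (fun X => φ X • G X j) (halfSpace d) := by
  have hsub : Function.support (fun X => φ X • G X j) ⊆ tsupport φ := by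
    intro X hX
    refine subset_tsupport _ ?_
    intro h0
    apply hX
    simp [h0]
  have hG : IntegrableOn (fun X => G X j) (tsupport φ) :=
    (EuclideanSpace.proj (𝕜 := ℂ) j).integrable_comp
      (h.locInt_grad.integrableOn_compact_subset hs hc)
  have hK : IntegrableOn (fun X => φ X • G X j) (tsupport φ) :=
    hG.continuousOn_smul hφ.continuous.continuousOn hc
  exact ((integrableOn_iff_integrable_of_support_subset hsub).1 hK).integrableOn

theorem HasWeakGradient.add {d : ℕ} {U V : Rn (d + 1) → ℂ} {G H : Rn (d + 1) → Cn (d + 1)}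
    (hU : HasWeakGradient U G) (hV : HasWeakGradient V H) : HasWeakGradient (U + V) (G + H) where
  locInt := hU.locInt.add hV.locInt
  locInt_grad := hU.locInt_grad.add hV.locInt_grad
  integral_eq φ hφ hc hs j := by
    simp only [Pi.add_apply, PiLp.add_apply, smul_add]
    rw [integral_add (hU.integrable_left hφ hc hs _) (hV.integrable_left hφ hc hs _),
      integral_add (hU.integrable_right hφ hc hs j) (hV.integrable_right hφ hc hs j),
      hU.integral_eq φ hφ hc hs j, hV.integral_eq φ hφ hc hs j, neg_add]

theorem HasWeakGradient.const_smul {d : ℕ} {U : Rn (d + 1) → ℂ} {G : Rn (d + 1) → Cn (d + 1)}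
    (c : ℂ) (hU : HasWeakGradient U G) : HasWeakGradient (c • U) (c • G) where
  locInt := hU.locInt.smul c
  locInt_grad := hU.locInt_grad.smul c
  integral_eq φ hφ hc hs j := by
    simp only [Pi.smul_apply, PiLp.smul_apply]
    simp_rw [smul_comm _ c]
    rw [integral_smul, integral_smul, hU.integral_eq φ hφ hc hs j, smul_neg]

theorem HasWeakGradient.zero (d : ℕ) :
    HasWeakGradient (0 : Rn (d + 1) → ℂ) (0 : Rn (d + 1) → Cn (d + 1)) where
  locInt := fun _ _ => integrableAtFilter_zero
  locInt_grad := fun _ _ => integrableAtFilter_zero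
  integral_eq φ _ _ _ j := by simp

theorem HasWeakGradient.congr {d : ℕ} {U V : Rn (d + 1) → ℂ} {G : Rn (d + 1) → Cn (d + 1)}
    (hU : HasWeakGradient U G) (h : U =ᵐ[halfMeasure d] V) : HasWeakGradient V G where
  locInt := by
    rw [locallyIntegrableOn_iff (isOpen_halfSpace d).isLocallyClosed]
    intro K hK hc
    exact (hU.locInt.integrableOn_compact_subset hK hc).congr (ae_mono (Measure.restrict_mono hK le_rfl) h)
  locInt_grad := hU.locInt_grad
  integral_eq φ hφ hc hs j := by
    rw [← hU.integral_eq φ hφ hc hs j]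
    refine integral_congr_ae ?_
    filter_upwards [h] with X hX
    rw [hX]

theorem HasWeakGradient.unique {d : ℕ} {U : Rn (d + 1) → ℂ} {G H : Rn (d + 1) → Cn (d + 1)}
    (hG : HasWeakGradient U G) (hH : HasWeakGradient U H) : G =ᵐ[halfMeasure d] H := by
  have key : ∀ j : Fin (d + 1), ∀ᵐ X, X ∈ halfSpace d → G X j - H X j = 0 := by
    intro j
    refine IsOpen.ae_eq_zero_of_integral_contDiff_smul_eq_zero (isOpen_halfSpace d) ?_ ?_
    · rw [locallyIntegrableOn_iff (isOpen_halfSpace d).isLocallyClosed]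
      intro K hK hc
      exact (EuclideanSpace.proj (𝕜 := ℂ) j).integrable_comp
        ((hG.locInt_grad.sub hH.locInt_grad).integrableOn_compact_subset hK hc)
    · intro φ hφ hc hs
      have h0 : ∫ X in halfSpace d, φ X • (G X j - H X j) = 0 := by
        simp only [smul_sub]
        rw [integral_sub (hG.integrable_right hφ hc hs j) (hH.integrable_right hφ hc hs j),
          sub_eq_zero, ← neg_inj, ← hG.integral_eq φ hφ hc hs j, ← hH.integral_eq φ hφ hc hs j]
      rw [← h0, eq_comm]
      refine setIntegral_eq_integral_of_forall_compl_eq_zero fun X hX => ?_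
      have : φ X = 0 := by
        by_contra hne
        exact hX (hs (subset_tsupport _ hne))
      simp [this]
  rw [Filter.EventuallyEq, ae_restrict_iff' (measurableSet_halfSpace d)]
  filter_upwards [ae_all_iff.2 key] with X hX hm
  ext j
  exact sub_eq_zero.1 (hX j hm)

theorem hasWeakGradient_weakGradient {d : ℕ} {U : Rn (d + 1) → ℂ}
    (h : ∃ G, HasWeakGradient U G) : HasWeakGradient U (weakGradient U) := by
  unfold weakGradient
  rw [dif_pos h]
  exact h.choose_spec

theorem HasWeakGradient.weakGradient_ae {d : ℕ} {U V : Rn (d + 1) → ℂ}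
    {G : Rn (d + 1) → Cn (d + 1)} (hU : HasWeakGradient U G) (h : U =ᵐ[halfMeasure d] V) :
    weakGradient V =ᵐ[halfMeasure d] G :=
  (hasWeakGradient_weakGradient ⟨G, hU.congr h⟩).unique (hU.congr h)

theorem covGradient_add_ae {d : ℕ} (A : Rn (d + 1) → Rn (d + 1)) {U V W : Rn (d + 1) → ℂ}
    (hU : ∃ G, HasWeakGradient U G) (hV : ∃ G, HasWeakGradient V G)
    (h : U + V =ᵐ[halfMeasure d] W) :
    covGradient A W =ᵐ[halfMeasure d] covGradient A U + covGradient A V := by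
  filter_upwards [h, ((hasWeakGradient_weakGradient hU).add
    (hasWeakGradient_weakGradient hV)).weakGradient_ae h] with X h1 h2
  ext j
  simp only [covGradient, h2, ← h1, Pi.add_apply, PiLp.add_apply]
  ring

theorem covGradient_smul_ae {d : ℕ} (A : Rn (d + 1) → Rn (d + 1)) {U W : Rn (d + 1) → ℂ} (c : ℂ)
    (hU : ∃ G, HasWeakGradient U G) (h : c • U =ᵐ[halfMeasure d] W) :
    covGradient A W =ᵐ[halfMeasure d] c • covGradient A U := by
  filter_upwards [h, ((hasWeakGradient_weakGradient hU).const_smul c).weakGradient_ae h]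
    with X h1 h2
  ext j
  simp only [covGradient, h2, ← h1, Pi.smul_apply, PiLp.add_apply, PiLp.smul_apply, smul_eq_mul]
  ring

/-- The weighted magnetic Sobolev space `W^{1,p}_{A,γ}(ℝ^{d+1}_+)`: the (classes of) functions
`U ∈ W^{1,1}_loc(ℝ^{d+1}_+, ℂ)` such that `U` and `∇_A U` are `p`-integrable for `t^γ dx dt`. -/
def magneticSobolev {d : ℕ} (A : Rn (d + 1) → Rn (d + 1)) (γ : ℝ) (p : ℝ≥0∞) :
    Submodule ℂ (Rn (d + 1) →ₘ[halfMeasure d] ℂ) where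
  carrier := {U | (∃ G, HasWeakGradient U G) ∧ MemLp U p (weightedMeasure d γ) ∧
    MemLp (covGradient A U) p (weightedMeasure d γ)}
  add_mem' := by
    rintro U V ⟨hU, hU1, hU2⟩ ⟨hV, hV1, hV2⟩
    have h : (U : Rn (d + 1) → ℂ) + (V : Rn (d + 1) → ℂ) =ᵐ[halfMeasure d] ↑(U + V) := (AEEqFun.coeFn_add U V).symm
    obtain ⟨G, hG⟩ := hU
    obtain ⟨H, hH⟩ := hV
    refine ⟨⟨G + H, (hG.add hH).congr h⟩,
      (hU1.add hV1).ae_eq ((weightedMeasure_ac d γ).ae_le h), (hU2.add hV2).ae_eq ?_⟩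
    exact (weightedMeasure_ac d γ).ae_le (covGradient_add_ae A ⟨G, hG⟩ ⟨H, hH⟩ h).symm
  zero_mem' := by
    have h : (0 : Rn (d + 1) → ℂ) =ᵐ[halfMeasure d] ↑(0 : Rn (d + 1) →ₘ[halfMeasure d] ℂ) :=
      AEEqFun.coeFn_zero.symm
    have hz := HasWeakGradient.zero d
    refine ⟨⟨0, hz.congr h⟩, MemLp.zero.ae_eq ((weightedMeasure_ac d γ).ae_le h), ?_⟩
    refine (MemLp.zero (ε := Cn (d + 1))).ae_eq ((weightedMeasure_ac d γ).ae_le ?_)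
    filter_upwards [h, hz.weakGradient_ae h] with X h1 h2
    ext j
    simp [covGradient, h2, ← h1]
  smul_mem' := by
    rintro c U ⟨⟨G, hG⟩, hU1, hU2⟩
    have h : c • (U : Rn (d + 1) → ℂ) =ᵐ[halfMeasure d] ↑(c • U) := (AEEqFun.coeFn_smul c U).symm
    refine ⟨⟨c • G, (hG.const_smul c).congr h⟩,
      (hU1.const_smul c).ae_eq ((weightedMeasure_ac d γ).ae_le h), (hU2.const_smul c).ae_eq ?_⟩
    exact (weightedMeasure_ac d γ).ae_le (covGradient_smul_ae A c ⟨G, hG⟩ h).symm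

/-- The linear embedding `U ↦ (U, ∇_A U)` of `W^{1,p}_{A,γ}` into a product of `L^p` spaces. -/
def magneticSobolevEmb {d : ℕ} (A : Rn (d + 1) → Rn (d + 1)) (γ : ℝ) (p : ℝ≥0∞) :
    magneticSobolev A γ p →ₗ[ℂ]
      WithLp p (Lp ℂ p (weightedMeasure d γ) × Lp (Cn (d + 1)) p (weightedMeasure d γ)) where
  toFun U := WithLp.toLp p (U.2.2.1.toLp _, U.2.2.2.toLp _)
  map_add' U V := by
    have h := (AEEqFun.coeFn_add U.1 V.1).symm
    rw [← WithLp.toLp_add, Prod.mk_add_mk, ← MemLp.toLp_add, ← MemLp.toLp_add]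
    congr 2
    · exact MemLp.toLp_congr _ _ ((weightedMeasure_ac d γ).ae_le h.symm)
    · exact MemLp.toLp_congr _ _
        ((weightedMeasure_ac d γ).ae_le (covGradient_add_ae A U.2.1 V.2.1 h))
  map_smul' c U := by
    have h := (AEEqFun.coeFn_smul c U.1).symm
    rw [RingHom.id_apply, ← WithLp.toLp_smul, Prod.smul_mk, ← MemLp.toLp_const_smul,
      ← MemLp.toLp_const_smul]
    congr 2
    · exact MemLp.toLp_congr _ _ ((weightedMeasure_ac d γ).ae_le h.symm)
    · exact MemLp.toLp_congr _ _
        ((weightedMeasure_ac d γ).ae_le (covGradient_smul_ae A c U.2.1 h))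

theorem magneticSobolevEmb_injective {d : ℕ} (A : Rn (d + 1) → Rn (d + 1)) (γ : ℝ) (p : ℝ≥0∞) :
    Function.Injective (magneticSobolevEmb A γ p) := by
  intro U V h
  have h1 : U.2.2.1.toLp _ = V.2.2.1.toLp _ := congrArg (fun w => (WithLp.ofLp w).1) h
  rw [MemLp.toLp_eq_toLp_iff] at h1
  exact Subtype.ext (AEEqFun.ext ((ac_weightedMeasure d γ).ae_le h1))

/-- The norm of `W^{1,p}_{A,γ}`; see `magneticSobolev_enorm_rpow` for the explicit formula. -/
instance {d : ℕ} (A : Rn (d + 1) → Rn (d + 1)) (γ : ℝ) (p : ℝ≥0∞) [Fact (1 ≤ p)] :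
    NormedAddCommGroup (magneticSobolev A γ p) :=
  NormedAddCommGroup.induced _ _ (magneticSobolevEmb A γ p) (magneticSobolevEmb_injective A γ p)

instance {d : ℕ} (A : Rn (d + 1) → Rn (d + 1)) (γ : ℝ) (p : ℝ≥0∞) [Fact (1 ≤ p)] :
    NormedSpace ℂ (magneticSobolev A γ p) :=
  NormedSpace.induced ℂ _ _ (magneticSobolevEmb A γ p)

theorem enorm_rpow_prod {α β E F : Type*} [MeasurableSpace α] [MeasurableSpace β]
    [NormedAddCommGroup E] [NormedAddCommGroup F]
    {μ : Measure α} {ν : Measure β} {p : ℝ≥0∞} [hp1 : Fact (1 ≤ p)] (hp : p ≠ ⊤)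
    {f : α → E} {g : β → F} (hf : MemLp f p μ) (hg : MemLp g p ν) :
    ‖WithLp.toLp p (hf.toLp f, hg.toLp g)‖ₑ ^ p.toReal =
      (∫⁻ x, ‖f x‖ₑ ^ p.toReal ∂μ) + ∫⁻ y, ‖g y‖ₑ ^ p.toReal ∂ν := by
  have hp0 : p ≠ 0 := (zero_lt_one.trans_le hp1.out).ne'
  have hpos : 0 < p.toReal := ENNReal.toReal_pos hp0 hp
  have e : ‖WithLp.toLp p (hf.toLp f, hg.toLp g)‖ₑ ^ p.toReal =
      ‖hf.toLp f‖ₑ ^ p.toReal + ‖hg.toLp g‖ₑ ^ p.toReal := by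
    rw [enorm_eq_nnnorm, WithLp.prod_nnnorm_eq_add hp, enorm_eq_nnnorm, enorm_eq_nnnorm,
      ← ENNReal.coe_rpow_of_nonneg _ hpos.le, ← ENNReal.coe_rpow_of_nonneg _ hpos.le,
      ← ENNReal.coe_rpow_of_nonneg _ hpos.le, ← NNReal.rpow_mul, one_div,
      inv_mul_cancel₀ hpos.ne', NNReal.rpow_one, ENNReal.coe_add]
    rfl
  rw [e, Lp.enorm_toLp, Lp.enorm_toLp, eLpNorm_eq_lintegral_rpow_enorm_toReal hp0 hp,
    eLpNorm_eq_lintegral_rpow_enorm_toReal hp0 hp, ← ENNReal.rpow_mul, ← ENNReal.rpow_mul,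
    one_div, inv_mul_cancel₀ hpos.ne', ENNReal.rpow_one, ENNReal.rpow_one]

/-- `‖U‖^p = ∬ (|U|^p + |∇_A U|^p) t^γ dx dt`. -/
theorem magneticSobolev_enorm_rpow {d : ℕ} (A : Rn (d + 1) → Rn (d + 1)) (γ : ℝ) (p : ℝ≥0∞)
    [Fact (1 ≤ p)] (hp : p ≠ ⊤) (U : magneticSobolev A γ p) :
    ‖U‖ₑ ^ p.toReal = ∫⁻ X in halfSpace d,
      (‖U.1 X‖ₑ ^ p.toReal + ‖covGradient A U.1 X‖ₑ ^ p.toReal) *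
        ENNReal.ofReal (X (Fin.last d) ^ γ) := by
  have h : ‖U‖ₑ = ‖WithLp.toLp p (U.2.2.1.toLp _, U.2.2.2.toLp _)‖ₑ := rfl
  have hm := (U.1.aestronglyMeasurable.enorm).pow_const p.toReal
  rw [h, enorm_rpow_prod hp, ← lintegral_add_left' (hm.mono_ac (weightedMeasure_ac d γ)),
    weightedMeasure, lintegral_withDensity_eq_lintegral_mul_non_measurable₀ _
      (measurable_weight d γ).aemeasurable (by simp)]
  simp only [Pi.mul_apply, mul_comm]

/-! ### The fractional magnetic Sobolev space on the boundary -/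

/-- The Gagliardo energy
`|u|^p_{W^{s,p}_a} = ∬ |e^{i I_a(x, y)} u(y) - u(x)|^p / |y - x|^{n + sp} dx dy`. -/
def gagliardo {n : ℕ} (a : Rn n → Rn n) (s : ℝ) (p : ℝ≥0∞) (u : Rn n → ℂ) : ℝ≥0∞ :=
  ∫⁻ z : Rn n × Rn n,
    ‖covDiff a u z‖ₑ ^ p.toReal / ‖z.2 - z.1‖ₑ ^ ((n : ℝ) + s * p.toReal)

/-- The measure `|y - x|^{-(n + sp)} dx dy` on `ℝⁿ × ℝⁿ`. -/
def gagliardoMeasure (n : ℕ) (s : ℝ) (p : ℝ≥0∞) : Measure (Rn n × Rn n) :=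
  volume.withDensity fun z => (‖z.2 - z.1‖ₑ ^ ((n : ℝ) + s * p.toReal))⁻¹

theorem gagliardoMeasure_ac (n : ℕ) (s : ℝ) (p : ℝ≥0∞) :
    gagliardoMeasure n s p ≪ (volume : Measure (Rn n × Rn n)) :=
  withDensity_absolutelyContinuous _ _

theorem covDiff_ae {n : ℕ} (a : Rn n → Rn n) (s : ℝ) (p : ℝ≥0∞) {u v : Rn n → ℂ}
    (h : u =ᵐ[volume] v) : covDiff a u =ᵐ[gagliardoMeasure n s p] covDiff a v := by
  refine (gagliardoMeasure_ac n s p).ae_le ?_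
  have h1 := (Measure.quasiMeasurePreserving_fst (μ := (volume : Measure (Rn n)))
    (ν := (volume : Measure (Rn n)))).ae_eq_comp h
  have h2 := (Measure.quasiMeasurePreserving_snd (μ := (volume : Measure (Rn n)))
    (ν := (volume : Measure (Rn n)))).ae_eq_comp h
  filter_upwards [h1, h2] with z e1 e2
  simp only [Function.comp_apply] at e1 e2
  simp only [covDiff, e1, e2]

theorem covDiff_add {n : ℕ} (a : Rn n → Rn n) (u v : Rn n → ℂ) :
    covDiff a (u + v) = covDiff a u + covDiff a v := by
  ext z
  simp only [covDiff, Pi.add_apply]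
  ring

theorem covDiff_smul {n : ℕ} (a : Rn n → Rn n) (c : ℂ) (u : Rn n → ℂ) :
    covDiff a (c • u) = c • covDiff a u := by
  ext z
  simp only [covDiff, Pi.smul_apply, smul_eq_mul]
  ring

/-- The fractional magnetic Sobolev space `W^{s,p}_a(ℝⁿ)`: the (classes of) functions
`u ∈ L^p(ℝⁿ, ℂ)` with finite Gagliardo energy. (For continuous `a` the covariant difference is
automatically measurable, so that the last condition just says `gagliardo a s p u < ∞`.) -/
def fracMagneticSobolev {n : ℕ} (a : Rn n → Rn n) (s : ℝ) (p : ℝ≥0∞) :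
    Submodule ℂ (Rn n →ₘ[volume] ℂ) where
  carrier := {u | MemLp u p volume ∧ MemLp (covDiff a u) p (gagliardoMeasure n s p)}
  add_mem' := by
    rintro u v ⟨hu1, hu2⟩ ⟨hv1, hv2⟩
    have h : (u : Rn n → ℂ) + (v : Rn n → ℂ) =ᵐ[volume] ↑(u + v) := (AEEqFun.coeFn_add u v).symm
    refine ⟨(hu1.add hv1).ae_eq h, (hu2.add hv2).ae_eq ?_⟩
    rw [← covDiff_add]
    exact covDiff_ae a s p h
  zero_mem' := by
    have h : (0 : Rn n → ℂ) =ᵐ[volume] ↑(0 : Rn n →ₘ[volume] ℂ) := AEEqFun.coeFn_zero.symm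
    refine ⟨MemLp.zero.ae_eq h, (MemLp.zero (ε := ℂ)).ae_eq ?_⟩
    have h0 : covDiff a (0 : Rn n → ℂ) = 0 := by
      ext z
      simp [covDiff]
    rw [← h0]
    exact covDiff_ae a s p h
  smul_mem' := by
    rintro c u ⟨hu1, hu2⟩
    have h : c • (u : Rn n → ℂ) =ᵐ[volume] ↑(c • u) := (AEEqFun.coeFn_smul c u).symm
    refine ⟨(hu1.const_smul c).ae_eq h, (hu2.const_smul c).ae_eq ?_⟩
    rw [← covDiff_smul]
    exact covDiff_ae a s p h

/-- The linear embedding of `W^{s,p}_a` into a product of `L^p` spaces that sends `u` to the pair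
of `u` and its covariant differences. -/
def fracMagneticSobolevEmb {n : ℕ} (a : Rn n → Rn n) (s : ℝ) (p : ℝ≥0∞) :
    fracMagneticSobolev a s p →ₗ[ℂ]
      WithLp p (Lp ℂ p (volume : Measure (Rn n)) × Lp ℂ p (gagliardoMeasure n s p)) where
  toFun u := WithLp.toLp p (u.2.1.toLp _, u.2.2.toLp _)
  map_add' u v := by
    have h := AEEqFun.coeFn_add u.1 v.1
    rw [← WithLp.toLp_add, Prod.mk_add_mk, ← MemLp.toLp_add, ← MemLp.toLp_add]
    congr 2
    · exact MemLp.toLp_congr _ _ h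
    · refine MemLp.toLp_congr _ _ ?_
      rw [← covDiff_add]
      exact covDiff_ae a s p h
  map_smul' c u := by
    have h := AEEqFun.coeFn_smul c u.1
    rw [RingHom.id_apply, ← WithLp.toLp_smul, Prod.smul_mk, ← MemLp.toLp_const_smul,
      ← MemLp.toLp_const_smul]
    congr 2
    · exact MemLp.toLp_congr _ _ h
    · refine MemLp.toLp_congr _ _ ?_
      rw [← covDiff_smul]
      exact covDiff_ae a s p h

theorem fracMagneticSobolevEmb_injective {n : ℕ} (a : Rn n → Rn n) (s : ℝ) (p : ℝ≥0∞) :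
    Function.Injective (fracMagneticSobolevEmb a s p) := by
  intro u v h
  have h1 : u.2.1.toLp _ = v.2.1.toLp _ := congrArg (fun w => (WithLp.ofLp w).1) h
  rw [MemLp.toLp_eq_toLp_iff] at h1
  exact Subtype.ext (AEEqFun.ext h1)

/-- The norm of `W^{s,p}_a`; see `fracMagneticSobolev_enorm_rpow` for the explicit formula. -/
instance {n : ℕ} (a : Rn n → Rn n) (s : ℝ) (p : ℝ≥0∞) [Fact (1 ≤ p)] :
    NormedAddCommGroup (fracMagneticSobolev a s p) :=
  NormedAddCommGroup.induced _ _ (fracMagneticSobolevEmb a s p)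
    (fracMagneticSobolevEmb_injective a s p)

instance {n : ℕ} (a : Rn n → Rn n) (s : ℝ) (p : ℝ≥0∞) [Fact (1 ≤ p)] :
    NormedSpace ℂ (fracMagneticSobolev a s p) :=
  NormedSpace.induced ℂ _ _ (fracMagneticSobolevEmb a s p)

/-- `‖u‖^p = ∫ |u|^p + |u|^p_{W^{s,p}_a}`. -/
theorem fracMagneticSobolev_enorm_rpow {n : ℕ} (a : Rn n → Rn n) (s : ℝ) (p : ℝ≥0∞)
    [Fact (1 ≤ p)] (hp : p ≠ ⊤) (u : fracMagneticSobolev a s p) :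
    ‖u‖ₑ ^ p.toReal = (∫⁻ x, ‖u.1 x‖ₑ ^ p.toReal) + gagliardo a s p u.1 := by
  have h : ‖u‖ₑ = ‖WithLp.toLp p (u.2.1.toLp _, u.2.2.toLp _)‖ₑ := rfl
  have hw : Measurable fun z : Rn n × Rn n =>
      (‖z.2 - z.1‖ₑ ^ ((n : ℝ) + s * p.toReal))⁻¹ := by fun_prop
  have hm : AEMeasurable (fun z => ‖covDiff a u.1 z‖ₑ ^ p.toReal) (gagliardoMeasure n s p) :=
    (u.2.2.aestronglyMeasurable.enorm).pow_const p.toReal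
  rw [h, enorm_rpow_prod hp, gagliardoMeasure,
    lintegral_withDensity_eq_lintegral_mul₀' hw.aemeasurable hm, gagliardo]
  simp only [Pi.mul_apply, mul_comm, div_eq_mul_inv]

end MagneticTrace

end

open MagneticTrace

open MeasureTheory Set
open scoped ENNReal NNReal ContDiff

noncomputable section

namespace MagneticTrace

/-! Two facts carry the proof. First, along a segment the transport factor `e^{i I_A}` turns the
covariant derivative into an ordinary one, so `|e^{i I_A(X, Y)} U(Y) - U(X)|` is at most the line
integral of `|∇_A U|`, just as without a field (`enorm_cov_sub_le_of_line`). Second, transports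
along different paths disagree only by the flux of `dA` between them: around a triangle the
circulation is at most `β` times the product of two side lengths (`CurlBound.abs_triangle_le`). The
natural length is `β^{-1/2}`, the size at which such fluxes become of order one; this is where the
powers of `β` in the estimates come from.

Trace. The weight `t^{(1-s)p-1}` is weak enough that, by Hölder, functions of finite energy are
absolutely continuous up to the boundary on almost every vertical line, and their limits define the
trace `u`. Averaging over heights in `(0, T]` bounds `‖u‖_p`, and `T = β^{-1/2}` gives the term
`β^{sp/2} ‖u‖^p`. For the seminorm, `u(x)` and `u(x + h)` are compared by going up to a height `t`
between `|h|` and `2|h|`, across, and down again. The three sides cost line integrals of `|∇_A U|`,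
and replacing the base of the rectangle by the other three sides costs a phase at most `min(2, 12 β
|h|²)`, multiplied by `|u(x + h)|`. Averaging in `t`, integrating against `|h|^{-d-sp}` and
exchanging the integrals in `h` and `t` recovers the weighted energy; the phase term integrates to a
multiple of `β^{sp/2} ‖u‖^p` by scaling. These are `HasWeakGradient.lintegral_boundaryTrace_le` and
`HasWeakGradient.lintegral_covDiff_div_le`.

Extension. The extension is a damped magnetic convolution, `U(x, t) = e^{-bt} ∫ κ(x - y, t) e^{i
I((x, t), (y, 0))} u(y) dy` with `b = √β`. In `∇_A U` the derivative of the phase cancels `iA` up to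
`β |X - Y|`, and `∫ ∇κ = 0` allows the transported value of `u` at the foot point `x` to be
subtracted, which produces covariant differences of `u` and another flux error. The damping absorbs
the growth of these errors in `t`, since `β t e^{-bt} ≤ 2 b e^{-bt/2}`
(`enorm_dotC_covField_extend_le`). The covariant differences then integrate to the Gagliardo energy,
and the error terms to `β^{sp/2} ‖u‖^p`. The trace of `U` is `u` because `|U(x, t) - e^{-bt} e^{iI}
u(x)| ≤ M t Q(t)` with `Q` integrable near `0` on almost every line, which is incompatible with a
nonzero limit as `1/t` is not integrable.

So that potentials can be differentiated at every point, `A` is first replaced by a `C¹` extension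
`B` to the whole space, obtained by a first-order reflection; only values on the closed half-space
ever matter. The real exponent is called `q`. -/

/-! ### Coordinates `(x, t)` on the half-space -/

/-- The point `(x, t)` of `ℝ^{d+1}`. -/
def pt {d : ℕ} (x : Rn d) (t : ℝ) : Rn (d + 1) :=
  WithLp.toLp 2 (Fin.snoc (α := fun _ => ℝ) (fun j => x j) t)

/-- The horizontal part `x` of the point `(x, t)`. -/
def hor (d : ℕ) : Rn (d + 1) →L[ℝ] Rn d :=
  LinearMap.toContinuousLinearMap
    { toFun := fun X => WithLp.toLp 2 fun j => X j.castSucc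
      map_add' := fun _ _ => by ext; simp
      map_smul' := fun _ _ => by ext; simp }

theorem bdry_eq_pt {d : ℕ} (x : Rn d) : bdry x = pt x 0 := rfl

@[simp]
theorem pt_last {d : ℕ} (x : Rn d) (t : ℝ) : pt x t (Fin.last d) = t := by simp [pt]

@[simp]
theorem pt_castSucc {d : ℕ} (x : Rn d) (t : ℝ) (j : Fin d) : pt x t j.castSucc = x j := by
  simp [pt]

@[simp]
theorem hor_apply {d : ℕ} (X : Rn (d + 1)) (j : Fin d) : hor d X j = X j.castSucc := rfl

@[simp]
theorem hor_pt {d : ℕ} (x : Rn d) (t : ℝ) : hor d (pt x t) = x := by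
  ext j
  simp

@[simp]
theorem pt_hor {d : ℕ} (X : Rn (d + 1)) : pt (hor d X) (X (Fin.last d)) = X := by
  ext j
  refine Fin.lastCases ?_ (fun j => ?_) j <;> simp

theorem pt_add {d : ℕ} (x y : Rn d) (t r : ℝ) : pt (x + y) (t + r) = pt x t + pt y r := by
  ext j
  refine Fin.lastCases ?_ (fun j => ?_) j <;> simp

theorem pt_sub {d : ℕ} (x y : Rn d) (t r : ℝ) : pt (x - y) (t - r) = pt x t - pt y r := by
  ext j
  refine Fin.lastCases ?_ (fun j => ?_) j <;> simp

theorem pt_smul {d : ℕ} (c : ℝ) (x : Rn d) (t : ℝ) : pt (c • x) (c * t) = c • pt x t := by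
  ext j
  refine Fin.lastCases ?_ (fun j => ?_) j <;> simp

theorem norm_pt_sq {d : ℕ} (x : Rn d) (t : ℝ) : ‖pt x t‖ ^ 2 = ‖x‖ ^ 2 + t ^ 2 := by
  simp [EuclideanSpace.norm_sq_eq, Fin.sum_univ_castSucc]

theorem norm_pt_zero {d : ℕ} (x : Rn d) : ‖pt x 0‖ = ‖x‖ := by
  have := norm_pt_sq x 0
  simpa using this

theorem norm_pt_zero_left {d : ℕ} (t : ℝ) : ‖pt (0 : Rn d) t‖ = |t| := by
  have := norm_pt_sq (0 : Rn d) t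
  simpa [sq_eq_sq_iff_abs_eq_abs] using this

theorem norm_pt_le {d : ℕ} (x : Rn d) (t : ℝ) : ‖pt x t‖ ≤ ‖x‖ + |t| := by
  have := norm_add_le (pt x 0) (pt 0 t)
  rwa [← pt_add, add_zero, zero_add, norm_pt_zero, norm_pt_zero_left] at this

theorem norm_hor_le {d : ℕ} (X : Rn (d + 1)) : ‖hor d X‖ ≤ ‖X‖ := by
  have h := norm_pt_sq (hor d X) (X (Fin.last d))
  rw [pt_hor] at h
  exact abs_le_of_sq_le_sq' (by nlinarith [sq_nonneg (X (Fin.last d))]) (norm_nonneg _) |>.2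

theorem abs_last_le {d : ℕ} (X : Rn (d + 1)) : |X (Fin.last d)| ≤ ‖X‖ := by
  simpa using PiLp.norm_apply_le X (Fin.last d)

theorem pt_mem_halfSpace {d : ℕ} {x : Rn d} {t : ℝ} : pt x t ∈ halfSpace d ↔ 0 < t := by
  simp [halfSpace]

theorem pt_mem_closedHalfSpace {d : ℕ} {x : Rn d} {t : ℝ} :
    pt x t ∈ closedHalfSpace d ↔ 0 ≤ t := by
  simp [closedHalfSpace]

theorem isClosed_closedHalfSpace (d : ℕ) : IsClosed (closedHalfSpace d) := by
  unfold closedHalfSpace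
  exact isClosed_le continuous_const (by fun_prop)

theorem halfSpace_subset_closedHalfSpace (d : ℕ) : halfSpace d ⊆ closedHalfSpace d :=
  fun X (hX : 0 < X (Fin.last d)) => hX.le

/-- The linear coordinates `(x, t) ↦ pt x t`. -/
def ptEquiv (d : ℕ) : (Rn d × ℝ) ≃L[ℝ] Rn (d + 1) :=
  LinearEquiv.toContinuousLinearEquiv
    { toFun := fun z => pt z.1 z.2
      invFun := fun X => (hor d X, X (Fin.last d))
      map_add' := fun _ _ => pt_add _ _ _ _
      map_smul' := fun _ _ => pt_smul _ _ _
      left_inv := fun _ => by simp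
      right_inv := fun _ => by simp }

@[simp]
theorem ptEquiv_apply {d : ℕ} (z : Rn d × ℝ) : ptEquiv d z = pt z.1 z.2 := rfl

@[fun_prop]
theorem continuous_pt_comp {d : ℕ} {α : Type*} [TopologicalSpace α] {f : α → Rn d} {g : α → ℝ}
    (hf : Continuous f) (hg : Continuous g) : Continuous fun a => pt (f a) (g a) :=
  (ptEquiv d).continuous.comp (hf.prodMk hg)

@[fun_prop]
theorem measurable_pt_comp {d : ℕ} {α : Type*} [MeasurableSpace α] {f : α → Rn d} {g : α → ℝ}
    (hf : Measurable f) (hg : Measurable g) : Measurable fun a => pt (f a) (g a) :=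
  (ptEquiv d).continuous.measurable.comp (hf.prodMk hg)

theorem measurePreserving_pt (d : ℕ) :
    MeasurePreserving (fun z : Rn d × ℝ => pt z.1 z.2) (volume.prod volume) volume := by
  have h1 : MeasurePreserving (fun z : Rn d × ℝ => (z.2, WithLp.ofLp z.1))
      (volume.prod volume) (volume.prod volume) :=
    ((MeasurePreserving.id volume).prod
      (EuclideanSpace.volume_preserving_symm_measurableEquiv_toLp (Fin d))).comp
      Measure.measurePreserving_swap
  have h2 := (volume_preserving_piFinSuccAbove (fun _ : Fin (d + 1) => ℝ) (Fin.last d)).symm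
  have h3 := (EuclideanSpace.volume_preserving_symm_measurableEquiv_toLp (Fin (d + 1))).symm
  have h4 := (h3.comp h2).comp h1
  have e : (fun z : Rn d × ℝ => pt z.1 z.2) =
      ((MeasurableEquiv.toLp 2 (Fin (d + 1) → ℝ)).symm.symm ∘
        (MeasurableEquiv.piFinSuccAbove (fun _ => ℝ) (Fin.last d)).symm) ∘
        fun z : Rn d × ℝ => (z.2, WithLp.ofLp z.1) := by
    funext z
    ext j
    refine Fin.lastCases ?_ (fun j => ?_) j <;>
      simp [MeasurableEquiv.piFinSuccAbove_symm_apply, Fin.insertNthEquiv]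
  rw [e]
  exact h4

theorem measurableEmbedding_pt (d : ℕ) : MeasurableEmbedding fun z : Rn d × ℝ => pt z.1 z.2 :=
  (ptEquiv d).toHomeomorph.measurableEmbedding

/-- Lebesgue measure on `(0, ∞)`. -/
abbrev halfLine : Measure ℝ := volume.restrict (Ioi 0)

theorem measurePreserving_pt_half (d : ℕ) :
    MeasurePreserving (fun z : Rn d × ℝ => pt z.1 z.2) (volume.prod halfLine) (halfMeasure d) := by
  have h := (measurePreserving_pt d).restrict_preimage_emb (measurableEmbedding_pt d) (halfSpace d)
  have e : (fun z : Rn d × ℝ => pt z.1 z.2) ⁻¹' halfSpace d = univ ×ˢ Ioi 0 := by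
    ext z
    simp [pt_mem_halfSpace]
  rw [e, ← Measure.prod_restrict, Measure.restrict_univ] at h
  exact h

theorem ae_half_iff {d : ℕ} {q : Rn (d + 1) → Prop} :
    (∀ᵐ X ∂halfMeasure d, q X) ↔ ∀ᵐ z ∂(volume : Measure (Rn d)).prod halfLine, q (pt z.1 z.2) := by
  rw [← (measurePreserving_pt_half d).map_eq, (measurableEmbedding_pt d).ae_map_iff]

theorem lintegral_half_prod {d : ℕ} (f : Rn (d + 1) → ℝ≥0∞) :
    ∫⁻ X in halfSpace d, f X =
      ∫⁻ z, f (pt z.1 z.2) ∂(volume : Measure (Rn d)).prod halfLine :=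
  ((measurePreserving_pt_half d).lintegral_comp_emb (measurableEmbedding_pt d) f).symm

theorem lintegral_half {d : ℕ} {f : Rn (d + 1) → ℝ≥0∞} (hf : AEMeasurable f (halfMeasure d)) :
    ∫⁻ X in halfSpace d, f X = ∫⁻ x : Rn d, ∫⁻ t in Ioi (0 : ℝ), f (pt x t) := by
  rw [lintegral_half_prod, lintegral_prod]
  exact hf.comp_quasiMeasurePreserving (measurePreserving_pt_half d).quasiMeasurePreserving

theorem lintegral_half_symm {d : ℕ} {f : Rn (d + 1) → ℝ≥0∞} (hf : AEMeasurable f (halfMeasure d)) :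
    ∫⁻ X in halfSpace d, f X = ∫⁻ t in Ioi (0 : ℝ), ∫⁻ x : Rn d, f (pt x t) := by
  rw [lintegral_half_prod, lintegral_prod_symm]
  exact hf.comp_quasiMeasurePreserving (measurePreserving_pt_half d).quasiMeasurePreserving

/-! ### Inequalities in `ℝ≥0∞` -/

/-- Jensen's inequality for the power function. -/
theorem lintegral_rpow_le_measure_rpow_mul {α : Type*} [MeasurableSpace α] {μ : Measure α}
    {f : α → ℝ≥0∞} (hf : AEMeasurable f μ) {q : ℝ} (hq : 1 ≤ q) :
    (∫⁻ x, f x ∂μ) ^ q ≤ μ univ ^ (q - 1) * ∫⁻ x, f x ^ q ∂μ := by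
  rcases hq.eq_or_lt with rfl | hq
  · simp
  have hc := Real.HolderConjugate.conjExponent hq
  have h := ENNReal.lintegral_mul_le_Lp_mul_Lq μ hc hf (aemeasurable_const (b := (1 : ℝ≥0∞)))
  have hq0 : 0 < q := zero_lt_one.trans hq
  calc (∫⁻ x, f x ∂μ) ^ q
      ≤ ((∫⁻ x, f x ^ q ∂μ) ^ (1 / q) * (μ univ) ^ (1 / q.conjExponent)) ^ q := by
        refine ENNReal.rpow_le_rpow ?_ hq0.le
        simpa using h
    _ = μ univ ^ (q - 1) * ∫⁻ x, f x ^ q ∂μ := by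
        rw [ENNReal.mul_rpow_of_nonneg _ _ hq0.le, ← ENNReal.rpow_mul, ← ENNReal.rpow_mul,
          one_div_mul_cancel hq0.ne', ENNReal.rpow_one, mul_comm]
        congr 2
        have := hc.symm.one_sub_inv
        rw [Real.conjExponent]
        field_simp

/-- The convexity constant `2 ^ (q - 1)` is weakened to `2 ^ q` so that iterating it produces `4 ^
q` and `8 ^ q`. -/
theorem rpow_add_le {q : ℝ} (hq : 1 ≤ q) (a b : ℝ≥0∞) : (a + b) ^ q ≤ 2 ^ q * (a ^ q + b ^ q) :=
  (ENNReal.rpow_add_le_mul_rpow_add_rpow a b hq).trans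
    (mul_le_mul_left (ENNReal.rpow_le_rpow_of_exponent_le one_le_two (by linarith)) _)

theorem rpow_add_three_le {q : ℝ} (hq : 1 ≤ q) (a b c : ℝ≥0∞) :
    (a + b + c) ^ q ≤ 4 ^ q * (a ^ q + b ^ q + c ^ q) := by
  have h4 : (4 : ℝ≥0∞) ^ q = 2 ^ q * 2 ^ q := by
    rw [← ENNReal.mul_rpow_of_nonneg _ _ (by linarith)]
    norm_num
  have h2 : (1 : ℝ≥0∞) ≤ 2 ^ q := ENNReal.one_le_rpow one_le_two (by linarith)
  calc (a + b + c) ^ q ≤ 2 ^ q * ((a + b) ^ q + c ^ q) := rpow_add_le hq _ _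
    _ ≤ 2 ^ q * (2 ^ q * (a ^ q + b ^ q) + 2 ^ q * c ^ q) := by
        gcongr
        · exact rpow_add_le hq _ _
        · exact le_mul_of_one_le_left' h2
    _ = _ := by rw [h4]; ring

theorem rpow_add_four_le {q : ℝ} (hq : 1 ≤ q) (a b c e : ℝ≥0∞) :
    (a + b + c + e) ^ q ≤ 8 ^ q * (a ^ q + b ^ q + c ^ q + e ^ q) := by
  have h8 : (8 : ℝ≥0∞) ^ q = 2 ^ q * 4 ^ q := by
    rw [← ENNReal.mul_rpow_of_nonneg _ _ (by linarith)]
    norm_num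
  have h4 : (1 : ℝ≥0∞) ≤ 4 ^ q := ENNReal.one_le_rpow (by norm_num) (by linarith)
  calc (a + b + c + e) ^ q ≤ 2 ^ q * ((a + b + c) ^ q + e ^ q) := rpow_add_le hq _ _
    _ ≤ 2 ^ q * (4 ^ q * (a ^ q + b ^ q + c ^ q) + 4 ^ q * e ^ q) := by
        gcongr
        · exact rpow_add_three_le hq _ _ _
        · exact le_mul_of_one_le_left' h4
    _ = _ := by rw [h8]; ring

section

/-! ### Line potentials of `C¹` fields -/

/-- Properness makes a closed ball times `[a, b]` compact, so the continuous derivative is bounded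
there by a constant, which serves as the dominating function. -/
theorem hasFDerivAt_intervalIntegral_of_continuous {E F : Type*} [NormedAddCommGroup E]
    [NormedSpace ℝ E] [ProperSpace E] [NormedAddCommGroup F] [NormedSpace ℝ F]
    {f : E → ℝ → F} {f' : E → ℝ → E →L[ℝ] F} (hf : ∀ X τ, HasFDerivAt (fun Z => f Z τ) (f' X τ) X)
    (hc : Continuous fun z : E × ℝ => f z.1 z.2) (hc' : Continuous fun z : E × ℝ => f' z.1 z.2)
    (a b : ℝ) (X : E) :
    HasFDerivAt (fun X => ∫ τ in a..b, f X τ) (∫ τ in a..b, f' X τ) X := by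
  obtain ⟨M, hM⟩ := ((isCompact_closedBall X 1).prod (isCompact_uIcc (a := a) (b := b))).exists_bound_of_continuousOn
    hc'.continuousOn
  have hcf : ∀ Z, Continuous fun τ => f Z τ := fun Z => hc.comp (by fun_prop : Continuous fun τ => (Z, τ))
  have hcf' : ∀ Z, Continuous fun τ => f' Z τ :=
    fun Z => hc'.comp (by fun_prop : Continuous fun τ => (Z, τ))
  refine intervalIntegral.hasFDerivAt_integral_of_dominated_of_fderiv_le (bound := fun _ => M)
    (Metric.closedBall_mem_nhds X one_pos) (.of_forall fun Z => (hcf Z).aestronglyMeasurable)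
    ((hcf X).intervalIntegrable _ _) (hcf' X).aestronglyMeasurable ?_ (by simp) ?_
  · exact .of_forall fun τ hτ Z hZ => hM (Z, τ) ⟨hZ, uIoc_subset_uIcc hτ⟩
  · exact .of_forall fun τ _ Z _ => hf Z τ

variable {n : ℕ}

/-- The integrand of the differential of `X ↦ I_B(X, Y)`. -/
def potDiffIntegrand (B : Rn n → Rn n) (X Y : Rn n) (τ : ℝ) : Rn n →L[ℝ] ℝ :=
  (1 - τ) • (innerSL ℝ (Y - X)).comp (fderiv ℝ B ((1 - τ) • X + τ • Y)) -
    innerSL ℝ (B ((1 - τ) • X + τ • Y))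

/-- The differential of `X ↦ I_B(X, Y)`. -/
def potDiff (B : Rn n → Rn n) (X Y : Rn n) : Rn n →L[ℝ] ℝ :=
  ∫ τ in (0 : ℝ)..1, potDiffIntegrand B X Y τ

theorem continuous_potDiffIntegrand {B : Rn n → Rn n} (hB : ContDiff ℝ 1 B) :
    Continuous fun z : (Rn n × Rn n) × ℝ => potDiffIntegrand B z.1.1 z.1.2 z.2 := by
  have h1 : Continuous fun z : (Rn n × Rn n) × ℝ =>
      fderiv ℝ B ((1 - z.2) • z.1.1 + z.2 • z.1.2) :=
    (hB.continuous_fderiv one_ne_zero).comp (by fun_prop)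
  have h2 : Continuous fun z : (Rn n × Rn n) × ℝ => B ((1 - z.2) • z.1.1 + z.2 • z.1.2) :=
    hB.continuous.comp (by fun_prop)
  have h3 : Continuous fun z : (Rn n × Rn n) × ℝ => innerSL ℝ (z.1.2 - z.1.1) :=
    (innerSL ℝ).continuous.comp (by fun_prop)
  unfold potDiffIntegrand
  exact ((by fun_prop : Continuous fun z : (Rn n × Rn n) × ℝ => 1 - z.2).smul (h3.clm_comp h1)).sub
    ((innerSL ℝ).continuous.comp h2)

theorem continuous_intPot {B : Rn n → Rn n} (hB : Continuous B) :
    Continuous fun z : Rn n × Rn n => intPot B z.1 z.2 := by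
  unfold intPot
  refine intervalIntegral.continuous_parametric_intervalIntegral_of_continuous' ?_ 0 1
  have : Continuous fun z : (Rn n × Rn n) × ℝ => B ((1 - z.2) • z.1.1 + z.2 • z.1.2) :=
    hB.comp (by fun_prop)
  exact this.inner (by fun_prop)

theorem continuous_potDiff {B : Rn n → Rn n} (hB : ContDiff ℝ 1 B) :
    Continuous fun z : Rn n × Rn n => potDiff B z.1 z.2 :=
  intervalIntegral.continuous_parametric_intervalIntegral_of_continuous'
    (continuous_potDiffIntegrand hB) 0 1

theorem hasFDerivAt_intPot {B : Rn n → Rn n} (hB : ContDiff ℝ 1 B) (X Y : Rn n) :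
    HasFDerivAt (fun Z => intPot B Z Y) (potDiff B X Y) X := by
  refine hasFDerivAt_intervalIntegral_of_continuous
    (f := fun Z τ => inner ℝ (B ((1 - τ) • Z + τ • Y)) (Y - Z))
    (f' := fun Z τ => potDiffIntegrand B Z Y τ) (fun Z τ => ?_) ?_ ?_ 0 1 X
  · have h1 : HasFDerivAt (fun Z : Rn n => (1 - τ) • Z + τ • Y)
        ((1 - τ) • ContinuousLinearMap.id ℝ (Rn n)) Z :=
      ((hasFDerivAt_id Z).const_smul (1 - τ)).add_const _
    have h2 := ((hB.differentiable one_ne_zero _).hasFDerivAt).comp Z h1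
    have h3 : HasFDerivAt (fun Z : Rn n => Y - Z) (-ContinuousLinearMap.id ℝ (Rn n)) Z :=
      (hasFDerivAt_id Z).const_sub Y
    refine (h2.inner ℝ h3).congr_fderiv ?_
    ext v
    simp [potDiffIntegrand, real_inner_comm, fderivInnerCLM_apply, inner_sub_left, inner_smul_right]
    ring
  · have : Continuous fun z : Rn n × ℝ => B ((1 - z.2) • z.1 + z.2 • Y) :=
      hB.continuous.comp (by fun_prop)
    exact this.inner (by fun_prop)
  · exact (continuous_potDiffIntegrand hB).comp
      (by fun_prop : Continuous fun z : Rn n × ℝ => ((z.1, Y), z.2))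

/-- The bilinear form `dB(X)[v, w]`. -/
def curl (B : Rn n → Rn n) (X v w : Rn n) : ℝ :=
  inner ℝ (fderiv ℝ B X v) w - inner ℝ (fderiv ℝ B X w) v

/-- The computation behind the Poincaré lemma. Integrating the derivative of `(1 - τ) B((1 - τ) X +
τ Y) · v` over `[0, 1]` gives `-B(X) · v`. Subtracting this identity from the differential of the
potential removes the undifferentiated field and antisymmetrizes its derivative. -/
theorem potDiff_add_inner {B : Rn n → Rn n} (hB : ContDiff ℝ 1 B) (X Y v : Rn n) :
    potDiff B X Y v + inner ℝ (B X) v =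
      ∫ τ in (0 : ℝ)..1, (1 - τ) * curl B ((1 - τ) • X + τ • Y) v (Y - X) := by
  have hc : Continuous fun τ : ℝ => potDiffIntegrand B X Y τ :=
    (continuous_potDiffIntegrand hB).comp (by fun_prop : Continuous fun τ : ℝ => ((X, Y), τ))
  have hcB : Continuous fun τ : ℝ => B ((1 - τ) • X + τ • Y) := hB.continuous.comp (by fun_prop)
  have hcB' : Continuous fun τ : ℝ => fderiv ℝ B ((1 - τ) • X + τ • Y) :=
    (hB.continuous_fderiv one_ne_zero).comp (by fun_prop)
  have hd : ∀ τ ∈ uIcc (0 : ℝ) 1, HasDerivAt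
      (fun τ : ℝ => (1 - τ) * inner ℝ (B ((1 - τ) • X + τ • Y)) v)
      (-inner ℝ (B ((1 - τ) • X + τ • Y)) v +
        (1 - τ) * inner ℝ (fderiv ℝ B ((1 - τ) • X + τ • Y) (Y - X)) v) τ := by
    intro τ _
    have h1 : HasDerivAt (fun τ : ℝ => (1 - τ) • X + τ • Y) (Y - X) τ := by
      have := (((hasDerivAt_id τ).const_sub 1).smul_const X).add ((hasDerivAt_id τ).smul_const Y)
      refine this.congr_deriv ?_
      module
    have h2 := ((hB.differentiable one_ne_zero _).hasFDerivAt).comp_hasDerivAt τ h1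
    have h3 := ((hasDerivAt_id τ).const_sub 1).mul (h2.inner ℝ (hasDerivAt_const τ v))
    refine h3.congr_deriv ?_
    simp
  have hint : Continuous fun τ : ℝ => -inner ℝ (B ((1 - τ) • X + τ • Y)) v +
      (1 - τ) * inner ℝ (fderiv ℝ B ((1 - τ) • X + τ • Y) (Y - X)) v :=
    (hcB.inner continuous_const).neg.add ((by fun_prop : Continuous fun τ : ℝ => 1 - τ).mul
      ((hcB'.clm_apply continuous_const).inner continuous_const))
  have h := intervalIntegral.integral_eq_sub_of_hasDerivAt hd (hint.intervalIntegrable _ _)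
  simp only [sub_self, zero_mul, sub_zero, one_smul, zero_smul, add_zero, one_mul, zero_sub] at h
  have e : potDiff B X Y v = ∫ τ in (0 : ℝ)..1, potDiffIntegrand B X Y τ v :=
    ContinuousLinearMap.intervalIntegral_apply (hc.intervalIntegrable _ _) v
  have hcv : Continuous fun τ : ℝ => potDiffIntegrand B X Y τ v := hc.clm_apply continuous_const
  rw [← sub_neg_eq_add, ← h, e, ← intervalIntegral.integral_sub (hcv.intervalIntegrable _ _)
    (hint.intervalIntegrable _ _)]
  refine intervalIntegral.integral_congr fun τ _ => ?_
  simp [potDiffIntegrand, curl, real_inner_comm, inner_sub_left]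
  ring

theorem intPot_self (B : Rn n → Rn n) (X : Rn n) : intPot B X X = 0 := by simp [intPot]

theorem intPot_line (B : Rn n → Rn n) (X v : Rn n) (σ : ℝ) :
    intPot B X (X + σ • v) = ∫ τ in (0 : ℝ)..σ, inner ℝ (B (X + τ • v)) v := by
  have h := intervalIntegral.smul_integral_comp_mul_left (a := 0) (b := 1)
    (fun τ : ℝ => inner ℝ (B (X + τ • v)) v) σ
  rw [mul_zero, mul_one] at h
  rw [← h, smul_eq_mul, ← intervalIntegral.integral_const_mul, intPot]
  refine intervalIntegral.integral_congr fun τ _ => ?_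
  have : (1 - τ) • X + τ • (X + σ • v) = X + (σ * τ) • v := by module
  simp only [this, add_sub_cancel_left, inner_smul_right]

theorem hasDerivAt_intPot_line {B : Rn n → Rn n} (hB : Continuous B) (X v : Rn n) (σ : ℝ) :
    HasDerivAt (fun σ : ℝ => intPot B X (X + σ • v)) (inner ℝ (B (X + σ • v)) v) σ := by
  simp only [intPot_line]
  have hc : Continuous fun τ : ℝ => inner ℝ (B (X + τ • v)) v :=
    (hB.comp (by fun_prop : Continuous fun τ : ℝ => X + τ • v)).inner continuous_const
  exact intervalIntegral.integral_hasDerivAt_right (hc.intervalIntegrable _ _)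
    (hc.stronglyMeasurableAtFilter _ _) hc.continuousAt

theorem intPot_symm (B : Rn n → Rn n) (X Y : Rn n) : intPot B Y X = -intPot B X Y := by
  have h := intervalIntegral.integral_comp_sub_left (a := 0) (b := 1)
    (fun τ : ℝ => inner ℝ (B ((1 - τ) • X + τ • Y)) (Y - X)) 1
  rw [sub_self, sub_zero] at h
  rw [intPot, intPot, ← h, ← intervalIntegral.integral_neg]
  refine intervalIntegral.integral_congr fun τ _ => ?_
  have : (1 - (1 - τ)) • X + (1 - τ) • Y = (1 - τ) • Y + τ • X := by module
  simp only [this, ← inner_neg_right, neg_sub]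

/-- A `C¹` field whose exterior derivative is bounded by `β` on the closed half-space. -/
structure CurlBound {d : ℕ} (B : Rn (d + 1) → Rn (d + 1)) (β : ℝ) : Prop where
  contDiff : ContDiff ℝ 1 B
  nonneg : 0 ≤ β
  bound : ∀ X ∈ closedHalfSpace d, ∀ v w, |curl B X v w| ≤ β * ‖v‖ * ‖w‖

section CurlBound

variable {d : ℕ} {B : Rn (d + 1) → Rn (d + 1)} {β : ℝ}

theorem convex_closedHalfSpace (d : ℕ) : Convex ℝ (closedHalfSpace d) := by
  intro X hX Y hY a b ha hb _
  have h1 : 0 ≤ X (Fin.last d) := hX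
  have h2 : 0 ≤ Y (Fin.last d) := hY
  change 0 ≤ (a • X + b • Y) (Fin.last d)
  simp only [PiLp.add_apply, PiLp.smul_apply, smul_eq_mul]
  positivity

/-- In other words, the covariant derivative at `X` of the transport factor towards a fixed `Y` is
at most `β |Y - X|`. The factor `1 - τ` of `potDiff_add_inner` is simply bounded by `1`. -/
theorem CurlBound.abs_potDiff_add_inner_le (h : CurlBound B β) {X Y : Rn (d + 1)}
    (hX : X ∈ closedHalfSpace d) (hY : Y ∈ closedHalfSpace d) (v : Rn (d + 1)) :
    |potDiff B X Y v + inner ℝ (B X) v| ≤ β * ‖v‖ * ‖Y - X‖ := by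
  rw [potDiff_add_inner h.contDiff]
  have := intervalIntegral.norm_integral_le_of_norm_le_const (a := 0) (b := 1)
    (f := fun τ => (1 - τ) * curl B ((1 - τ) • X + τ • Y) v (Y - X)) (C := β * ‖v‖ * ‖Y - X‖) ?_
  · simpa using this
  · intro τ hτ
    rw [uIoc_of_le zero_le_one] at hτ
    have hZ : (1 - τ) • X + τ • Y ∈ closedHalfSpace d :=
      convex_closedHalfSpace d hX hY (by linarith [hτ.2]) hτ.1.le (by ring)
    have h1 := h.bound _ hZ v (Y - X)
    rw [norm_mul, Real.norm_eq_abs, Real.norm_eq_abs, abs_of_nonneg (by linarith [hτ.2])]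
    have h3 := abs_nonneg (curl B ((1 - τ) • X + τ • Y) v (Y - X))
    nlinarith [hτ.1]

/-- The circulation along a triangle is controlled by the exterior derivative. -/
theorem CurlBound.abs_triangle_le (h : CurlBound B β) {X Y Z : Rn (d + 1)}
    (hX : X ∈ closedHalfSpace d) (hY : Y ∈ closedHalfSpace d) (hZ : Z ∈ closedHalfSpace d)
    {R : ℝ} (h1 : ‖Y - X‖ ≤ R) (h2 : ‖Y - Z‖ ≤ R) :
    |intPot B X Z + intPot B Z Y - intPot B X Y| ≤ β * ‖Z - X‖ * R := by
  set v := Z - X with hv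
  -- The vertex slides from `X` to `Z`. The derivative of the length-two path through it is the
  -- quantity just bounded, and at `σ = 0` the path is the segment from `X` to `Y`; the mean value
  -- inequality replaces Stokes' theorem.
  have hd : ∀ σ : ℝ, HasDerivAt
      (fun σ : ℝ => intPot B X (X + σ • v) + intPot B (X + σ • v) Y)
      (inner ℝ (B (X + σ • v)) v + potDiff B (X + σ • v) Y v) σ := by
    intro σ
    refine (hasDerivAt_intPot_line h.contDiff.continuous X v σ).add ?_
    have e1 : HasDerivAt (fun σ : ℝ => X + σ • v) v σ := by
      simpa using ((hasDerivAt_id σ).smul_const v).const_add X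
    exact (hasFDerivAt_intPot h.contDiff _ Y).comp_hasDerivAt σ e1
  have := norm_image_sub_le_of_norm_deriv_le_segment_01' (C := β * ‖v‖ * R)
    (fun σ _ => (hd σ).hasDerivWithinAt) ?_
  · simp only [one_smul, zero_smul, add_zero, intPot_self, zero_add, Real.norm_eq_abs] at this
    rwa [hv, add_sub_cancel] at this
  · intro σ hσ
    have e : X + σ • v = (1 - σ) • X + σ • Z := by rw [hv]; module
    have hW : X + σ • v ∈ closedHalfSpace d := by
      rw [e]
      exact convex_closedHalfSpace d hX hZ (by linarith [hσ.2]) hσ.1 (by ring)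
    rw [add_comm, Real.norm_eq_abs]
    refine (h.abs_potDiff_add_inner_le hW hY v).trans ?_
    -- The distance from `Y` is convex along the segment, hence controlled by its values at the two
    -- ends.
    have e2 : Y - (X + σ • v) = (1 - σ) • (Y - X) + σ • (Y - Z) := by rw [hv]; module
    have h3 : ‖Y - (X + σ • v)‖ ≤ R := by
      rw [e2]
      refine (norm_add_le _ _).trans ?_
      rw [norm_smul, norm_smul, Real.norm_of_nonneg hσ.1,
        Real.norm_of_nonneg (by linarith [hσ.2])]
      nlinarith [hσ.1, hσ.2]
    have := h.nonneg
    gcongr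

end CurlBound

/-- A segment in the boundary has horizontal velocity, so the normal component of the field does not
contribute. -/
theorem intPot_parallel {d : ℕ} (A : Rn (d + 1) → Rn (d + 1)) (x y : Rn d) :
    intPot (parallel A) x y = intPot A (bdry x) (bdry y) := by
  unfold intPot
  refine intervalIntegral.integral_congr fun τ _ => ?_
  have e : (1 - τ) • bdry x + τ • bdry y = bdry ((1 - τ) • x + τ • y) := by
    simp only [bdry_eq_pt, ← pt_smul, ← pt_add, mul_zero, add_zero]
  have e2 : bdry y - bdry x = pt (y - x) 0 := by
    simp only [bdry_eq_pt, ← pt_sub, sub_zero]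
  simp only [e, e2]
  simp [PiLp.inner_apply, Fin.sum_univ_castSucc, parallel]

end

/-! ### The fundamental theorem of calculus for weak derivatives along translations -/

section Sweep

variable {d : ℕ}

/-- The set swept out by the translates of `K` by `τ v`, `0 ≤ τ ≤ 1`. -/
def sweep (K : Set (Rn (d + 1))) (v : Rn (d + 1)) : Set (Rn (d + 1)) :=
  (fun z : Rn (d + 1) × ℝ => z.1 + z.2 • v) '' K ×ˢ Icc 0 1

theorem isCompact_sweep {K : Set (Rn (d + 1))} (hK : IsCompact K) (v : Rn (d + 1)) :
    IsCompact (sweep K v) :=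
  (hK.prod isCompact_Icc).image (by fun_prop)

theorem add_smul_mem_halfSpace {X v : Rn (d + 1)} (hX : X ∈ halfSpace d)
    (hv : 0 ≤ v (Fin.last d)) {τ : ℝ} (hτ : 0 ≤ τ) : X + τ • v ∈ halfSpace d := by
  have h1 : 0 < X (Fin.last d) := hX
  change 0 < (X + τ • v) (Fin.last d)
  simp only [PiLp.add_apply, PiLp.smul_apply, smul_eq_mul]
  positivity

theorem sweep_subset_halfSpace {K : Set (Rn (d + 1))} (hK : K ⊆ halfSpace d) {v : Rn (d + 1)}
    (hv : 0 ≤ v (Fin.last d)) : sweep K v ⊆ halfSpace d := by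
  rintro _ ⟨⟨X, τ⟩, ⟨hX, hτ⟩, rfl⟩
  exact add_smul_mem_halfSpace (hK hX) hv hτ.1

theorem setLIntegral_comp_add_le_sweep {K : Set (Rn (d + 1))} (hK : IsCompact K)
    (v : Rn (d + 1)) (f : Rn (d + 1) → ℝ≥0∞) {τ : ℝ} (hτ : τ ∈ Icc (0 : ℝ) 1) :
    ∫⁻ X in K, f (X + τ • v) ≤ ∫⁻ X in sweep K v, f X := by
  rw [← lintegral_indicator hK.measurableSet,
    ← lintegral_indicator (isCompact_sweep hK v).measurableSet,
    ← lintegral_add_right_eq_self ((sweep K v).indicator f) (τ • v)]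
  refine lintegral_mono fun X => ?_
  by_cases hX : X ∈ K
  · rw [indicator_of_mem hX, indicator_of_mem]
    exact ⟨(X, τ), ⟨hX, hτ⟩, rfl⟩
  · rw [indicator_of_notMem hX]
    exact zero_le

/-- Since `v` does not point downwards, all the translates of `K` stay in one compact subset of the
half-space, where `f` is integrable; Tonelli does the rest. -/
theorem integrable_sweep {E : Type*} [NormedAddCommGroup E] [MeasurableSpace E] [BorelSpace E]
    [SecondCountableTopology E] {f : Rn (d + 1) → E} (hf : Measurable f)
    (hfi : LocallyIntegrableOn f (halfSpace d)) {K : Set (Rn (d + 1))} (hK : IsCompact K)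
    (hKH : K ⊆ halfSpace d) {v : Rn (d + 1)} (hv : 0 ≤ v (Fin.last d)) :
    Integrable (fun z : Rn (d + 1) × ℝ => f (z.1 + z.2 • v))
      ((volume.restrict K).prod (volume.restrict (Ioc 0 1))) := by
  have hm : Measurable fun z : Rn (d + 1) × ℝ => f (z.1 + z.2 • v) := hf.comp (by fun_prop)
  refine ⟨hm.aestronglyMeasurable, ?_⟩
  have hfin : ∫⁻ X in sweep K v, ‖f X‖ₑ < ⊤ :=
    (hfi.integrableOn_compact_subset (sweep_subset_halfSpace hKH hv) (isCompact_sweep hK v)).2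
  rw [HasFiniteIntegral, lintegral_prod_symm _ hm.enorm.aemeasurable]
  refine lt_of_le_of_lt (setLIntegral_mono' measurableSet_Ioc fun τ hτ =>
    setLIntegral_comp_add_le_sweep hK v (fun X => ‖f X‖ₑ) ⟨hτ.1.le, hτ.2⟩) ?_
  simpa using hfin

/-- The half-space is a countable union of compact sets, each bounded and at positive distance from
the boundary. -/
theorem ae_halfMeasure_of_forall_isCompact {q : Rn (d + 1) → Prop}
    (h : ∀ K : Set (Rn (d + 1)), IsCompact K → K ⊆ halfSpace d → ∀ᵐ X ∂volume.restrict K, q X) :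
    ∀ᵐ X ∂halfMeasure d, q X := by
  let K : ℕ → Set (Rn (d + 1)) := fun n =>
    Metric.closedBall 0 n ∩ {X | 1 / ((n : ℝ) + 1) ≤ X (Fin.last d)}
  have hK : ∀ n, IsCompact (K n) := fun n => (isCompact_closedBall 0 (n : ℝ)).inter_right
    (isClosed_le continuous_const (by fun_prop))
  have hKH : ∀ n, K n ⊆ halfSpace d := fun n X hX => by
    have h1 : 1 / ((n : ℝ) + 1) ≤ X (Fin.last d) := hX.2
    exact lt_of_lt_of_le (by positivity) h1
  have hcov : halfSpace d ⊆ ⋃ n, K n := by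
    intro X (hX : 0 < X (Fin.last d))
    obtain ⟨n, hn⟩ := exists_nat_one_div_lt hX
    obtain ⟨m, hm⟩ := exists_nat_ge ‖X‖
    refine mem_iUnion.2 ⟨max n m, ?_, ?_⟩
    · rw [mem_closedBall_zero_iff]
      exact hm.trans (by exact_mod_cast le_max_right n m)
    · refine le_trans ?_ hn.le
      have : (n : ℝ) ≤ (max n m : ℕ) := by exact_mod_cast le_max_left n m
      exact one_div_le_one_div_of_le (by positivity) (by linarith)
  exact ae_restrict_of_ae_restrict_of_subset hcov
    ((ae_restrict_iUnion_iff K q).2 fun n => h (K n) (hK n) (hKH n))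

theorem ae_integrableOn_line {E : Type*} [NormedAddCommGroup E] [MeasurableSpace E] [BorelSpace E]
    [SecondCountableTopology E] {f : Rn (d + 1) → E} (hf : Measurable f)
    (hfi : LocallyIntegrableOn f (halfSpace d)) {v : Rn (d + 1)} (hv : 0 ≤ v (Fin.last d)) :
    ∀ᵐ X ∂halfMeasure d, IntegrableOn (fun τ : ℝ => f (X + τ • v)) (Ioc 0 1) :=
  ae_halfMeasure_of_forall_isCompact fun _ hK hKH => (integrable_sweep hf hfi hK hKH hv).prod_right_ae

theorem integrable_smul_of_tsupport {f : Rn (d + 1) → ℂ}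
    (hfi : LocallyIntegrableOn f (halfSpace d)) {φ : Rn (d + 1) → ℝ} (hφ : Continuous φ)
    (hc : HasCompactSupport φ) (hs : tsupport φ ⊆ halfSpace d) :
    Integrable fun X => φ X • f X := by
  have hsub : Function.support (fun X => φ X • f X) ⊆ tsupport φ := by
    intro X hX
    refine subset_tsupport _ fun h0 => hX ?_
    simp [h0]
  exact (integrableOn_iff_integrable_of_support_subset hsub).1
    ((hfi.integrableOn_compact_subset hs hc).continuousOn_smul hφ.continuousOn hc)

/-- If `g` is the weak derivative of `U` in the direction `v`, then
`U(X + v) - U(X) = ∫₀¹ g(X + τ v) dτ` for almost every `X`. -/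
theorem ae_sub_eq_integral_of_weakDeriv {U g : Rn (d + 1) → ℂ} (hU : Measurable U)
    (hg : Measurable g) (hUi : LocallyIntegrableOn U (halfSpace d))
    (hgi : LocallyIntegrableOn g (halfSpace d)) {v : Rn (d + 1)} (hv : 0 ≤ v (Fin.last d))
    (h : ∀ φ : Rn (d + 1) → ℝ, ContDiff ℝ ∞ φ → HasCompactSupport φ → tsupport φ ⊆ halfSpace d →
      ∫ X, fderiv ℝ φ X v • U X = -∫ X, φ X • g X) :
    ∀ᵐ X ∂halfMeasure d, U (X + v) - U X = ∫ τ in (0 : ℝ)..1, g (X + τ • v) := by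
  have hshift : LocallyIntegrableOn (fun X => U (X + v)) (halfSpace d) := by
    rw [locallyIntegrableOn_iff (isOpen_halfSpace d).isLocallyClosed]
    intro K hKH hK
    refine ⟨(hU.comp (measurable_add_const v)).aestronglyMeasurable, ?_⟩
    have hfin : ∫⁻ X in sweep K v, ‖U X‖ₑ < ⊤ :=
      (hUi.integrableOn_compact_subset (sweep_subset_halfSpace hKH hv) (isCompact_sweep hK v)).2
    refine lt_of_le_of_lt ?_ hfin
    simpa using setLIntegral_comp_add_le_sweep hK v (fun X => ‖U X‖ₑ) (τ := 1) (by simp)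
  have hline : LocallyIntegrableOn (fun X => ∫ τ in (0 : ℝ)..1, g (X + τ • v)) (halfSpace d) := by
    rw [locallyIntegrableOn_iff (isOpen_halfSpace d).isLocallyClosed]
    intro K hKH hK
    simp only [intervalIntegral.integral_of_le zero_le_one]
    exact (integrable_sweep hg hgi hK hKH hv).integral_prod_left
  -- The identity is tested against smooth `φ`, and all translations are moved onto `φ`.
  have key : ∀ᵐ X, X ∈ halfSpace d →
      U (X + v) - U X - ∫ τ in (0 : ℝ)..1, g (X + τ • v) = 0 := by
    refine (isOpen_halfSpace d).ae_eq_zero_of_integral_contDiff_smul_eq_zero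
      ((hshift.sub hUi).sub hline) fun φ hφ hc hs => ?_
    set K := tsupport φ with hKdef
    have hK : IsCompact K := hc
    -- Translating the test function by `τ v` with `v` not pointing downwards keeps it admissible.
    have hshs : ∀ τ ∈ Icc (0 : ℝ) 1, tsupport (fun X => φ (X - τ • v)) ⊆ sweep K v := by
      intro τ hτ X hX
      have : X - τ • v ∈ K := 
        tsupport_comp_subset_preimage φ (f := fun X => X - τ • v) (by fun_prop) hX
      exact ⟨(X - τ • v, τ), ⟨this, hτ⟩, by simp⟩
    have hK' : IsCompact (sweep K v) := isCompact_sweep hK v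
    have hK'H : sweep K v ⊆ halfSpace d := sweep_subset_halfSpace hs hv
    have hsm : ∀ τ : ℝ, ContDiff ℝ ∞ fun X => φ (X - τ • v) := fun τ =>
      hφ.comp (contDiff_id.sub contDiff_const)
    have hcs : ∀ τ ∈ Icc (0 : ℝ) 1, HasCompactSupport fun X => φ (X - τ • v) := fun τ hτ =>
      hK'.of_isClosed_subset (isClosed_tsupport _) (hshs τ hτ)
    have hint1 := integrable_smul_of_tsupport hshift hφ.continuous hc hs
    have hint2 := integrable_smul_of_tsupport hUi hφ.continuous hc hs
    have hint3 := integrable_smul_of_tsupport hline hφ.continuous hc hs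
    have hint4 : Integrable fun X => φ (X - v) • U X := by
      have := integrable_smul_of_tsupport hUi (hsm 1).continuous (hcs 1 (by simp))
        ((hshs 1 (by simp)).trans hK'H)
      simpa using this
    have hfd : ∀ (X : Rn (d + 1)) (τ : ℝ), fderiv ℝ (fun X => φ (X - τ • v)) X = fderiv ℝ φ (X - τ • v) :=
      fun X τ => by
        simpa only [sub_eq_add_neg] using fderiv_comp_add_right (f := φ) (x := X) (-(τ • v))
    have hcfd : Continuous fun z : Rn (d + 1) × ℝ => fderiv ℝ φ (z.1 - z.2 • v) v :=
      ((hφ.continuous_fderiv (by simp)).comp (by fun_prop)).clm_apply continuous_const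
    -- the two applications of Fubini's theorem
    have : IsFiniteMeasure ((volume : Measure ℝ).restrict (uIoc 0 1)) := by
      rw [uIoc_of_le zero_le_one]
      infer_instance
    have hF1 : Integrable (Function.uncurry fun (τ : ℝ) X => fderiv ℝ φ (X - τ • v) v • U X)
        ((volume.restrict (uIoc 0 1)).prod volume) := by
      have i0 : Integrable ((sweep K v).indicator U) :=
        (integrable_indicator_iff hK'.measurableSet).2 (hUi.integrableOn_compact_subset hK'H hK')
      have i1 := i0.comp_snd (volume.restrict (uIoc (0 : ℝ) 1))
      obtain ⟨M, hM⟩ := (hφ.continuous_fderiv (by simp)).bounded_above_of_compact_support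
        (hc.fderiv ℝ)
      have i2 := i1.bdd_smul (φ := fun z : ℝ × Rn (d + 1) => fderiv ℝ φ (z.2 - z.1 • v) v)
        (M * ‖v‖) (hcfd.comp continuous_swap).aestronglyMeasurable
        (.of_forall fun z => ((fderiv ℝ φ (z.2 - z.1 • v)).le_opNorm v).trans (by
          gcongr; exact hM _))
      refine i2.congr ?_
      have hτ : ∀ᵐ z ∂(volume.restrict (uIoc (0 : ℝ) 1)).prod (volume : Measure (Rn (d + 1))),
          z.1 ∈ uIoc (0 : ℝ) 1 :=
        Measure.quasiMeasurePreserving_fst.ae (ae_restrict_mem measurableSet_uIoc)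
      filter_upwards [hτ] with z hz
      rw [uIoc_of_le zero_le_one] at hz
      by_cases hX : z.2 ∈ sweep K v
      · simp [Function.uncurry, hX]
      · have h0 : fderiv ℝ φ (z.2 - z.1 • v) = 0 := by
          by_contra hne
          refine hX ⟨(z.2 - z.1 • v, z.1), ⟨?_, hz.1.le, hz.2⟩, by simp⟩
          exact support_fderiv_subset ℝ hne
        simp [Function.uncurry, h0]
    have hF2 : Integrable (Function.uncurry fun (τ : ℝ) X => φ X • g (X + τ • v))
        ((volume.restrict (uIoc 0 1)).prod volume) := by
      obtain ⟨M, hM⟩ := hφ.continuous.bounded_above_of_compact_support hc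
      have i1 := (integrable_sweep hg hgi hK hs hv).swap
      have i2 := i1.bdd_smul (φ := fun z : ℝ × Rn (d + 1) => φ z.2) M
        (hφ.continuous.comp continuous_snd).aestronglyMeasurable (.of_forall fun z => hM _)
      rw [uIoc_of_le zero_le_one]
      refine (integrableOn_iff_integrable_of_support_subset (s := univ ×ˢ K) fun z hz => ?_).1 ?_
      · refine ⟨mem_univ _, subset_tsupport _ fun h0 => hz ?_⟩
        simp [Function.uncurry, h0]
      · rw [IntegrableOn, ← Measure.prod_restrict, Measure.restrict_univ]
        exact i2
    have e1 : ∫ X, φ X • U (X + v) = ∫ X, φ (X - v) • U X := by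
      rw [← integral_sub_right_eq_self (fun X => φ X • U (X + v)) v]
      simp
    have e2 : ∀ X, φ (X - v) - φ X = -∫ τ in (0 : ℝ)..1, fderiv ℝ φ (X - τ • v) v := by
      intro X
      have hd : ∀ τ ∈ uIcc (0 : ℝ) 1, HasDerivAt (fun τ : ℝ => φ (X - τ • v))
          (-(fderiv ℝ φ (X - τ • v) v)) τ := by
        intro τ _
        have h1 : HasDerivAt (fun τ : ℝ => X - τ • v) (-v) τ := by
          simpa using ((hasDerivAt_id τ).smul_const v).const_sub X
        have := ((hφ.differentiable (by simp)) _).hasFDerivAt.comp_hasDerivAt τ h1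
        rwa [map_neg] at this
      have hcX : Continuous fun τ : ℝ => fderiv ℝ φ (X - τ • v) v :=
        hcfd.comp (by fun_prop : Continuous fun τ : ℝ => (X, τ))
      have := intervalIntegral.integral_eq_sub_of_hasDerivAt hd (hcX.neg.intervalIntegrable _ _)
      rw [← intervalIntegral.integral_neg, this]
      simp
    -- The increment of `φ` is the integral of its directional derivatives along the translation.
    -- For each `τ` the definition of the weak derivative is applied to the translate of `φ`, and
    -- the result is translated back.
    have e3 : ∫ X, (φ (X - v) - φ X) • U X = ∫ X, φ X • ∫ τ in (0 : ℝ)..1, g (X + τ • v) := by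
      calc ∫ X, (φ (X - v) - φ X) • U X
          = -∫ X, ∫ τ in (0 : ℝ)..1, fderiv ℝ φ (X - τ • v) v • U X := by
            rw [← integral_neg]
            refine integral_congr_ae (.of_forall fun X => ?_)
            simp only [e2 X, neg_smul, intervalIntegral.integral_smul_const]
        _ = -∫ τ in (0 : ℝ)..1, ∫ X, fderiv ℝ φ (X - τ • v) v • U X := by
            rw [intervalIntegral_integral_swap hF1]
        _ = ∫ τ in (0 : ℝ)..1, ∫ X, φ X • g (X + τ • v) := by
            rw [← intervalIntegral.integral_neg]
            refine intervalIntegral.integral_congr fun τ hτ => ?_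
            rw [uIcc_of_le zero_le_one] at hτ
            have := h _ (hsm τ) (hcs τ hτ) ((hshs τ hτ).trans hK'H)
            rw [integral_congr_ae (.of_forall fun X => by rw [hfd])] at this
            beta_reduce
            rw [this, neg_neg]
            rw [← integral_sub_right_eq_self (fun X => φ X • g (X + τ • v)) (τ • v)]
            simp
        _ = ∫ X, ∫ τ in (0 : ℝ)..1, φ X • g (X + τ • v) := intervalIntegral_integral_swap hF2
        _ = _ := by simp only [intervalIntegral.integral_smul]
    simp only [smul_sub]
    have e4 := integral_sub (hint1.sub hint2) hint3
    simp only [Pi.sub_apply] at e4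
    rw [e4, integral_sub hint1 hint2, e1,
      ← integral_sub hint4 hint2, ← e3]
    simp only [sub_smul, sub_self]
  rw [ae_restrict_iff' (measurableSet_halfSpace d)]
  filter_upwards [key] with X hX hm
  exact sub_eq_zero.1 (hX hm)

end Sweep

/-! ### Covariant differences along segments -/

/-- The complex pairing `∑ vⱼ gⱼ` of a complex covector with a real vector. -/
def dotC {n : ℕ} (v : Rn n) : Cn n →L[ℂ] ℂ :=
  ∑ j, (v j : ℂ) • EuclideanSpace.proj j

theorem dotC_apply {n : ℕ} (v : Rn n) (g : Cn n) : dotC v g = ∑ j, (v j : ℂ) * g j := by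
  simp [dotC]

theorem norm_dotC_le {n : ℕ} (v : Rn n) (g : Cn n) : ‖dotC v g‖ ≤ ‖v‖ * ‖g‖ := by
  have h := norm_inner_le_norm (𝕜 := ℂ) (WithLp.toLp 2 fun j => (v j : ℂ) : Cn n) g
  have e1 : inner ℂ (WithLp.toLp 2 fun j => (v j : ℂ) : Cn n) g = dotC v g := by
    simp [PiLp.inner_apply, dotC_apply, mul_comm]
  have e2 : ‖(WithLp.toLp 2 fun j => (v j : ℂ) : Cn n)‖ = ‖v‖ := by
    simp [EuclideanSpace.norm_eq]
  rwa [e1, e2] at h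

theorem dotC_smul_left {n : ℕ} (c : ℝ) (v : Rn n) (g : Cn n) :
    dotC (c • v) g = c • dotC v g := by
  simp [dotC_apply, Finset.mul_sum, mul_assoc]

/-- The covector field `∇_B U = G + i B U` built from a gradient `G`. -/
def covField {n : ℕ} (B : Rn n → Rn n) (U : Rn n → ℂ) (G : Rn n → Cn n) (X : Rn n) : Cn n :=
  G X + WithLp.toLp 2 fun j => Complex.I * (B X j : ℂ) * U X

theorem dotC_covField {n : ℕ} (B : Rn n → Rn n) (U : Rn n → ℂ) (G : Rn n → Cn n) (X v : Rn n) :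
    dotC v (covField B U G X) = dotC v (G X) + Complex.I * (inner ℝ (B X) v : ℝ) * U X := by
  simp only [covField, map_add, dotC_apply, PiLp.inner_apply, add_right_inj]
  push_cast
  rw [Finset.mul_sum, Finset.sum_mul]
  refine Finset.sum_congr rfl fun j _ => ?_
  simp
  ring

@[fun_prop]
theorem measurable_covField {n : ℕ} {B : Rn n → Rn n} {U : Rn n → ℂ} {G : Rn n → Cn n}
    (hB : Measurable B) (hU : Measurable U) (hG : Measurable G) : Measurable (covField B U G) := by
  unfold covField
  refine hG.add ?_
  have : Measurable fun X => fun j => Complex.I * (B X j : ℂ) * U X := by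
    refine measurable_pi_lambda _ fun j => ?_
    have : Measurable fun X => B X j := (by fun_prop : Measurable fun Y : Rn n => Y j).comp hB
    fun_prop
  exact (PiLp.continuous_toLp 2 _).measurable.comp this

section

variable {d : ℕ} {U : Rn (d + 1) → ℂ} {G : Rn (d + 1) → Cn (d + 1)}

theorem HasWeakGradient.locallyIntegrableOn_dotC (h : HasWeakGradient U G) (v : Rn (d + 1)) :
    LocallyIntegrableOn (fun X => dotC v (G X)) (halfSpace d) := by
  rw [locallyIntegrableOn_iff (isOpen_halfSpace d).isLocallyClosed]
  intro K hK hc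
  exact (dotC v).integrable_comp (h.locInt_grad.integrableOn_compact_subset hK hc)

theorem HasWeakGradient.integral_fderiv_smul (h : HasWeakGradient U G) {φ : Rn (d + 1) → ℝ}
    (hφ : ContDiff ℝ ∞ φ) (hc : HasCompactSupport φ) (hs : tsupport φ ⊆ halfSpace d)
    (v : Rn (d + 1)) :
    ∫ X, fderiv ℝ φ X v • U X = -∫ X, φ X • dotC v (G X) := by
  have h1 : ∫ X in halfSpace d, fderiv ℝ φ X v • U X = ∫ X, fderiv ℝ φ X v • U X := by
    refine setIntegral_eq_integral_of_forall_compl_eq_zero fun X hX => ?_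
    have : fderiv ℝ φ X = 0 := by
      by_contra hne
      exact hX (hs (support_fderiv_subset ℝ hne))
    simp [this]
  have h2 : ∫ X in halfSpace d, φ X • dotC v (G X) = ∫ X, φ X • dotC v (G X) := by
    refine setIntegral_eq_integral_of_forall_compl_eq_zero fun X hX => ?_
    have : φ X = 0 := by
      by_contra hne
      exact hX (hs (subset_tsupport _ hne))
    simp [this]
  rw [← h1, ← h2]
  have hv : v = ∑ j, v j • EuclideanSpace.single j (1 : ℝ) := by
    ext i
    simp [Pi.single_apply]
  have e1 : ∀ X, fderiv ℝ φ X v • U X =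
      ∑ j, v j • (fderiv ℝ φ X (EuclideanSpace.single j 1) • U X) := by
    intro X
    conv_lhs => rw [hv]
    simp only [map_sum, map_smul, Finset.sum_smul, smul_assoc]
  have e2 : ∀ X, φ X • dotC v (G X) = ∑ j, v j • (φ X • G X j) := by
    intro X
    rw [dotC_apply, Finset.smul_sum]
    refine Finset.sum_congr rfl fun j _ => ?_
    simp only [Complex.real_smul]
    ring
  simp only [e1, e2]
  have i1 := integral_finsetSum Finset.univ fun j _ =>
    (h.integrable_left hφ hc hs (EuclideanSpace.single j 1)).smul (v j)
  have i2 := integral_finsetSum Finset.univ fun j _ => (h.integrable_right hφ hc hs j).smul (v j)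
  simp only [Pi.smul_apply] at i1 i2
  rw [i1, i2, ← Finset.sum_neg_distrib]
  refine Finset.sum_congr rfl fun j _ => ?_
  rw [integral_smul, integral_smul, h.integral_eq φ hφ hc hs j, smul_neg]

theorem HasWeakGradient.ae_sub_eq (h : HasWeakGradient U G) (hU : Measurable U)
    (hG : Measurable G) {v : Rn (d + 1)} (hv : 0 ≤ v (Fin.last d)) :
    ∀ᵐ X ∂halfMeasure d, U (X + v) - U X = ∫ τ in (0 : ℝ)..1, dotC v (G (X + τ • v)) :=
  ae_sub_eq_integral_of_weakDeriv hU ((dotC v).continuous.measurable.comp hG) h.locInt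
    (h.locallyIntegrableOn_dotC v) hv fun _ hφ hc hs => h.integral_fderiv_smul hφ hc hs v

theorem integral_line_smul (G : Rn (d + 1) → Cn (d + 1)) (X v : Rn (d + 1)) (σ : ℝ) :
    ∫ τ in (0 : ℝ)..1, dotC (σ • v) (G (X + τ • (σ • v))) =
      ∫ τ in (0 : ℝ)..σ, dotC v (G (X + τ • v)) := by
  have h := intervalIntegral.smul_integral_comp_mul_left (a := 0) (b := 1)
    (fun τ : ℝ => dotC v (G (X + τ • v))) σ
  rw [mul_zero, mul_one] at h
  rw [← h, ← intervalIntegral.integral_smul]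
  refine intervalIntegral.integral_congr fun τ _ => ?_
  simp only [dotC_smul_left, smul_smul, mul_comm]

/-- The variable endpoint is scaled to `1`, so that the integral becomes one over a fixed interval
with a jointly measurable integrand. -/
theorem measurable_integral_line (hG : Measurable G) (v : Rn (d + 1)) :
    Measurable fun z : Rn (d + 1) × ℝ => ∫ τ in (0 : ℝ)..z.2, dotC v (G (z.1 + τ • v)) := by
  have h : StronglyMeasurable fun q : (Rn (d + 1) × ℝ) × ℝ =>
      q.1.2 • dotC v (G (q.1.1 + q.2 • (q.1.2 • v))) := by
    refine Measurable.stronglyMeasurable ?_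
    refine (by fun_prop : Measurable fun q : (Rn (d + 1) × ℝ) × ℝ => q.1.2).smul ?_
    exact (dotC v).continuous.measurable.comp (hG.comp (by fun_prop))
  have h2 := (h.integral_prod_right' (ν := volume.restrict (Ioc (0 : ℝ) 1))).measurable
  convert h2 using 1
  funext z
  rw [← integral_line_smul, intervalIntegral.integral_of_le zero_le_one]
  simp only [dotC_smul_left]

/-- For each `σ` the previous formula holds off a null set depending on `σ`. By Fubini almost every
`X` is good for almost every `σ`, which is the absolute continuity on lines that is used below. -/
theorem HasWeakGradient.ae_ae_eq_add_integral (h : HasWeakGradient U G) (hU : Measurable U)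
    (hG : Measurable G) {v : Rn (d + 1)} (hv : 0 ≤ v (Fin.last d)) :
    ∀ᵐ X ∂halfMeasure d, ∀ᵐ σ ∂halfLine,
      U (X + σ • v) = U X + ∫ τ in (0 : ℝ)..σ, dotC v (G (X + τ • v)) := by
  rw [Measure.ae_ae_comm]
  · filter_upwards [ae_restrict_mem measurableSet_Ioi] with σ (hσ : 0 < σ)
    have hσv : 0 ≤ (σ • v) (Fin.last d) := mul_nonneg hσ.le hv
    filter_upwards [h.ae_sub_eq hU hG hσv] with X hX
    rw [← integral_line_smul, ← hX]
    ring
  · exact measurableSet_eq_fun (hU.comp (by fun_prop))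
      ((hU.comp measurable_fst).add (measurable_integral_line hG v))

/-- The product rule for a `C¹` factor and a primitive of an integrable function. -/
theorem mul_primitive_sub_eq_integral {e e' g : ℝ → ℂ} (he : ∀ σ, HasDerivAt e (e' σ) σ)
    (he' : Continuous e') (hg : IntegrableOn g (Ioc 0 1)) (c : ℂ) :
    e 1 * (c + ∫ τ in (0 : ℝ)..1, g τ) - e 0 * c =
      ∫ σ in (0 : ℝ)..1, (e' σ * (c + ∫ τ in (0 : ℝ)..σ, g τ) + e σ * g σ) := by
  have hce : Continuous e := continuous_iff_continuousAt.2 fun σ => (he σ).continuousAt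
  have hgi : IntervalIntegrable g volume 0 1 :=
    (intervalIntegrable_iff_integrableOn_Ioc_of_le zero_le_one).2 hg
  have hFTC : ∀ a b, ∫ σ in a..b, e' σ = e b - e a := fun a b =>
    intervalIntegral.integral_eq_sub_of_hasDerivAt (fun σ _ => he σ) (he'.intervalIntegrable _ _)
  -- The product rule reduces to Fubini for `e'(σ) g(τ)` on the triangle `0 < τ ≤ σ ≤ 1`; the
  -- primitive of `g` need not be differentiated.
  let f : ℝ → ℝ → ℂ := fun σ τ => (Ioc 0 σ).indicator (fun τ => e' σ * g τ) τ
  have hf : Integrable (Function.uncurry f)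
      ((volume.restrict (Ioc 0 1)).prod (volume.restrict (Ioc 0 1))) := by
    obtain ⟨M, hM⟩ := isCompact_Icc.exists_bound_of_continuousOn (he'.continuousOn (s := Icc 0 1))
    have i1 : Integrable (fun z : ℝ × ℝ => g z.2)
        ((volume.restrict (Ioc 0 1)).prod (volume.restrict (Ioc 0 1))) := hg.comp_snd _
    have hb : ∀ᵐ z ∂(volume.restrict (Ioc (0 : ℝ) 1)).prod (volume.restrict (Ioc (0 : ℝ) 1)),
        ‖e' z.1‖ ≤ M := by
      have : ∀ᵐ z ∂(volume.restrict (Ioc (0 : ℝ) 1)).prod (volume.restrict (Ioc (0 : ℝ) 1)),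
          z.1 ∈ Ioc (0 : ℝ) 1 :=
        Measure.quasiMeasurePreserving_fst.ae (ae_restrict_mem measurableSet_Ioc)
      filter_upwards [this] with z hz using hM _ ⟨hz.1.le, hz.2⟩
    have i2 := i1.bdd_mul (f := fun z : ℝ × ℝ => e' z.1)
      (he'.comp continuous_fst).aestronglyMeasurable hb
    have hS : MeasurableSet {z : ℝ × ℝ | z.2 ∈ Ioc 0 z.1} :=
      (measurableSet_lt measurable_const measurable_snd).inter
        (measurableSet_le measurable_snd measurable_fst)
    exact i2.indicator hS
  have e1 : ∫ σ in Ioc (0 : ℝ) 1, ∫ τ in Ioc (0 : ℝ) 1, f σ τ =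
      ∫ σ in (0 : ℝ)..1, e' σ * ∫ τ in (0 : ℝ)..σ, g τ := by
    rw [intervalIntegral.integral_of_le zero_le_one]
    refine setIntegral_congr_fun measurableSet_Ioc fun σ hσ => ?_
    simp only [f]
    rw [setIntegral_indicator measurableSet_Ioc, intervalIntegral.integral_of_le hσ.1.le,
      Ioc_inter_Ioc, max_self, min_eq_right hσ.2, integral_const_mul]
  have e2 : ∫ τ in Ioc (0 : ℝ) 1, ∫ σ in Ioc (0 : ℝ) 1, f σ τ =
      ∫ τ in (0 : ℝ)..1, (e 1 - e τ) * g τ := by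
    rw [intervalIntegral.integral_of_le zero_le_one]
    refine setIntegral_congr_fun measurableSet_Ioc fun τ hτ => ?_
    have : ∀ σ, f σ τ = (Ici τ).indicator (fun σ => e' σ * g τ) σ := by
      intro σ
      simp only [f, indicator_apply, mem_Ioc, mem_Ici, hτ.1, true_and]
    simp only [this]
    rw [setIntegral_indicator measurableSet_Ici]
    have hset : Ioc (0 : ℝ) 1 ∩ Ici τ = Icc τ 1 := by
      ext σ
      simp only [mem_inter_iff, mem_Ioc, mem_Ici, mem_Icc]
      constructor
      · rintro ⟨⟨_, h⟩, h'⟩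
        exact ⟨h', h⟩
      · rintro ⟨h, h'⟩
        exact ⟨⟨hτ.1.trans_le h, h'⟩, h⟩
    rw [hset, integral_Icc_eq_integral_Ioc, ← intervalIntegral.integral_of_le hτ.2,
      intervalIntegral.integral_mul_const, hFTC]
  have hswap := integral_integral_swap hf
  rw [e1, e2] at hswap
  have j1 : IntervalIntegrable (fun τ => e τ * g τ) volume 0 1 :=
    hgi.continuousOn_mul hce.continuousOn
  have j2 : IntervalIntegrable (fun τ => e 1 * g τ) volume 0 1 := hgi.const_mul _
  have hprim : ContinuousOn (fun σ => ∫ τ in (0 : ℝ)..σ, g τ) (uIcc 0 1) :=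
    intervalIntegral.continuousOn_primitive_interval' hgi (by simp)
  have j3 : IntervalIntegrable (fun σ => e' σ * ∫ τ in (0 : ℝ)..σ, g τ) volume 0 1 :=
    (he'.continuousOn.mul hprim).intervalIntegrable
  have j4 : IntervalIntegrable (fun σ => e' σ * c) volume 0 1 :=
    (he'.mul continuous_const).intervalIntegrable _ _
  have e3 : ∫ τ in (0 : ℝ)..1, (e 1 - e τ) * g τ =
      e 1 * (∫ τ in (0 : ℝ)..1, g τ) - ∫ τ in (0 : ℝ)..1, e τ * g τ := by
    simp only [sub_mul]
    rw [intervalIntegral.integral_sub j2 j1, intervalIntegral.integral_const_mul]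
  simp only [mul_add]
  rw [intervalIntegral.integral_add (j4.add j3) j1, intervalIntegral.integral_add j4 j3, hswap, e3,
    intervalIntegral.integral_mul_const, hFTC]
  ring

/-- The covariant difference along a segment on which `U` is absolutely continuous is controlled
by the covariant derivative. -/
theorem enorm_cov_sub_le_of_line {B : Rn (d + 1) → Rn (d + 1)} (hB : Continuous B)
    {X v : Rn (d + 1)} {c : ℂ}
    (h3 : IntegrableOn (fun τ : ℝ => dotC v (G (X + τ • v))) (Ioc 0 1))
    (h1 : U (X + v) = c + ∫ τ in (0 : ℝ)..1, dotC v (G (X + τ • v)))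
    (h2 : ∀ᵐ σ ∂volume.restrict (Ioc (0 : ℝ) 1),
      U (X + σ • v) = c + ∫ τ in (0 : ℝ)..σ, dotC v (G (X + τ • v))) :
    ‖Complex.exp (Complex.I * (intPot B X (X + v) : ℂ)) * U (X + v) - c‖ₑ ≤
      ‖v‖ₑ * ∫⁻ τ in Ioc (0 : ℝ) 1, ‖covField B U G (X + τ • v)‖ₑ := by
  set e : ℝ → ℂ := fun σ => Complex.exp (Complex.I * (intPot B X (X + σ • v) : ℂ)) with he
  have hd : ∀ σ, HasDerivAt e (Complex.I * (inner ℝ (B (X + σ • v)) v : ℝ) * e σ) σ := by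
    intro σ
    have := (((hasDerivAt_intPot_line hB X v σ).ofReal_comp).const_mul Complex.I).cexp
    refine this.congr_deriv ?_
    rw [he]
    ring
  have hce : Continuous e := continuous_iff_continuousAt.2 fun σ => (hd σ).continuousAt
  have hcB : Continuous fun σ : ℝ => (inner ℝ (B (X + σ • v)) v : ℝ) :=
    (hB.comp (by fun_prop : Continuous fun σ : ℝ => X + σ • v)).inner continuous_const
  have hcd : Continuous fun σ => Complex.I * (inner ℝ (B (X + σ • v)) v : ℝ) * e σ :=
    (continuous_const.mul (Complex.continuous_ofReal.comp hcB)).mul hce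
  have key := mul_primitive_sub_eq_integral hd hcd h3 c
  have e0 : e 0 = 1 := by simp [he, intPot_self]
  have e1 : e 1 = Complex.exp (Complex.I * (intPot B X (X + v) : ℂ)) := by simp [he]
  rw [← h1, e0, e1, one_mul] at key
  rw [key, intervalIntegral.integral_of_le zero_le_one, ← lintegral_const_mul' _ _ (by simp)]
  refine (enorm_integral_le_lintegral_enorm _).trans (lintegral_mono_ae ?_)
  filter_upwards [h2] with σ hσ
  rw [← hσ]
  have hn : ‖e σ‖ₑ = 1 := by
    rw [← ofReal_norm, ← ENNReal.ofReal_one]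
    simp [he, mul_comm Complex.I]
  -- The derivative of the transported function is the transported covariant derivative, and the
  -- transport factor has modulus one.
  have : Complex.I * (inner ℝ (B (X + σ • v)) v : ℝ) * e σ * U (X + σ • v) +
      e σ * dotC v (G (X + σ • v)) = e σ * dotC v (covField B U G (X + σ • v)) := by
    rw [dotC_covField]
    ring
  rw [this, enorm_mul, hn, one_mul, ← ofReal_norm, ← ofReal_norm, ← ofReal_norm,
    ← ENNReal.ofReal_mul (norm_nonneg _)]
  exact ENNReal.ofReal_le_ofReal (norm_dotC_le v (covField B U G (X + σ • v)))

theorem HasWeakGradient.ae_enorm_cov_sub_le (h : HasWeakGradient U G) (hU : Measurable U)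
    (hG : Measurable G) {B : Rn (d + 1) → Rn (d + 1)} (hB : Continuous B) {v : Rn (d + 1)}
    (hv : 0 ≤ v (Fin.last d)) :
    ∀ᵐ X ∂halfMeasure d,
      ‖Complex.exp (Complex.I * (intPot B X (X + v) : ℂ)) * U (X + v) - U X‖ₑ ≤
        ‖v‖ₑ * ∫⁻ τ in Ioc (0 : ℝ) 1, ‖covField B U G (X + τ • v)‖ₑ := by
  filter_upwards [h.ae_sub_eq hU hG hv, h.ae_ae_eq_add_integral hU hG hv,
    ae_integrableOn_line ((dotC v).continuous.measurable.comp hG)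
      (h.locallyIntegrableOn_dotC v) hv] with X h1 h2 h3
  refine enorm_cov_sub_le_of_line hB h3 ?_
    (ae_restrict_of_ae_restrict_of_subset Ioc_subset_Ioi_self h2)
  rw [← h1]
  ring

end

/-! ### The boundary trace -/

theorem lintegral_comp_smul {E : Type*} [NormedAddCommGroup E] [NormedSpace ℝ E]
    [MeasurableSpace E] [BorelSpace E] [FiniteDimensional ℝ E] (μ : Measure E)
    [μ.IsAddHaarMeasure] (f : E → ℝ≥0∞) {r : ℝ} (hr : 0 < r) :
    ∫⁻ x, f (r • x) ∂μ = ENNReal.ofReal (r ^ (-(Module.finrank ℝ E : ℝ))) * ∫⁻ x, f x ∂μ := by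
  have h := lintegral_map_equiv (μ := μ) f (MeasurableEquiv.smul₀ r hr.ne' : E ≃ᵐ E)
  rw [MeasurableEquiv.coe_smul₀, Measure.map_addHaar_smul μ hr.ne', lintegral_smul_measure] at h
  rw [← h, Real.rpow_neg hr.le, Real.rpow_natCast, abs_of_pos (by positivity), smul_eq_mul]

theorem setLIntegral_Ioc_comp_mul (f : ℝ → ℝ≥0∞) {t : ℝ} (ht : 0 < t) :
    ENNReal.ofReal t * ∫⁻ τ in Ioc (0 : ℝ) 1, f (τ * t) = ∫⁻ τ in Ioc 0 t, f τ := by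
  have h := lintegral_comp_smul volume ((Ioc 0 t).indicator f) ht
  have e : ∀ x : ℝ, (Ioc 0 t).indicator f (t • x) = (Ioc 0 1).indicator (fun τ => f (τ * t)) x := by
    intro x
    simp only [indicator_apply, mem_Ioc, smul_eq_mul, mul_comm t]
    have h1 : 0 < x * t ↔ 0 < x := by simp [ht]
    have h2 : x * t ≤ t ↔ x ≤ 1 := by simpa using mul_le_mul_iff_left₀ ht (b := x) (c := 1)
    simp only [h1, h2]
  simp only [e] at h
  rw [lintegral_indicator measurableSet_Ioc, lintegral_indicator measurableSet_Ioc] at h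
  rw [h, ← mul_assoc, ← ENNReal.ofReal_mul ht.le]
  simp only [Module.finrank_self, Nat.cast_one, Real.rpow_neg_one]
  rw [mul_inv_cancel₀ ht.ne', ENNReal.ofReal_one, one_mul]

theorem setLIntegral_rpow_Ioc {a T : ℝ} (ha : -1 < a) (hT : 0 ≤ T) :
    ∫⁻ t in Ioc 0 T, ENNReal.ofReal (t ^ a) = ENNReal.ofReal (T ^ (a + 1) / (a + 1)) := by
  have hi : IntegrableOn (fun t : ℝ => t ^ a) (Ioc 0 T) := by
    have := intervalIntegral.intervalIntegrable_rpow' (a := 0) (b := T) ha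
    rwa [intervalIntegrable_iff_integrableOn_Ioc_of_le hT] at this
  rw [← ofReal_integral_eq_lintegral_ofReal hi, ← intervalIntegral.integral_of_le hT,
    integral_rpow (.inl ha), Real.zero_rpow (by linarith), sub_zero]
  filter_upwards [ae_restrict_mem measurableSet_Ioc] with t ht using Real.rpow_nonneg ht.1.le _

/-- A weighted Hölder inequality on `(0, T]`. -/
theorem rpow_setLIntegral_le {f : ℝ → ℝ≥0∞} (hf : Measurable f) {s q T : ℝ} (hs : 0 < s)
    (hq : 1 ≤ q) (hT : 0 ≤ T) :
    (∫⁻ t in Ioc 0 T, f t) ^ q ≤ ENNReal.ofReal (T ^ s / s) ^ (q - 1) *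
      ∫⁻ t in Ioc 0 T, ENNReal.ofReal (t ^ ((1 - s) * (q - 1))) * f t ^ q := by
  have hw : ∀ a : ℝ, Measurable fun t : ℝ => ENNReal.ofReal (t ^ a) := fun a => by fun_prop
  -- Jensen's inequality for the measure `t^{s-1} dt`, of total mass `T^s / s`, applied to `t^{1-s}
  -- f`. The exponents combine as `(s - 1) + (1 - s) q = (1 - s)(q - 1)`.
  set μ := (volume.restrict (Ioc 0 T)).withDensity fun t => ENNReal.ofReal (t ^ (s - 1)) with hμ
  have hμu : μ univ = ENNReal.ofReal (T ^ s / s) := by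
    rw [hμ, withDensity_apply _ MeasurableSet.univ, Measure.restrict_univ,
      setLIntegral_rpow_Ioc (by linarith) hT]
    simp
  have hmeas : Measurable fun t => ENNReal.ofReal (t ^ (1 - s)) * f t := (hw _).mul hf
  have h := lintegral_rpow_le_measure_rpow_mul (μ := μ) hmeas.aemeasurable hq
  rw [hμu, hμ, lintegral_withDensity_eq_lintegral_mul _ (hw _) hmeas,
    lintegral_withDensity_eq_lintegral_mul _ (hw _) (hmeas.pow_const q)] at h
  have e1 : ∫⁻ t in Ioc 0 T, f t = ∫⁻ t in Ioc 0 T, ((fun t => ENNReal.ofReal (t ^ (s - 1))) *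
      fun t => ENNReal.ofReal (t ^ (1 - s)) * f t) t := by
    refine setLIntegral_congr_fun measurableSet_Ioc fun t ht => ?_
    simp only [Pi.mul_apply]
    rw [← mul_assoc, ← ENNReal.ofReal_mul (Real.rpow_nonneg ht.1.le _), ← Real.rpow_add ht.1]
    simp
  have e2 : ∫⁻ t in Ioc 0 T, ((fun t => ENNReal.ofReal (t ^ (s - 1))) *
      fun t => (ENNReal.ofReal (t ^ (1 - s)) * f t) ^ q) t =
      ∫⁻ t in Ioc 0 T, ENNReal.ofReal (t ^ ((1 - s) * (q - 1))) * f t ^ q := by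
    refine setLIntegral_congr_fun measurableSet_Ioc fun t ht => ?_
    simp only [Pi.mul_apply]
    rw [ENNReal.mul_rpow_of_nonneg _ _ (by linarith), ENNReal.ofReal_rpow_of_pos
      (Real.rpow_pos_of_pos ht.1 _), ← mul_assoc,
      ← ENNReal.ofReal_mul (Real.rpow_nonneg ht.1.le _), ← Real.rpow_mul ht.1.le,
      ← Real.rpow_add ht.1]
    congr 3
    ring_nf
  rwa [← e1, e2] at h

/-- A function on `(0, ∞)` that is invariant under almost all forward translations is constant. -/
theorem exists_ae_eq_const {E : Type*} {D : ℝ → E}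
    (h : ∀ᵐ t ∂halfLine, ∀ᵐ σ ∂halfLine, D (t + σ) = D t) : ∃ c, ∀ᵐ t ∂halfLine, D t = c := by
  -- There are good base points arbitrarily close to `0`, and from each of them `D` is almost
  -- everywhere constant to the right.
  have hgood : ∀ n : ℕ, ∃ t, t ∈ Ioo (0 : ℝ) (1 / (n + 1)) ∧
      ∀ᵐ t' ∂volume.restrict (Ioi t), D t' = D t := by
    intro n
    have hn : (0 : ℝ) < 1 / (n + 1) := by positivity
    have h1 : ∀ᵐ t ∂volume.restrict (Ioo (0 : ℝ) (1 / (n + 1))), ∀ᵐ σ ∂halfLine, D (t + σ) = D t :=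
      ae_restrict_of_ae_restrict_of_subset Ioo_subset_Ioi_self h
    have : (ae (volume.restrict (Ioo (0 : ℝ) (1 / (n + 1))))).NeBot := by
      rw [ae_neBot, Ne, Measure.restrict_eq_zero, Real.volume_Ioo]
      simpa using hn
    obtain ⟨t, ht, htm⟩ := (h1.and (ae_restrict_mem measurableSet_Ioo)).exists
    refine ⟨t, htm, ?_⟩
    rw [ae_restrict_iff' measurableSet_Ioi] at ht ⊢
    have h2 := (measurePreserving_sub_right (volume : Measure ℝ) t).quasiMeasurePreserving.ae ht
    filter_upwards [h2] with t' h3 (h4 : t < t')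
    have := h3 (sub_pos.2 h4 : 0 < t' - t)
    rwa [add_sub_cancel] at this
  choose t ht1 ht2 using hgood
  refine ⟨D (t 0), ?_⟩
  -- Two such half-lines overlap in a set of positive measure, so their constants agree.
  have hconst : ∀ n, D (t n) = D (t 0) := by
    intro n
    have h1 := ae_restrict_of_ae_restrict_of_subset (Ioi_subset_Ioi (le_max_left (t n) (t 0))) (ht2 n)
    have h2 := ae_restrict_of_ae_restrict_of_subset (Ioi_subset_Ioi (le_max_right (t n) (t 0))) (ht2 0)
    have : (ae ((volume : Measure ℝ).restrict (Ioi (max (t n) (t 0))))).NeBot := by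
      rw [ae_neBot, Ne, Measure.restrict_eq_zero, Real.volume_Ioi]
      simp
    obtain ⟨x, hx1, hx2⟩ := (h1.and h2).exists
    rw [← hx1, hx2]
  have hcov : Ioi (0 : ℝ) ⊆ ⋃ n, Ioi (t n) := by
    intro x (hx : 0 < x)
    obtain ⟨n, hn⟩ := exists_nat_one_div_lt hx
    exact mem_iUnion.2 ⟨n, (ht1 n).2.trans hn⟩
  refine ae_restrict_of_ae_restrict_of_subset hcov ((ae_restrict_iUnion_iff _ _).2 fun n => ?_)
  filter_upwards [ht2 n] with x hx
  rw [hx, hconst]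

section Trace

variable {d : ℕ} {U : Rn (d + 1) → ℂ} {G : Rn (d + 1) → Cn (d + 1)}

/-- The boundary trace of a function `U` with weak gradient `G`. -/
def boundaryTrace (U : Rn (d + 1) → ℂ) (G : Rn (d + 1) → Cn (d + 1)) (x : Rn d) : ℂ :=
  ∫ t in Ioc (0 : ℝ) 1, (U (pt x t) - (1 - t) • G (pt x t) (Fin.last d))

theorem dotC_pt_zero_one (g : Cn (d + 1)) : dotC (pt (0 : Rn d) 1) g = g (Fin.last d) := by
  simp [dotC_apply, Fin.sum_univ_castSucc]

theorem pt_add_smul (x : Rn d) (t τ : ℝ) : pt x t + τ • pt (0 : Rn d) 1 = pt x (t + τ) := by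
  rw [← pt_smul, ← pt_add]
  simp

/-- Along almost every vertical line, `U` is the primitive of its normal derivative that starts
from the boundary trace. -/
theorem HasWeakGradient.ae_eq_boundaryTrace_add (h : HasWeakGradient U G) (hU : Measurable U)
    (hG : Measurable G) :
    ∀ᵐ x : Rn d, IntegrableOn (fun t => U (pt x t)) (Ioc 0 1) →
      (∀ T : ℝ, 0 < T → IntegrableOn (fun t => G (pt x t) (Fin.last d)) (Ioc 0 T)) →
      ∀ᵐ t ∂halfLine, U (pt x t) =
        boundaryTrace U G x + ∫ τ in (0 : ℝ)..t, G (pt x τ) (Fin.last d) := by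
  have h1 := h.ae_ae_eq_add_integral hU hG (v := pt 0 1) (by simp)
  rw [ae_half_iff] at h1
  filter_upwards [Measure.ae_ae_of_ae_prod h1] with x hx hUi hgi
  simp only [pt_add_smul, dotC_pt_zero_one] at hx
  set g : ℝ → ℂ := fun t => G (pt x t) (Fin.last d) with hg
  have hgii : ∀ a b : ℝ, 0 ≤ a → 0 ≤ b → IntervalIntegrable g volume a b := by
    have : ∀ T : ℝ, 0 ≤ T → IntervalIntegrable g volume 0 T := by
      intro T hT
      rcases hT.eq_or_lt with rfl | hT
      · simp
      · exact (intervalIntegrable_iff_integrableOn_Ioc_of_le hT.le).2 (hgi T hT)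
    exact fun a b ha hb => (this a ha).symm.trans (this b hb)
  obtain ⟨c, hc⟩ := exists_ae_eq_const (D := fun t => U (pt x t) - ∫ τ in (0 : ℝ)..t, g τ) (by
    filter_upwards [hx, ae_restrict_mem measurableSet_Ioi] with t ht (ht0 : 0 < t)
    filter_upwards [ht, ae_restrict_mem measurableSet_Ioi] with σ hσ (hσ0 : 0 < σ)
    rw [hσ, intervalIntegral.integral_comp_add_left (fun τ => G (pt x τ) (Fin.last d)) t, add_zero,
      ← intervalIntegral.integral_add_adjacent_intervals (hgii 0 t le_rfl ht0.le)
        (hgii t (t + σ) ht0.le (by positivity))]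
    ring)
  -- The constant is recovered by averaging `U - ∫₀ᵗ g = c` over `(0, 1]`. Since `∫₀¹ ∫₀ᵗ g = ∫₀¹ (1
  -- - t) g`, this explains the weight `1 - t` in `boundaryTrace`.
  have hc' : boundaryTrace U G x = c := by
    have e1 := mul_primitive_sub_eq_integral (e := fun σ : ℝ => (σ : ℂ)) (e' := fun _ => 1)
      (fun σ => Complex.ofRealCLM.hasDerivAt) continuous_const (hgi 1 one_pos) 0
    have hp : IntegrableOn (fun t => ∫ τ in (0 : ℝ)..t, g τ) (Ioc 0 1) :=
      ((intervalIntegral.continuousOn_primitive_interval' (hgii 0 1 le_rfl zero_le_one)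
        (by simp)).intervalIntegrable).1
    have hg1 : IntegrableOn (fun t : ℝ => (t : ℂ) * g t) (Ioc 0 1) :=
      ((hgii 0 1 le_rfl zero_le_one).continuousOn_mul
        (Complex.continuous_ofReal.continuousOn)).1
    simp only [Complex.ofReal_one, one_mul, zero_add, Complex.ofReal_zero, mul_zero, sub_zero] at e1
    rw [intervalIntegral.integral_of_le zero_le_one,
      intervalIntegral.integral_of_le zero_le_one, integral_add hp hg1] at e1
    have e2 : ∫ t in Ioc (0 : ℝ) 1, (U (pt x t) - ∫ τ in (0 : ℝ)..t, g τ) = c := by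
      rw [integral_congr_ae (ae_restrict_of_ae_restrict_of_subset Ioc_subset_Ioi_self hc)]
      simp
    rw [← e2, integral_sub hUi hp, boundaryTrace]
    have e3 : ∀ t : ℝ, U (pt x t) - (1 - t) • G (pt x t) (Fin.last d) =
        U (pt x t) - g t + t * g t := by
      intro t
      rw [Complex.real_smul, hg]
      push_cast
      ring
    simp only [e3]
    have e4 := integral_add (hUi.sub (hgi 1 one_pos)) hg1
    simp only [Pi.sub_apply] at e4
    rw [e4, integral_sub hUi (hgi 1 one_pos), e1]
    ring
  filter_upwards [hc] with t ht
  rw [hc', ← ht]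
  ring

/-- The covariant difference between the boundary trace and the values of `U` along a vertical
line is controlled by the covariant derivative. -/
theorem enorm_cov_sub_boundary_le {B : Rn (d + 1) → Rn (d + 1)} (hB : Continuous B) {x : Rn d} {c : ℂ}
    (hgi : ∀ T : ℝ, 0 < T → IntegrableOn (fun t => G (pt x t) (Fin.last d)) (Ioc 0 T))
    (h : ∀ᵐ t ∂halfLine, U (pt x t) = c + ∫ τ in (0 : ℝ)..t, G (pt x τ) (Fin.last d)) :
    ∀ᵐ t ∂halfLine, ‖Complex.exp (Complex.I * (intPot B (pt x 0) (pt x t) : ℂ)) * U (pt x t) - c‖ₑ ≤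
      ∫⁻ τ in Ioc 0 t, ‖covField B U G (pt x τ)‖ₑ := by
  filter_upwards [h, ae_restrict_mem measurableSet_Ioi] with t ht (ht0 : 0 < t)
  have hv : ∀ τ : ℝ, pt x 0 + τ • pt (0 : Rn d) t = pt x (τ * t) := by
    intro τ
    rw [← pt_smul, ← pt_add]
    simp
  have hv1 : pt x 0 + pt (0 : Rn d) t = pt x t := by simpa using hv 1
  have hdot : ∀ g : Cn (d + 1), dotC (pt (0 : Rn d) t) g = t • g (Fin.last d) := by
    intro g
    rw [← dotC_pt_zero_one, ← dotC_smul_left, ← pt_smul]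
    simp
  have hscale : ∀ σ : ℝ, ∫ τ in (0 : ℝ)..σ, dotC (pt (0 : Rn d) t) (G (pt x 0 + τ • pt (0 : Rn d) t)) =
      ∫ τ in (0 : ℝ)..σ * t, G (pt x τ) (Fin.last d) := by
    intro σ
    have := intervalIntegral.smul_integral_comp_mul_right (a := 0) (b := σ)
      (fun τ => G (pt x τ) (Fin.last d)) t
    rw [zero_mul] at this
    rw [← this, ← intervalIntegral.integral_smul]
    simp only [hv, hdot]
  have h3 : IntegrableOn (fun τ : ℝ => dotC (pt (0 : Rn d) t) (G (pt x 0 + τ • pt (0 : Rn d) t)))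
      (Ioc 0 1) := by
    simp only [hv, hdot]
    have i1 : IntervalIntegrable (fun τ => G (pt x τ) (Fin.last d)) volume 0 t :=
      (intervalIntegrable_iff_integrableOn_Ioc_of_le ht0.le).2 (hgi t ht0)
    have i2 := (i1.comp_mul_right (c := t)).smul t
    rw [zero_div, div_self ht0.ne', intervalIntegrable_iff_integrableOn_Ioc_of_le zero_le_one] at i2
    exact i2
  -- The segment starts on the boundary, where `U` has no meaningful value; the line estimate only
  -- uses the constant `c` of the primitive.
  have key := enorm_cov_sub_le_of_line (U := U) (G := G) hB (c := c) h3 (by rw [hscale, hv1, ht, one_mul]) ?_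
  · rw [hv1] at key
    refine key.trans_eq ?_
    rw [← setLIntegral_Ioc_comp_mul _ ht0, ← ofReal_norm, norm_pt_zero_left, abs_of_pos ht0]
    simp only [hv]
  · simp only [hscale]
    simp only [hv]
    rw [ae_restrict_iff' measurableSet_Ioi] at h
    -- Rescaling the line by `t` preserves null sets, so the formula for almost every height holds
    -- for almost every parameter on the segment.
    have hq : Measure.QuasiMeasurePreserving (fun τ : ℝ => τ * t) volume volume := by
      refine ⟨by fun_prop, ?_⟩
      rw [Real.map_volume_mul_right ht0.ne']
      exact Measure.smul_absolutelyContinuous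
    refine ae_restrict_of_ae_restrict_of_subset (t := Ioi 0) Ioc_subset_Ioi_self ?_
    rw [ae_restrict_iff' measurableSet_Ioi]
    filter_upwards [hq.ae h] with σ h1 (h2 : 0 < σ)
    exact h1 (mul_pos h2 ht0)

end Trace

/-! ### Power weights and weighted energies -/

/-- The weight `t^a` as an extended nonnegative number. -/
def wt (a t : ℝ) : ℝ≥0∞ := ENNReal.ofReal (t ^ a)

@[fun_prop]
theorem measurable_wt (a : ℝ) : Measurable (wt a) := by
  unfold wt
  fun_prop

@[fun_prop]
theorem measurable_wt_comp {α : Type*} [MeasurableSpace α] (a : ℝ) {f : α → ℝ} (hf : Measurable f) :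
    Measurable fun x => wt a (f x) := (measurable_wt a).comp hf

theorem wt_ne_top (a t : ℝ) : wt a t ≠ ⊤ := ENNReal.ofReal_ne_top

theorem wt_ne_zero (a : ℝ) {t : ℝ} (ht : 0 < t) : wt a t ≠ 0 := by
  simpa [wt] using Real.rpow_pos_of_pos ht a

theorem wt_mul_wt (a b : ℝ) {t : ℝ} (ht : 0 < t) : wt a t * wt b t = wt (a + b) t := by
  rw [wt, wt, wt, ← ENNReal.ofReal_mul (Real.rpow_nonneg ht.le _), Real.rpow_add ht]

theorem wt_rpow (a : ℝ) {q t : ℝ} (hq : 0 ≤ q) (ht : 0 < t) : wt a t ^ q = wt (a * q) t := by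
  rw [wt, wt, ENNReal.ofReal_rpow_of_nonneg (Real.rpow_nonneg ht.le _) hq, Real.rpow_mul ht.le]

theorem wt_mul_left (a : ℝ) {r t : ℝ} (hr : 0 ≤ r) (ht : 0 ≤ t) :
    wt a (r * t) = wt a r * wt a t := by
  rw [wt, wt, wt, ← ENNReal.ofReal_mul (Real.rpow_nonneg hr _), Real.mul_rpow hr ht]

theorem wt_zero (t : ℝ) : wt 0 t = 1 := by simp [wt]

theorem wt_one (t : ℝ) : wt 1 t = ENNReal.ofReal t := by simp [wt]

theorem wt_mono {a r t : ℝ} (ha : 0 ≤ a) (hr : 0 ≤ r) (hrt : r ≤ t) : wt a r ≤ wt a t :=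
  ENNReal.ofReal_le_ofReal (Real.rpow_le_rpow hr hrt ha)

theorem wt_mul_wt_neg (a : ℝ) {t : ℝ} (ht : 0 < t) : wt a t * wt (-a) t = 1 := by
  rw [wt_mul_wt _ _ ht, add_neg_cancel, wt_zero]

/-- The weighted energy `∬ t^γ f^q dx dt`. -/
def energy {d : ℕ} (γ q : ℝ) (f : Rn (d + 1) → ℝ≥0∞) : ℝ≥0∞ :=
  ∫⁻ X in halfSpace d, wt γ (X (Fin.last d)) * f X ^ q

section Energy

variable {d : ℕ} {γ q s : ℝ} {f : Rn (d + 1) → ℝ≥0∞}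

theorem energy_eq (γ q : ℝ) (hf : Measurable f) :
    energy γ q f = ∫⁻ x : Rn d, ∫⁻ t in Ioi (0 : ℝ), wt γ t * f (pt x t) ^ q := by
  rw [energy, lintegral_half (Measurable.aemeasurable (by fun_prop))]
  simp

theorem energy_eq_symm (γ q : ℝ) (hf : Measurable f) :
    energy γ q f = ∫⁻ t in Ioi (0 : ℝ), wt γ t * ∫⁻ x : Rn d, f (pt x t) ^ q := by
  rw [energy, lintegral_half_symm (Measurable.aemeasurable (by fun_prop))]
  simp only [pt_last]
  refine lintegral_congr fun t => ?_
  rw [lintegral_const_mul' _ _ (wt_ne_top _ _)]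

theorem rpow_setLIntegral_le_wt {f : ℝ → ℝ≥0∞} (hf : Measurable f) {T : ℝ} (hs : 0 < s)
    (hq : 1 ≤ q) (hT : 0 < T) :
    (∫⁻ t in Ioc 0 T, f t) ^ q ≤ ENNReal.ofReal (1 / s) ^ (q - 1) * wt (s * (q - 1)) T *
      ∫⁻ t in Ioc 0 T, wt ((1 - s) * (q - 1)) t * f t ^ q := by
  refine (rpow_setLIntegral_le hf hs hq hT.le).trans_eq ?_
  have : ENNReal.ofReal (T ^ s / s) ^ (q - 1) =
      ENNReal.ofReal (1 / s) ^ (q - 1) * wt (s * (q - 1)) T := by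
    rw [div_eq_mul_one_div, mul_comm (T ^ s), ENNReal.ofReal_mul (by positivity),
      ENNReal.mul_rpow_of_nonneg _ _ (by linarith), ← wt_rpow s (by linarith) hT, wt]
  rw [this]
  rfl

/-- The weight of the previous lemma is `t^s` times the weight of the energy, and `t^s ≤ T^s`. -/
theorem rpow_setLIntegral_le_wt' {f : ℝ → ℝ≥0∞} (hf : Measurable f) {T : ℝ} (hs : 0 < s)
    (hq : 1 ≤ q) (hT : 0 < T) :
    (∫⁻ t in Ioc 0 T, f t) ^ q ≤ ENNReal.ofReal (1 / s) ^ (q - 1) * wt (s * q) T *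
      ∫⁻ t in Ioc 0 T, wt ((1 - s) * q - 1) t * f t ^ q := by
  refine (rpow_setLIntegral_le_wt hf hs hq hT).trans ?_
  have h1 : s * q = s * (q - 1) + s := by ring
  rw [h1, ← wt_mul_wt _ _ hT, ← mul_assoc, mul_assoc _ (wt s T)]
  gcongr
  rw [← lintegral_const_mul' _ _ (wt_ne_top _ _)]
  refine setLIntegral_mono' measurableSet_Ioc fun t ht => ?_
  have h2 : (1 - s) * (q - 1) = s + ((1 - s) * q - 1) := by ring
  rw [h2, ← wt_mul_wt _ _ ht.1, mul_assoc]
  gcongr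
  exact wt_mono hs.le ht.1.le ht.2

/-- Finite energy forces integrability up to `t = 0` on almost every vertical line. The positivity
of `s` is essential: it makes the weighted Hölder constant finite. -/
theorem ae_setLIntegral_line_lt_top (hf : Measurable f) (hs : 0 < s) (hq : 1 ≤ q)
    (he : energy ((1 - s) * q - 1) q f < ⊤) :
    ∀ᵐ x : Rn d, ∀ T : ℝ, 0 < T → ∫⁻ t in Ioc 0 T, f (pt x t) < ⊤ := by
  rw [energy_eq _ _ hf] at he
  have hm : Measurable fun x : Rn d => ∫⁻ t in Ioi (0 : ℝ), wt ((1 - s) * q - 1) t * f (pt x t) ^ q :=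
    Measurable.lintegral_prod_right' (f := fun z : Rn d × ℝ => wt ((1 - s) * q - 1) z.2 *
      f (pt z.1 z.2) ^ q) (by fun_prop)
  filter_upwards [ae_lt_top hm he.ne] with x hx T hT
  have h1 := rpow_setLIntegral_le_wt' (f := fun t => f (pt x t)) (by fun_prop) hs hq hT
  rw [← ENNReal.rpow_lt_top_iff_of_pos (zero_lt_one.trans_le hq)]
  refine h1.trans_lt (ENNReal.mul_lt_top (ENNReal.mul_lt_top ?_ (wt_ne_top _ _).lt_top) ?_)
  · exact ENNReal.rpow_lt_top_of_nonneg (by linarith) ENNReal.ofReal_ne_top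
  · exact (lintegral_mono_set Ioc_subset_Ioi_self).trans_lt hx

end Energy

/-! ### Vertical estimates and the `L^q` bound of the boundary trace -/

section TraceEstimates

variable {d : ℕ} {U : Rn (d + 1) → ℂ} {G : Rn (d + 1) → Cn (d + 1)} {s q : ℝ}

theorem measurable_apply {n : ℕ} {α : Type*} [MeasurableSpace α] {F : α → Cn n}
    (hF : Measurable F) (j : Fin n) : Measurable fun a => F a j :=
  (EuclideanSpace.proj (𝕜 := ℂ) j).continuous.measurable.comp hF

theorem stronglyMeasurable_boundaryTrace (hU : Measurable U) (hG : Measurable G) :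
    StronglyMeasurable (boundaryTrace U G) := by
  have : Measurable fun z : Rn d × ℝ =>
      U (pt z.1 z.2) - (1 - z.2) • G (pt z.1 z.2) (Fin.last d) := by
    refine (hU.comp (by fun_prop)).sub ((by fun_prop : Measurable fun z : Rn d × ℝ => 1 - z.2).smul ?_)
    exact measurable_apply (hG.comp (by fun_prop)) _
  exact this.stronglyMeasurable.integral_prod_right'

theorem covField_apply {n : ℕ} (B : Rn n → Rn n) (U : Rn n → ℂ) (G : Rn n → Cn n) (X : Rn n)
    (j : Fin n) : covField B U G X j = G X j + Complex.I * (B X j : ℂ) * U X := rfl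

/-- Functions of finite energy are integrable up to the boundary along almost every vertical line. -/
theorem ae_integrableOn_vertical {B : Rn (d + 1) → Rn (d + 1)} (hB : Continuous B)
    (hU : Measurable U) (hG : Measurable G) (hs : 0 < s) (hq : 1 ≤ q)
    (eU : energy ((1 - s) * q - 1) q (fun X => ‖U X‖ₑ) < ⊤)
    (eF : energy ((1 - s) * q - 1) q (fun X => ‖covField B U G X‖ₑ) < ⊤) :
    ∀ᵐ x : Rn d, ∀ T : ℝ, 0 < T → IntegrableOn (fun t => U (pt x t)) (Ioc 0 T) ∧
      IntegrableOn (fun t => G (pt x t) (Fin.last d)) (Ioc 0 T) := by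
  have hF : Measurable (covField B U G) := measurable_covField hB.measurable hU hG
  filter_upwards [ae_setLIntegral_line_lt_top hU.enorm hs hq eU,
    ae_setLIntegral_line_lt_top hF.enorm hs hq eF] with x h1 h2 T hT
  have iU : IntegrableOn (fun t => U (pt x t)) (Ioc 0 T) :=
    ⟨(hU.comp (by fun_prop)).aestronglyMeasurable, h1 T hT⟩
  have iF : IntegrableOn (fun t => covField B U G (pt x t)) (Ioc 0 T) :=
    ⟨(hF.comp (by fun_prop)).aestronglyMeasurable, h2 T hT⟩
  have iFl := (EuclideanSpace.proj (𝕜 := ℂ) (Fin.last d)).integrable_comp iF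
  have hcB : Continuous fun t : ℝ => Complex.I * (B (pt x t) (Fin.last d) : ℂ) := by
    have : Continuous fun t : ℝ => B (pt x t) (Fin.last d) :=
      (by fun_prop : Continuous fun Y : Rn (d + 1) => Y (Fin.last d)).comp (hB.comp (by fun_prop))
    fun_prop
  have iBU : IntegrableOn (fun t => Complex.I * (B (pt x t) (Fin.last d) : ℂ) * U (pt x t))
      (Ioc 0 T) := by
    rw [← intervalIntegrable_iff_integrableOn_Ioc_of_le hT.le] at iU ⊢
    exact iU.continuousOn_mul hcB.continuousOn
  refine ⟨iU, (iFl.sub iBU).congr (.of_forall fun t => ?_)⟩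
  simp [covField_apply]

theorem HasWeakGradient.ae_enorm_cov_sub_boundaryTrace_le (h : HasWeakGradient U G)
    (hU : Measurable U) (hG : Measurable G) {B : Rn (d + 1) → Rn (d + 1)} (hB : Continuous B)
    (hs : 0 < s) (hq : 1 ≤ q)
    (eU : energy ((1 - s) * q - 1) q (fun X => ‖U X‖ₑ) < ⊤)
    (eF : energy ((1 - s) * q - 1) q (fun X => ‖covField B U G X‖ₑ) < ⊤) :
    ∀ᵐ x : Rn d, ∀ᵐ t ∂halfLine,
      ‖Complex.exp (Complex.I * (intPot B (pt x 0) (pt x t) : ℂ)) * U (pt x t) -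
        boundaryTrace U G x‖ₑ ≤ ∫⁻ τ in Ioc 0 t, ‖covField B U G (pt x τ)‖ₑ := by
  filter_upwards [h.ae_eq_boundaryTrace_add hU hG,
    ae_integrableOn_vertical hB hU hG hs hq eU eF] with x h1 h2
  exact enorm_cov_sub_boundary_le hB (fun T hT => (h2 T hT).2)
    (h1 (h2 1 one_pos).1 fun T hT => (h2 T hT).2)

theorem enorm_exp_I_mul_ofReal (θ : ℝ) : ‖Complex.exp (Complex.I * (θ : ℂ))‖ₑ = 1 := by
  rw [← ofReal_norm, mul_comm, Complex.norm_exp_ofReal_mul_I, ENNReal.ofReal_one]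

/-- The weighted `L^q` estimate of the boundary trace at scale `T`. -/
theorem HasWeakGradient.lintegral_boundaryTrace_le (h : HasWeakGradient U G)
    (hU : Measurable U) (hG : Measurable G) {B : Rn (d + 1) → Rn (d + 1)} (hB : Continuous B)
    (hs : 0 < s) (hs1 : s < 1) (hq : 1 ≤ q)
    (eU : energy ((1 - s) * q - 1) q (fun X => ‖U X‖ₑ) < ⊤)
    (eF : energy ((1 - s) * q - 1) q (fun X => ‖covField B U G X‖ₑ) < ⊤) {T : ℝ} (hT : 0 < T) :
    wt ((1 - s) * q) T * ∫⁻ x, ‖boundaryTrace U G x‖ₑ ^ q ≤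
      ENNReal.ofReal ((1 - s) * q) * 2 ^ q * (energy ((1 - s) * q - 1) q (fun X => ‖U X‖ₑ) +
        ENNReal.ofReal (1 / ((1 - s) * q)) * ENNReal.ofReal (1 / s) ^ (q - 1) * wt q T *
        energy ((1 - s) * q - 1) q (fun X => ‖covField B U G X‖ₑ)) := by
  have hF : Measurable (covField B U G) := measurable_covField hB.measurable hU hG
  have hq0 : 0 < q := zero_lt_one.trans_le hq
  set γ := (1 - s) * q - 1 with hγ
  have hγ1 : γ + 1 = (1 - s) * q := by rw [hγ]; ring
  have hpos : 0 < (1 - s) * q := mul_pos (by linarith) hq0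
  set m := ENNReal.ofReal (1 / ((1 - s) * q)) with hm
  -- The weight has finite mass near `0` because `s < 1`.
  have hwT : ∫⁻ t in Ioc 0 T, wt γ t = m * wt ((1 - s) * q) T := by
    have := setLIntegral_rpow_Ioc (a := γ) (by linarith) hT.le
    rw [hγ1, div_eq_mul_one_div, mul_comm, ENNReal.ofReal_mul (by positivity)] at this
    exact this
  set cs := ENNReal.ofReal (1 / s) ^ (q - 1) with hcs
  -- On a vertical line the trace is at most `|U(x, t)|` plus the integral of the covariant field up
  -- to height `T`, which no longer depends on `t`; this is averaged over `t ∈ (0, T]` with the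
  -- weight.
  have hpt : ∀ᵐ x : Rn d, m * wt ((1 - s) * q) T * ‖boundaryTrace U G x‖ₑ ^ q ≤
      2 ^ q * ((∫⁻ t in Ioi (0 : ℝ), wt γ t * ‖U (pt x t)‖ₑ ^ q) +
        m * wt ((1 - s) * q) T * (cs * wt (s * q) T *
          ∫⁻ t in Ioi (0 : ℝ), wt γ t * ‖covField B U G (pt x t)‖ₑ ^ q)) := by
    filter_upwards [h.ae_enorm_cov_sub_boundaryTrace_le hU hG hB hs hq eU eF] with x hx
    have hx' := ae_restrict_of_ae_restrict_of_subset
      (Ioc_subset_Ioi_self : Ioc 0 T ⊆ Ioi (0 : ℝ)) hx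
    set N := ∫⁻ τ in Ioc 0 T, ‖covField B U G (pt x τ)‖ₑ with hN
    have hb : ∀ᵐ t ∂volume.restrict (Ioc 0 T), wt γ t * ‖boundaryTrace U G x‖ₑ ^ q ≤
        2 ^ q * (wt γ t * ‖U (pt x t)‖ₑ ^ q + wt γ t * N ^ q) := by
      filter_upwards [hx', ae_restrict_mem measurableSet_Ioc] with t ht htm
      have h1 : ‖boundaryTrace U G x‖ₑ ≤ ‖U (pt x t)‖ₑ + N := by
        set e := Complex.exp (Complex.I * (intPot B (pt x 0) (pt x t) : ℂ))
        have e1 : boundaryTrace U G x = e * U (pt x t) - (e * U (pt x t) - boundaryTrace U G x) := by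
          ring
        rw [e1]
        refine enorm_sub_le.trans (add_le_add ?_ (ht.trans ?_))
        · rw [enorm_mul, enorm_exp_I_mul_ofReal, one_mul]
        · exact lintegral_mono_set (Ioc_subset_Ioc_right htm.2)
      calc wt γ t * ‖boundaryTrace U G x‖ₑ ^ q
          ≤ wt γ t * (2 ^ q * (‖U (pt x t)‖ₑ ^ q + N ^ q)) := by
            gcongr
            exact (ENNReal.rpow_le_rpow h1 hq0.le).trans (rpow_add_le hq _ _)
        _ = _ := by ring
    have h2 := lintegral_mono_ae hb
    rw [lintegral_mul_const _ (measurable_wt _), hwT,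
      lintegral_const_mul _ (by fun_prop), lintegral_add_right _ (by fun_prop),
      lintegral_mul_const _ (measurable_wt _), hwT] at h2
    refine h2.trans ?_
    gcongr
    · exact Ioc_subset_Ioi_self
    · refine (rpow_setLIntegral_le_wt' (f := fun t => ‖covField B U G (pt x t)‖ₑ)
        (by fun_prop) hs hq hT).trans ?_
      gcongr
      exact Ioc_subset_Ioi_self
  have h3 := lintegral_mono_ae hpt
  have hmF : Measurable fun x : Rn d => ∫⁻ t in Ioi (0 : ℝ), wt γ t * ‖covField B U G (pt x t)‖ₑ ^ q :=
    Measurable.lintegral_prod_right' (f := fun z : Rn d × ℝ => wt γ z.2 *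
      ‖covField B U G (pt z.1 z.2)‖ₑ ^ q) (by fun_prop)
  have hmT := (stronglyMeasurable_boundaryTrace hU hG).measurable
  rw [lintegral_const_mul _ (by fun_prop), lintegral_const_mul' _ _ (by simp),
    lintegral_add_right _ (by fun_prop), lintegral_const_mul _ (by fun_prop),
    lintegral_const_mul _ (by fun_prop), ← energy_eq γ q hU.enorm, ← energy_eq γ q hF.enorm] at h3
  have hm1 : ENNReal.ofReal ((1 - s) * q) * m = 1 := by
    rw [hm, ← ENNReal.ofReal_mul hpos.le, mul_one_div_cancel hpos.ne', ENNReal.ofReal_one]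
  calc wt ((1 - s) * q) T * ∫⁻ x, ‖boundaryTrace U G x‖ₑ ^ q
      = ENNReal.ofReal ((1 - s) * q) *
          (m * wt ((1 - s) * q) T * ∫⁻ x, ‖boundaryTrace U G x‖ₑ ^ q) := by
        rw [← mul_assoc, ← mul_assoc, hm1, one_mul]
    _ ≤ _ := by
        rw [mul_assoc _ (2 ^ q)]
        refine mul_le_mul' le_rfl ?_
        refine h3.trans_eq ?_
        have : wt q T = wt ((1 - s) * q) T * wt (s * q) T := by
          rw [wt_mul_wt _ _ hT]
          congr 1
          ring
        rw [this]
        ring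

end TraceEstimates

/-! ### Radial integrals -/

section Radial

variable {d : ℕ}

theorem lintegral_norm_scale (g : ℝ → ℝ≥0∞) {t : ℝ} (ht : 0 < t) :
    ∫⁻ h : Rn d, g ‖h‖ = wt d t * ∫⁻ k : Rn d, g (t * ‖k‖) := by
  have h1 := lintegral_comp_smul (volume : Measure (Rn d)) (fun h => g ‖h‖) ht
  simp only [norm_smul, Real.norm_of_nonneg ht.le, finrank_euclideanSpace, Fintype.card_fin] at h1
  rw [h1, ← mul_assoc]
  change _ = wt d t * wt (-d) t * _
  rw [wt_mul_wt_neg _ ht, one_mul]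

/-- The tail of `|h|^{-(d + a)}`, normalized. -/
def tailConst (d : ℕ) (a : ℝ) : ℝ≥0∞ :=
  ∫⁻ h : Rn d, {h : Rn d | 1 ≤ 2 * ‖h‖}.indicator (fun h => wt (-(d + a)) ‖h‖) h

/-- On the region of integration `1 + |h| ≤ 3 |h|`, so the integrand is dominated by a multiple of
`(1 + |h|)^{-(d+a)}`. -/
theorem tailConst_lt_top (d : ℕ) {a : ℝ} (ha : 0 < a) : tailConst d a < ⊤ := by
  have hi : Integrable (fun h : Rn d => (1 + ‖h‖) ^ (-((d : ℝ) + a))) :=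
    integrable_one_add_norm (by simpa using ha)
  have hfin : ENNReal.ofReal (3 ^ ((d : ℝ) + a)) *
      ∫⁻ h : Rn d, ENNReal.ofReal ((1 + ‖h‖) ^ (-((d : ℝ) + a))) < ⊤ := by
    refine ENNReal.mul_lt_top ENNReal.ofReal_lt_top ?_
    rw [← ofReal_integral_eq_lintegral_ofReal hi (.of_forall fun h => by positivity)]
    exact ENNReal.ofReal_lt_top
  refine lt_of_le_of_lt ?_ hfin
  rw [← lintegral_const_mul' _ _ ENNReal.ofReal_ne_top]
  refine lintegral_mono fun h => ?_
  by_cases hh : 1 ≤ 2 * ‖h‖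
  swap
  · rw [indicator_of_notMem (show h ∉ {h : Rn d | 1 ≤ 2 * ‖h‖} from hh)]
    exact zero_le
  rw [indicator_of_mem (show h ∈ {h : Rn d | 1 ≤ 2 * ‖h‖} from hh)]
  rw [wt, ← ENNReal.ofReal_mul (by positivity)]
  refine ENNReal.ofReal_le_ofReal ?_
  have hpos : 0 < ‖h‖ := by linarith
  have hda : 0 < (d : ℝ) + a := by positivity
  have h3 : 1 + ‖h‖ ≤ 3 * ‖h‖ := by linarith
  rw [Real.rpow_neg (by positivity), Real.rpow_neg (by positivity), ← div_eq_mul_inv,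
    inv_eq_one_div, div_le_div_iff₀ (by positivity) (by positivity), one_mul,
    ← Real.mul_rpow (by norm_num) hpos.le]
  exact Real.rpow_le_rpow (by positivity) h3 hda.le

/-- Substitute `h = t k`. -/
theorem lintegral_tail (a : ℝ) {t : ℝ} (ht : 0 < t) :
    ∫⁻ h : Rn d, {h : Rn d | t ≤ 2 * ‖h‖}.indicator (fun h => wt (-(d + a)) ‖h‖) h =
      wt (-a) t * tailConst d a := by
  have h1 := lintegral_norm_scale (d := d)
    (fun r => {r : ℝ | t ≤ 2 * r}.indicator (wt (-(d + a))) r) ht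
  have e1 : ∀ h : Rn d, {h : Rn d | t ≤ 2 * ‖h‖}.indicator (fun h => wt (-(d + a)) ‖h‖) h =
      {r : ℝ | t ≤ 2 * r}.indicator (wt (-(d + a))) ‖h‖ := fun h => by
    simp only [indicator_apply, mem_ofPred_eq]
  have e2 : ∀ k : Rn d, {r : ℝ | t ≤ 2 * r}.indicator (wt (-(d + a))) (t * ‖k‖) =
      wt (-(d + a)) t * {h : Rn d | 1 ≤ 2 * ‖h‖}.indicator (fun h => wt (-(d + a)) ‖h‖) k := by
    intro k
    have : t ≤ 2 * (t * ‖k‖) ↔ 1 ≤ 2 * ‖k‖ := by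
      rw [mul_left_comm, le_mul_iff_one_le_right ht]
    simp only [indicator_apply, mem_ofPred_eq, this]
    split_ifs
    · exact wt_mul_left _ ht.le (norm_nonneg k)
    · simp
  simp only [e1]
  rw [h1]
  simp only [e2]
  rw [lintegral_const_mul' _ _ (wt_ne_top _ _), ← mul_assoc, wt_mul_wt _ _ ht, tailConst]
  congr 2
  ring

/-- The constant in the integral of the phase defect. -/
def phaseConst (d : ℕ) (s q : ℝ) : ℝ≥0∞ :=
  ∫⁻ k : Rn d, wt (-(d + s * q)) ‖k‖ * ENNReal.ofReal (min 2 (12 * ‖k‖ ^ 2)) ^ q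

/-- Away from `0` the bound `2` leaves the tail `|k|^{-(d+sq)}`, which is integrable as `s > 0`.
Near `0` the quadratic bound gives `|k|^{2q-sq-d}`, whose exponent exceeds `-d`. -/
theorem phaseConst_lt_top (hd : 1 ≤ d) {s q : ℝ} (hs : 0 < s) (hs1 : s < 1) (hq : 1 ≤ q) :
    phaseConst d s q < ⊤ := by
  have hq0 : 0 < q := zero_lt_one.trans_le hq
  have h1 : ∀ k : Rn d, wt (-(d + s * q)) ‖k‖ * ENNReal.ofReal (min 2 (12 * ‖k‖ ^ 2)) ^ q ≤
      2 ^ q * {h : Rn d | 1 ≤ 2 * ‖h‖}.indicator (fun h => wt (-(d + s * q)) ‖h‖) k +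
        12 ^ q * (Metric.ball (0 : Rn d) 1).indicator (fun k => wt (-(d + s * q - 2 * q)) ‖k‖) k := by
    intro k
    by_cases hk : 1 ≤ 2 * ‖k‖
    · refine le_add_right ?_
      rw [indicator_of_mem (show k ∈ {h : Rn d | 1 ≤ 2 * ‖h‖} from hk), mul_comm]
      gcongr
      exact (ENNReal.ofReal_le_ofReal (min_le_left _ _)).trans_eq (ENNReal.ofReal_ofNat 2)
    · refine le_add_left ?_
      rw [indicator_of_mem (by rw [mem_ball_zero_iff]; linarith)]
      rcases eq_or_ne k 0 with rfl | hk0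
      · simp [hq0]
      have hpos : 0 < ‖k‖ := norm_pos_iff.2 hk0
      calc wt (-(d + s * q)) ‖k‖ * ENNReal.ofReal (min 2 (12 * ‖k‖ ^ 2)) ^ q
          ≤ wt (-(d + s * q)) ‖k‖ * (12 * wt 2 ‖k‖) ^ q := by
            gcongr
            refine (ENNReal.ofReal_le_ofReal (min_le_right _ _)).trans_eq ?_
            rw [ENNReal.ofReal_mul (by norm_num), ENNReal.ofReal_ofNat, wt, Real.rpow_two]
        _ = 12 ^ q * wt (-(d + s * q - 2 * q)) ‖k‖ := by
            rw [ENNReal.mul_rpow_of_nonneg _ _ hq0.le, wt_rpow _ hq0.le hpos, mul_left_comm,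
              wt_mul_wt _ _ hpos]
            congr 2
            ring
  refine (lintegral_mono h1).trans_lt ?_
  have hind : Measurable fun k : Rn d =>
      {h : Rn d | 1 ≤ 2 * ‖h‖}.indicator (fun h => wt (-(d + s * q)) ‖h‖) k :=
    (by fun_prop : Measurable fun h : Rn d => wt (-(d + s * q)) ‖h‖).indicator
      (measurableSet_le measurable_const (by fun_prop))
  have h2 : (2 : ℝ≥0∞) ^ q ≠ ⊤ := ENNReal.rpow_ne_top_of_nonneg hq0.le ENNReal.ofNat_ne_top
  have h12 : (12 : ℝ≥0∞) ^ q ≠ ⊤ := ENNReal.rpow_ne_top_of_nonneg hq0.le ENNReal.ofNat_ne_top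
  rw [lintegral_add_left (hind.const_mul _), lintegral_const_mul' _ _ h2,
    lintegral_const_mul' _ _ h12, lintegral_indicator measurableSet_ball]
  refine ENNReal.add_lt_top.2 ⟨ENNReal.mul_lt_top h2.lt_top (tailConst_lt_top d (by positivity)),
    ENNReal.mul_lt_top h12.lt_top ?_⟩
  have hα : d + s * q - 2 * q < Module.finrank ℝ (Rn d) := by
    rw [finrank_euclideanSpace, Fintype.card_fin]
    nlinarith
  have hi := integrableOn_ball_of_norm_le_rpow (μ := (volume : Measure (Rn d))) (r := 1) (C := 1)
    (f := fun k : Rn d => ‖k‖ ^ (-(d + s * q - 2 * q))) (by simpa using hd) hα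
    (.of_forall fun k => by rw [Real.norm_of_nonneg (by positivity), one_mul])
    (Measurable.aestronglyMeasurable (by fun_prop))
  unfold wt
  rw [← ofReal_integral_eq_lintegral_ofReal hi (.of_forall fun k => by positivity)]
  exact ENNReal.ofReal_lt_top

/-- The substitution `h = β^{-1/2} k` removes `β` from the minimum, and the homogeneity of the
weight and of the measure leaves `β^{sq/2}`. -/
theorem lintegral_phase {s q : ℝ} (hs : 0 < s) (hq : 0 < q) {β : ℝ} (hβ : 0 ≤ β) :
    ∫⁻ h : Rn d, wt (-(d + s * q)) ‖h‖ * ENNReal.ofReal (min 2 (12 * β * ‖h‖ ^ 2)) ^ q =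
      phaseConst d s q * ENNReal.ofReal β ^ (s * q / 2) := by
  rcases hβ.eq_or_lt with rfl | hβ
  · have : 0 < s * q / 2 := by positivity
    simp [hq, this]
  set t := β ^ (-(1 / 2) : ℝ) with ht
  have ht0 : 0 < t := Real.rpow_pos_of_pos hβ _
  have htt : β * t ^ 2 = 1 := by
    rw [ht, ← Real.rpow_natCast, ← Real.rpow_mul hβ.le]
    norm_num
    rw [Real.rpow_neg_one, mul_inv_cancel₀ hβ.ne']
  have h1 := lintegral_norm_scale (d := d) (fun r => wt (-(d + s * q)) r *
    ENNReal.ofReal (min 2 (12 * β * r ^ 2)) ^ q) ht0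
  rw [h1]
  have e : ∀ k : Rn d, wt (-(d + s * q)) (t * ‖k‖) *
      ENNReal.ofReal (min 2 (12 * β * (t * ‖k‖) ^ 2)) ^ q = wt (-(d + s * q)) t *
        (wt (-(d + s * q)) ‖k‖ * ENNReal.ofReal (min 2 (12 * ‖k‖ ^ 2)) ^ q) := by
    intro k
    rw [wt_mul_left _ ht0.le (norm_nonneg k), mul_assoc]
    have : 12 * β * (t * ‖k‖) ^ 2 = 12 * ‖k‖ ^ 2 := by
      rw [mul_pow]
      linear_combination 12 * ‖k‖ ^ 2 * htt
    rw [this]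
  simp only [e]
  rw [lintegral_const_mul' _ _ (wt_ne_top _ _), ← mul_assoc, wt_mul_wt _ _ ht0, phaseConst, mul_comm]
  congr 1
  rw [wt, ht, ← Real.rpow_mul hβ.le, ENNReal.ofReal_rpow_of_pos hβ]
  congr 2
  ring

/-- Tonelli on `S`, in the form needed to exchange heights with increments for the trace, and
heights with pairs of boundary points for the extension. -/
theorem lintegral_lintegral_indicator_swap {α : Type*} [MeasurableSpace α] {μ : Measure α}
    [SFinite μ] {w : α → ℝ≥0∞} (hw : Measurable w) {g : ℝ → ℝ≥0∞} (hg : Measurable g)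
    {S : Set (α × ℝ)} (hS : MeasurableSet S) (hS0 : ∀ z ∈ S, 0 < z.2) :
    ∫⁻ h, (w h * ∫⁻ t in {t | (h, t) ∈ S}, g t) ∂μ =
      ∫⁻ t in Ioi (0 : ℝ), g t * ∫⁻ h, {h | (h, t) ∈ S}.indicator w h ∂μ := by
  have hm : Measurable fun z : α × ℝ => S.indicator (fun z => w z.1 * g z.2) z :=
    Measurable.indicator (by fun_prop) hS
  have e1 : ∀ h, w h * ∫⁻ t in {t | (h, t) ∈ S}, g t =
      ∫⁻ t, S.indicator (fun z => w z.1 * g z.2) (h, t) := by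
    intro h
    have hSh : MeasurableSet {t | (h, t) ∈ S} := measurable_prodMk_left hS
    rw [← lintegral_const_mul _ hg, ← lintegral_indicator hSh]
    rfl
  have e2 : ∀ t, ∫⁻ h, S.indicator (fun z => w z.1 * g z.2) (h, t) ∂μ =
      (Ioi (0 : ℝ)).indicator (fun t => g t * ∫⁻ h, {h | (h, t) ∈ S}.indicator w h ∂μ) t := by
    intro t
    by_cases ht : 0 < t
    · have hSt : MeasurableSet {h | (h, t) ∈ S} := measurable_prodMk_right hS
      rw [indicator_of_mem (show t ∈ Ioi (0 : ℝ) from ht),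
        ← lintegral_const_mul _ (hw.indicator hSt)]
      refine lintegral_congr fun h => ?_
      by_cases hh : (h, t) ∈ S
      · rw [indicator_of_mem hh, indicator_of_mem (show h ∈ {h | (h, t) ∈ S} from hh), mul_comm]
      · rw [indicator_of_notMem hh, indicator_of_notMem (show h ∉ {h | (h, t) ∈ S} from hh), mul_zero]
    · rw [indicator_of_notMem (show t ∉ Ioi (0 : ℝ) from ht)]
      have : ∀ h, (h, t) ∉ S := fun h hh => ht (hS0 _ hh)
      simp [this]
  simp only [e1]
  rw [lintegral_lintegral_swap hm.aemeasurable]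
  simp only [e2]
  rw [lintegral_indicator measurableSet_Ioi]

end Radial

/-! ### The Gagliardo estimate of the trace -/

/-- Both bounds are needed: the linear one makes the phase term integrable for small increments, the
trivial bound `2` for large ones. -/
theorem enorm_exp_sub_one_le (θ : ℝ) {M : ℝ} (h : |θ| ≤ M) :
    ‖Complex.exp (Complex.I * (θ : ℂ)) - 1‖ₑ ≤ ENNReal.ofReal (min 2 M) := by
  rw [← ofReal_norm]
  refine ENNReal.ofReal_le_ofReal (le_min ?_ (Real.norm_exp_I_mul_ofReal_sub_one_le.trans h))
  refine (norm_sub_le _ _).trans_eq ?_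
  rw [mul_comm, Complex.norm_exp_ofReal_mul_I, norm_one]
  norm_num

section

variable {d : ℕ} {B : Rn (d + 1) → Rn (d + 1)} {β : ℝ}

/-- The circulation along a vertical rectangle based on the boundary. -/
theorem CurlBound.abs_rectangle_le (hB : CurlBound B β) (x h : Rn d) {t : ℝ} (ht0 : 0 ≤ t)
    (ht : t ≤ 2 * ‖h‖) :
    |intPot B (pt x 0) (pt x t) + intPot B (pt x t) (pt (x + h) t) +
      intPot B (pt (x + h) t) (pt (x + h) 0) - intPot B (pt x 0) (pt (x + h) 0)| ≤
      12 * β * ‖h‖ ^ 2 := by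
  have m : ∀ (y : Rn d) {r : ℝ}, 0 ≤ r → pt y r ∈ closedHalfSpace d := fun y r hr =>
    pt_mem_closedHalfSpace.2 hr
  have n1 : ‖pt (x + h) t - pt x 0‖ ≤ 3 * ‖h‖ := by
    rw [← pt_sub, add_sub_cancel_left, sub_zero]
    refine (norm_pt_le _ _).trans ?_
    rw [abs_of_nonneg ht0]
    linarith
  have n2 : ‖pt (x + h) t - pt x t‖ ≤ 3 * ‖h‖ := by
    rw [← pt_sub, add_sub_cancel_left, sub_self, norm_pt_zero]
    linarith [norm_nonneg h]
  have n3 : ‖pt x t - pt x 0‖ ≤ 2 * ‖h‖ := by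
    rw [← pt_sub, sub_self, sub_zero, norm_pt_zero_left, abs_of_nonneg ht0]
    exact ht
  have n4 : ‖pt (x + h) 0 - pt x 0‖ ≤ 2 * ‖h‖ := by
    rw [← pt_sub, add_sub_cancel_left, sub_zero, norm_pt_zero]
    linarith [norm_nonneg h]
  have n5 : ‖pt (x + h) 0 - pt (x + h) t‖ ≤ 2 * ‖h‖ := by
    rw [← pt_sub, sub_self, zero_sub, norm_pt_zero_left, abs_neg, abs_of_nonneg ht0]
    exact ht
  -- The diagonal from `(x, 0)` to `(x + h, t)` cuts the rectangle into two triangles. With sides at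
  -- most `2|h|` and `3|h|`, each contributes `6 β |h|²`.
  have t1 := hB.abs_triangle_le (m x le_rfl) (m (x + h) ht0) (m x ht0) n1 n2
  have t2 := hB.abs_triangle_le (m x le_rfl) (m (x + h) le_rfl) (m (x + h) ht0) n4 n5
  have hβ := hB.nonneg
  have b1 : β * ‖pt x t - pt x 0‖ * (3 * ‖h‖) ≤ β * (2 * ‖h‖) * (3 * ‖h‖) := by gcongr
  have b2 : β * ‖pt (x + h) t - pt x 0‖ * (2 * ‖h‖) ≤ β * (3 * ‖h‖) * (2 * ‖h‖) := by gcongr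
  rw [abs_le] at t1 t2 ⊢
  constructor <;> nlinarith

/-- The covariant difference of boundary values, compared along a vertical rectangle. -/
theorem CurlBound.enorm_cov_sub_le_rectangle (hB : CurlBound B β) (x h : Rn d) {t : ℝ}
    (ht0 : 0 ≤ t) (ht : t ≤ 2 * ‖h‖) (a b U V : ℂ) :
    ‖Complex.exp (Complex.I * (intPot B (pt x 0) (pt (x + h) 0) : ℂ)) * b - a‖ₑ ≤
      ‖Complex.exp (Complex.I * (intPot B (pt x 0) (pt x t) : ℂ)) * U - a‖ₑ +
      ‖Complex.exp (Complex.I * (intPot B (pt (x + h) 0) (pt (x + h) t) : ℂ)) * V - b‖ₑ +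
      ‖Complex.exp (Complex.I * (intPot B (pt x t) (pt (x + h) t) : ℂ)) * V - U‖ₑ +
      ENNReal.ofReal (min 2 (12 * β * ‖h‖ ^ 2)) * ‖b‖ₑ := by
  set i1 := intPot B (pt x 0) (pt x t) with hi1
  set i2 := intPot B (pt x t) (pt (x + h) t) with hi2
  set i3 := intPot B (pt (x + h) 0) (pt (x + h) t) with hi3
  set i0 := intPot B (pt x 0) (pt (x + h) 0) with hi0
  have hθ : |i1 + i2 - i3 - i0| ≤ 12 * β * ‖h‖ ^ 2 := by
    have := hB.abs_rectangle_le x h ht0 ht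
    rwa [intPot_symm B (pt (x + h) 0) (pt (x + h) t), ← hi1, ← hi2, ← hi3, ← hi0,
      ← sub_eq_add_neg] at this
  set e : ℝ → ℂ := fun r => Complex.exp (Complex.I * (r : ℂ)) with he
  have hadd : ∀ r r', e (r + r') = e r * e r' := fun r r' => by
    simp only [he]
    rw [← Complex.exp_add]
    push_cast
    ring_nf
  have hn : ∀ r, ‖e r‖ₑ = 1 := enorm_exp_I_mul_ofReal
  -- Telescoping along the path up, across and down. The last summand corrects for transporting `b`
  -- along the base instead of along this path, and the phase there is the circulation around the
  -- rectangle.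
  have d1 : e i0 * b - a = (e i1 * U - a) + -(e (i1 + i2 - i3) * (e i3 * V - b)) +
      e i1 * (e i2 * V - U) + -(e i0 * ((e (i1 + i2 - i3 - i0) - 1) * b)) := by
    have k1 : e (i1 + i2 - i3) * e i3 = e i1 * e i2 := by
      rw [← hadd, ← hadd]
      congr 1
      ring
    have k2 : e i0 * e (i1 + i2 - i3 - i0) = e (i1 + i2 - i3) := by
      rw [← hadd]
      congr 1
      ring
    linear_combination V * k1 + b * k2
  change ‖e i0 * b - a‖ₑ ≤ ‖e i1 * U - a‖ₑ + ‖e i3 * V - b‖ₑ + ‖e i2 * V - U‖ₑ + _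
  rw [d1]
  refine (enorm_add_le _ _).trans (add_le_add ((enorm_add_le _ _).trans
    (add_le_add ((enorm_add_le _ _).trans (add_le_add le_rfl ?_)) ?_)) ?_)
  · rw [enorm_neg, enorm_mul, hn, one_mul]
  · rw [enorm_mul, hn, one_mul]
  · rw [enorm_neg, enorm_mul, hn, one_mul, enorm_mul]
    gcongr
    exact enorm_exp_sub_one_le _ hθ

theorem covDiff_parallel (B : Rn (d + 1) → Rn (d + 1)) (u : Rn d → ℂ) (x y : Rn d) :
    covDiff (parallel B) u (x, y) =
      Complex.exp (Complex.I * (intPot B (pt x 0) (pt y 0) : ℂ)) * u y - u x := by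
  rw [covDiff, intPot_parallel]
  rfl

theorem continuous_parallel (hB : Continuous B) : Continuous (parallel B) := by
  unfold parallel
  refine (PiLp.continuous_toLp 2 _).comp (continuous_pi fun j => ?_)
  exact (by fun_prop : Continuous fun Y : Rn (d + 1) => Y j.castSucc).comp
    (hB.comp (by change Continuous fun x : Rn d => pt x 0; fun_prop))

theorem measurable_covDiff {n : ℕ} {a : Rn n → Rn n} (ha : Continuous a) {u : Rn n → ℂ}
    (hu : Measurable u) : Measurable (covDiff a u) := by
  unfold covDiff
  have := (continuous_intPot ha).measurable
  fun_prop

theorem lintegral_prod_translate {n : ℕ} {f : Rn n × Rn n → ℝ≥0∞} (hf : Measurable f) :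
    ∫⁻ z, f z = ∫⁻ h, ∫⁻ x, f (x, x + h) := by
  rw [Measure.volume_eq_prod, lintegral_prod _ hf.aemeasurable]
  have : ∀ x, ∫⁻ y, f (x, y) = ∫⁻ h, f (x, x + h) := fun x =>
    (lintegral_add_left_eq_self (fun y => f (x, y)) x).symm
  simp only [this]
  exact lintegral_lintegral_swap (Measurable.aemeasurable (by fun_prop))

variable {U : Rn (d + 1) → ℂ} {G : Rn (d + 1) → Cn (d + 1)} {s q : ℝ}

/-- The `L^q` norm of covariant differences of the trace for a fixed increment. -/
theorem HasWeakGradient.lintegral_covDiff_boundaryTrace_le (hUG : HasWeakGradient U G)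
    (hU : Measurable U) (hG : Measurable G) (hB : CurlBound B β) (hs : 0 < s) (hq : 1 ≤ q)
    (eU : energy ((1 - s) * q - 1) q (fun X => ‖U X‖ₑ) < ⊤)
    (eF : energy ((1 - s) * q - 1) q (fun X => ‖covField B U G X‖ₑ) < ⊤) {h : Rn d} (hh : h ≠ 0) :
    ∫⁻ x, ‖covDiff (parallel B) (boundaryTrace U G) (x, x + h)‖ₑ ^ q ≤
      8 ^ q * (2 * (ENNReal.ofReal (1 / s) ^ (q - 1) * wt (s * (q - 1)) (2 * ‖h‖) *
          ∫⁻ t in Ioc 0 (2 * ‖h‖), wt ((1 - s) * (q - 1)) t *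
            ∫⁻ x : Rn d, ‖covField B U G (pt x t)‖ₑ ^ q) +
        wt (q - 1) ‖h‖ * (∫⁻ t in Ioc ‖h‖ (2 * ‖h‖), ∫⁻ x : Rn d, ‖covField B U G (pt x t)‖ₑ ^ q) +
        ENNReal.ofReal (min 2 (12 * β * ‖h‖ ^ 2)) ^ q *
          ∫⁻ x, ‖boundaryTrace U G x‖ₑ ^ q) := by
  have hF : Measurable (covField B U G) := measurable_covField hB.contDiff.continuous.measurable hU hG
  have hq0 : 0 < q := zero_lt_one.trans_le hq
  have hpos : 0 < ‖h‖ := norm_pos_iff.2 hh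
  set u := boundaryTrace U G with hu
  have hum : Measurable u := (stronglyMeasurable_boundaryTrace hU hG).measurable
  set ψ := ENNReal.ofReal (min 2 (12 * β * ‖h‖ ^ 2)) with hψ
  obtain ⟨Φ, hΦ⟩ : ∃ Φ : Rn d → ℝ≥0∞, ∀ x, Φ x =
      ∫⁻ τ in Ioc 0 (2 * ‖h‖), ‖covField B U G (pt x τ)‖ₑ := ⟨_, fun _ => rfl⟩
  have hΦm : Measurable Φ := by
    rw [funext hΦ]
    exact Measurable.lintegral_prod_right' (f := fun z : Rn d × ℝ => ‖covField B U G (pt z.1 z.2)‖ₑ)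
      (by fun_prop)
  obtain ⟨N, hN⟩ : ∃ N : Rn d → ℝ → ℝ≥0∞, ∀ x t, N x t =
      ∫⁻ τ in Ioc (0 : ℝ) 1, ‖covField B U G (pt (x + τ • h) t)‖ₑ ^ q := ⟨_, fun _ _ => rfl⟩
  have hNm : Measurable fun z : Rn d × ℝ => N z.1 z.2 := by
    simp only [hN]
    exact Measurable.lintegral_prod_right' (f := fun z : (Rn d × ℝ) × ℝ =>
      ‖covField B U G (pt (z.1.1 + z.2 • h) z.1.2)‖ₑ ^ q) (by fun_prop)
  have hvert := hUG.ae_enorm_cov_sub_boundaryTrace_le hU hG hB.contDiff.continuous hs hq eU eF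
  have hvert' := (measurePreserving_add_right (volume : Measure (Rn d)) h).quasiMeasurePreserving.ae hvert
  have hhor := hUG.ae_enorm_cov_sub_le hU hG hB.contDiff.continuous (v := pt h 0) (by simp)
  rw [ae_half_iff] at hhor
  -- The rectangle estimate holds for almost every height `t ∈ (|h|, 2|h|]` and is integrated over
  -- this interval. The factor `|h|` on the left is the length of the interval; it is divided out at
  -- the end.
  have hpt : ∀ᵐ x : Rn d, ENNReal.ofReal ‖h‖ * ‖covDiff (parallel B) u (x, x + h)‖ₑ ^ q ≤
      8 ^ q * (ENNReal.ofReal ‖h‖ * (Φ x ^ q + Φ (x + h) ^ q + ψ ^ q * ‖u (x + h)‖ₑ ^ q) +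
        wt q ‖h‖ * ∫⁻ t in Ioc ‖h‖ (2 * ‖h‖), N x t) := by
    filter_upwards [hvert, hvert', Measure.ae_ae_of_ae_prod hhor] with x h1 h2 h3
    have hsub : Ioc ‖h‖ (2 * ‖h‖) ⊆ Ioi (0 : ℝ) := fun t ht => hpos.trans ht.1
    have key : ∀ᵐ t ∂volume.restrict (Ioc ‖h‖ (2 * ‖h‖)),
        ‖covDiff (parallel B) u (x, x + h)‖ₑ ^ q ≤
          8 ^ q * ((Φ x ^ q + Φ (x + h) ^ q + ψ ^ q * ‖u (x + h)‖ₑ ^ q) + wt q ‖h‖ * N x t) := by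
      filter_upwards [ae_restrict_of_ae_restrict_of_subset hsub h1,
        ae_restrict_of_ae_restrict_of_subset hsub h2,
        ae_restrict_of_ae_restrict_of_subset hsub h3,
        ae_restrict_mem measurableSet_Ioc] with t j1 j2 j3 ht
      have ht0 : 0 < t := hpos.trans ht.1
      have hmono : ∀ y : Rn d, ∫⁻ τ in Ioc 0 t, ‖covField B U G (pt y τ)‖ₑ ≤ Φ y := fun y =>
        hΦ y ▸ lintegral_mono_set (Ioc_subset_Ioc_right ht.2)
      have hX : ∀ τ : ℝ, pt x t + τ • pt h 0 = pt (x + τ • h) t := fun τ => by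
        rw [← pt_smul, ← pt_add]
        simp
      have hX1 : pt x t + pt h 0 = pt (x + h) t := by simpa using hX 1
      simp only [hX, hX1] at j3
      have k := hB.enorm_cov_sub_le_rectangle x h ht0.le ht.2 (u x) (u (x + h)) (U (pt x t))
        (U (pt (x + h) t))
      rw [← covDiff_parallel] at k
      have k3 : (‖pt h 0‖ₑ * ∫⁻ τ in Ioc (0 : ℝ) 1, ‖covField B U G (pt (x + τ • h) t)‖ₑ) ^ q ≤
          wt q ‖h‖ * N x t := by
        rw [ENNReal.mul_rpow_of_nonneg _ _ hq0.le]
        have e1 : ‖pt h 0‖ₑ ^ q = wt q ‖h‖ := by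
          rw [← ofReal_norm, norm_pt_zero, ENNReal.ofReal_rpow_of_pos hpos, wt]
        rw [e1]
        gcongr
        refine (lintegral_rpow_le_measure_rpow_mul (Measurable.aemeasurable (by fun_prop)) hq).trans_eq ?_
        simp [hN]
      calc ‖covDiff (parallel B) u (x, x + h)‖ₑ ^ q
          ≤ (Φ x + Φ (x + h) + (‖pt h 0‖ₑ * ∫⁻ τ in Ioc (0 : ℝ) 1,
              ‖covField B U G (pt (x + τ • h) t)‖ₑ) + ψ * ‖u (x + h)‖ₑ) ^ q := by
            refine ENNReal.rpow_le_rpow (k.trans ?_) hq0.le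
            gcongr
            · exact j1.trans (hmono x)
            · exact j2.trans (hmono (x + h))
        _ ≤ 8 ^ q * (Φ x ^ q + Φ (x + h) ^ q + (‖pt h 0‖ₑ * ∫⁻ τ in Ioc (0 : ℝ) 1,
              ‖covField B U G (pt (x + τ • h) t)‖ₑ) ^ q + (ψ * ‖u (x + h)‖ₑ) ^ q) :=
            rpow_add_four_le hq _ _ _ _
        _ ≤ 8 ^ q * (Φ x ^ q + Φ (x + h) ^ q + wt q ‖h‖ * N x t + ψ ^ q * ‖u (x + h)‖ₑ ^ q) := by
            rw [ENNReal.mul_rpow_of_nonneg ψ _ hq0.le]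
            gcongr
        _ = _ := by ring
    have hvol : volume (Ioc ‖h‖ (2 * ‖h‖)) = ENNReal.ofReal ‖h‖ := by
      rw [Real.volume_Ioc]
      congr 1
      ring
    have hNx : Measurable (N x) := 
      hNm.comp (by fun_prop : Measurable fun t : ℝ => (x, t))
    have k := lintegral_mono_ae key
    rw [setLIntegral_const, hvol, lintegral_const_mul _ (by fun_prop),
      lintegral_add_left (by fun_prop), setLIntegral_const, hvol,
      lintegral_const_mul _ hNx] at k
    rw [mul_comm]
    refine k.trans_eq ?_
    ring
  have hint := lintegral_mono_ae hpt
  have hcm : Measurable fun x => covDiff (parallel B) u (x, x + h) :=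
    (measurable_covDiff (continuous_parallel hB.contDiff.continuous) hum).comp (by fun_prop)
  have hIm : Measurable fun x => ∫⁻ t in Ioc ‖h‖ (2 * ‖h‖), N x t :=
    Measurable.lintegral_prod_right' hNm
  have tr : ∀ f : Rn d → ℝ≥0∞, ∫⁻ x, f (x + h) = ∫⁻ x, f x := fun f =>
    lintegral_add_right_eq_self f h
  rw [lintegral_const_mul _ (by fun_prop), lintegral_const_mul _ (by fun_prop),
    lintegral_add_left (by fun_prop), lintegral_const_mul _ (by fun_prop),
    lintegral_add_left (by fun_prop), lintegral_add_left (by fun_prop),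
    lintegral_const_mul _ (by fun_prop), lintegral_const_mul _ hIm, tr (fun x => Φ x ^ q),
    tr (fun x => ‖u x‖ₑ ^ q)] at hint
  -- After integration in `x`, the shift by `τ h` along the horizontal side disappears by
  -- translation invariance.
  have hNint : ∫⁻ x, ∫⁻ t in Ioc ‖h‖ (2 * ‖h‖), N x t =
      ∫⁻ t in Ioc ‖h‖ (2 * ‖h‖), ∫⁻ x : Rn d, ‖covField B U G (pt x t)‖ₑ ^ q := by
    rw [lintegral_lintegral_swap (Measurable.aemeasurable hNm)]
    refine lintegral_congr fun t => ?_
    simp only [hN]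
    rw [lintegral_lintegral_swap (Measurable.aemeasurable (by fun_prop))]
    have : ∀ τ : ℝ, ∫⁻ x, ‖covField B U G (pt (x + τ • h) t)‖ₑ ^ q =
        ∫⁻ x, ‖covField B U G (pt x t)‖ₑ ^ q := fun τ =>
      lintegral_add_right_eq_self (fun x => ‖covField B U G (pt x t)‖ₑ ^ q) (τ • h)
    simp [this]
  have hΦint : ∫⁻ x, Φ x ^ q ≤ ENNReal.ofReal (1 / s) ^ (q - 1) * wt (s * (q - 1)) (2 * ‖h‖) *
      ∫⁻ t in Ioc 0 (2 * ‖h‖), wt ((1 - s) * (q - 1)) t *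
        ∫⁻ x : Rn d, ‖covField B U G (pt x t)‖ₑ ^ q := by
    have k := lintegral_mono (μ := (volume : Measure (Rn d))) fun x : Rn d => rpow_setLIntegral_le_wt
      (f := fun t => ‖covField B U G (pt x t)‖ₑ) (by fun_prop) hs hq
      (by positivity : 0 < 2 * ‖h‖)
    simp only [← hΦ] at k
    refine k.trans_eq ?_
    have hm2 : Measurable fun x : Rn d => ∫⁻ t in Ioc 0 (2 * ‖h‖), wt ((1 - s) * (q - 1)) t *
        ‖covField B U G (pt x t)‖ₑ ^ q :=
      Measurable.lintegral_prod_right' (f := fun z : Rn d × ℝ => wt ((1 - s) * (q - 1)) z.2 *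
        ‖covField B U G (pt z.1 z.2)‖ₑ ^ q) (by fun_prop)
    rw [lintegral_const_mul _ hm2, lintegral_lintegral_swap (Measurable.aemeasurable (by fun_prop))]
    congr 1
    refine lintegral_congr fun t => ?_
    rw [lintegral_const_mul' _ _ (wt_ne_top _ _)]
  rw [hNint] at hint
  have hone : wt (-1) ‖h‖ * ENNReal.ofReal ‖h‖ = 1 := by
    rw [← wt_one, wt_mul_wt _ _ hpos, neg_add_cancel, wt_zero]
  have hwq : wt (-1) ‖h‖ * wt q ‖h‖ = wt (q - 1) ‖h‖ := by
    rw [wt_mul_wt _ _ hpos]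
    congr 1
    ring
  calc ∫⁻ x, ‖covDiff (parallel B) u (x, x + h)‖ₑ ^ q
      = wt (-1) ‖h‖ * (ENNReal.ofReal ‖h‖ * ∫⁻ x, ‖covDiff (parallel B) u (x, x + h)‖ₑ ^ q) := by
        rw [← mul_assoc, hone, one_mul]
    _ ≤ wt (-1) ‖h‖ * _ := mul_le_mul' le_rfl hint
    _ = 8 ^ q * ((wt (-1) ‖h‖ * ENNReal.ofReal ‖h‖) *
          ((∫⁻ x, Φ x ^ q) + (∫⁻ x, Φ x ^ q) + ψ ^ q * ∫⁻ x, ‖u x‖ₑ ^ q) +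
          (wt (-1) ‖h‖ * wt q ‖h‖) * ∫⁻ t in Ioc ‖h‖ (2 * ‖h‖),
            ∫⁻ x : Rn d, ‖covField B U G (pt x t)‖ₑ ^ q) := by ring
    _ = 8 ^ q * (2 * (∫⁻ x, Φ x ^ q) + wt (q - 1) ‖h‖ * (∫⁻ t in Ioc ‖h‖ (2 * ‖h‖),
          ∫⁻ x : Rn d, ‖covField B U G (pt x t)‖ₑ ^ q) + ψ ^ q * ∫⁻ x, ‖u x‖ₑ ^ q) := by
        rw [hone, hwq]
        ring
    _ ≤ _ := by gcongr

theorem div_enorm_rpow_eq {n : ℕ} {h : Rn n} (hh : h ≠ 0) {a : ℝ} (c : ℝ≥0∞) :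
    c / ‖h‖ₑ ^ a = wt (-a) ‖h‖ * c := by
  have hpos : 0 < ‖h‖ := norm_pos_iff.2 hh
  rw [div_eq_mul_inv, mul_comm, ← ENNReal.rpow_neg, ← ofReal_norm, ENNReal.ofReal_rpow_of_pos hpos, wt]

/-- The Gagliardo estimate of the boundary trace. -/
theorem HasWeakGradient.lintegral_covDiff_div_le (hUG : HasWeakGradient U G)
    (hU : Measurable U) (hG : Measurable G) (hB : CurlBound B β) (hs : 0 < s) (hs1 : s < 1)
    (hq : 1 ≤ q)
    (eU : energy ((1 - s) * q - 1) q (fun X => ‖U X‖ₑ) < ⊤)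
    (eF : energy ((1 - s) * q - 1) q (fun X => ‖covField B U G X‖ₑ) < ⊤) :
    ∫⁻ z : Rn d × Rn d, ‖covDiff (parallel B) (boundaryTrace U G) z‖ₑ ^ q /
        ‖z.2 - z.1‖ₑ ^ (d + s * q) ≤
      8 ^ q * ((2 * (ENNReal.ofReal (1 / s) ^ (q - 1) * wt (s * (q - 1)) 2) + 1) * tailConst d s *
          energy ((1 - s) * q - 1) q (fun X => ‖covField B U G X‖ₑ) +
        phaseConst d s q * ENNReal.ofReal β ^ (s * q / 2) *
          ∫⁻ x, ‖boundaryTrace U G x‖ₑ ^ q) := by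
  have hF : Measurable (covField B U G) := measurable_covField hB.contDiff.continuous.measurable hU hG
  have hq0 : 0 < q := zero_lt_one.trans_le hq
  set u := boundaryTrace U G with hu
  have hum : Measurable u := (stronglyMeasurable_boundaryTrace hU hG).measurable
  have hcm := measurable_covDiff (continuous_parallel hB.contDiff.continuous) hum
  set g : ℝ → ℝ≥0∞ := fun t => ∫⁻ x : Rn d, ‖covField B U G (pt x t)‖ₑ ^ q with hg
  have hgm : Measurable g :=
    Measurable.lintegral_prod_left' (f := fun z : Rn d × ℝ => ‖covField B U G (pt z.1 z.2)‖ₑ ^ q)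
      (by fun_prop)
  set cs := ENNReal.ofReal (1 / s) ^ (q - 1) with hcs
  -- These are `|h|^{-(d+sq)}` multiplied by the powers of `|h|` from the fixed increment estimate,
  -- `|h|^{s(q-1)}` for the vertical sides and `|h|^{q-1}` for the horizontal one.
  set w1 : Rn d → ℝ≥0∞ := fun h => wt (-(d + s)) ‖h‖ with hw1
  set w2 : Rn d → ℝ≥0∞ := fun h => wt ((1 - s) * q - 1 - d) ‖h‖ with hw2
  set S1 : Set (Rn d × ℝ) := {z | 0 < z.2 ∧ z.2 ≤ 2 * ‖z.1‖} with hS1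
  set S2 : Set (Rn d × ℝ) := {z | ‖z.1‖ < z.2 ∧ z.2 ≤ 2 * ‖z.1‖} with hS2
  have hS1m : MeasurableSet S1 := (measurableSet_lt measurable_const measurable_snd).inter
    (measurableSet_le measurable_snd (by fun_prop))
  have hS2m : MeasurableSet S2 := (measurableSet_lt (by fun_prop) measurable_snd).inter
    (measurableSet_le measurable_snd (by fun_prop))
  set E := energy ((1 - s) * q - 1) q (fun X => ‖covField B U G X‖ₑ) with hE
  have hE' : E = ∫⁻ t in Ioi (0 : ℝ), wt ((1 - s) * q - 1) t * g t := energy_eq_symm _ _ hF.enorm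
  -- With `t` outermost, the inner integral is the tail over `|h| ≥ t/2`, a multiple of `t^{-s}`,
  -- and `(1 - s)(q - 1) - s` is exactly the exponent of the energy.
  have I1 : ∫⁻ h, w1 h * ∫⁻ t in Ioc 0 (2 * ‖h‖), wt ((1 - s) * (q - 1)) t * g t =
      tailConst d s * E := by
    have k := lintegral_lintegral_indicator_swap (μ := (volume : Measure (Rn d))) (w := w1)
      (by fun_prop) (g := fun t => wt ((1 - s) * (q - 1)) t * g t) (by fun_prop) hS1m
      (fun z hz => hz.1)
    refine k.trans ?_
    rw [hE', ← lintegral_const_mul _ (by fun_prop)]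
    refine setLIntegral_congr_fun measurableSet_Ioi fun t ht => ?_
    have ht : 0 < t := ht
    have e : ∀ h : Rn d, {h | (h, t) ∈ S1}.indicator w1 h =
        {h : Rn d | t ≤ 2 * ‖h‖}.indicator (fun h => wt (-(d + s)) ‖h‖) h := by
      intro h
      simp only [indicator_apply, hS1, mem_ofPred_eq, ht, true_and, hw1]
    simp only [e]
    rw [lintegral_tail s ht]
    have : (1 - s) * q - 1 = (1 - s) * (q - 1) + -s := by ring
    rw [this, ← wt_mul_wt _ _ ht]
    ring
  have I2 : ∫⁻ h, w2 h * ∫⁻ t in Ioc ‖h‖ (2 * ‖h‖), g t ≤ tailConst d s * E := by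
    have k := lintegral_lintegral_indicator_swap (μ := (volume : Measure (Rn d))) (w := w2)
      (by fun_prop) hgm hS2m (fun z hz => (norm_nonneg _).trans_lt hz.1)
    refine (le_of_eq k).trans ?_
    rw [hE', ← lintegral_const_mul _ (by fun_prop)]
    refine setLIntegral_mono' measurableSet_Ioi fun t ht => ?_
    have ht : 0 < t := ht
    -- On this region `|h| < t`, so the surplus power `|h|^{(1-s)(q-1)}` is at most the same power
    -- of `t`, and the tail integral of the vertical term can be used again.
    have e : ∀ h : Rn d, {h | (h, t) ∈ S2}.indicator w2 h ≤ wt ((1 - s) * (q - 1)) t *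
        {h : Rn d | t ≤ 2 * ‖h‖}.indicator (fun h => wt (-(d + s)) ‖h‖) h := by
      intro h
      by_cases hh : (h, t) ∈ S2
      · have h1 : ‖h‖ < t := hh.1
        have h2 : t ≤ 2 * ‖h‖ := hh.2
        have hpos : 0 < ‖h‖ := by linarith
        rw [indicator_of_mem (show h ∈ {h | (h, t) ∈ S2} from hh),
          indicator_of_mem (show h ∈ {h : Rn d | t ≤ 2 * ‖h‖} from h2)]
        have : (1 - s) * q - 1 - d = (1 - s) * (q - 1) + -(d + s) := by ring
        simp only [hw2]
        rw [this, ← wt_mul_wt _ _ hpos]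
        gcongr
        exact wt_mono (mul_nonneg (by linarith) (by linarith)) hpos.le h1.le
      · rw [indicator_of_notMem (show h ∉ {h | (h, t) ∈ S2} from hh)]
        exact zero_le
    refine (mul_le_mul' le_rfl (lintegral_mono e)).trans_eq ?_
    rw [lintegral_const_mul' _ _ (wt_ne_top _ _), lintegral_tail s ht]
    have : (1 - s) * q - 1 = (1 - s) * (q - 1) + -s := by ring
    rw [this, ← wt_mul_wt _ _ ht]
    ring
  have I3 := lintegral_phase (d := d) hs hq0 hB.nonneg
  set L := ∫⁻ x, ‖u x‖ₑ ^ q with hL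
  rw [lintegral_prod_translate (by fun_prop)]
  have hbound : ∀ h : Rn d, ∫⁻ x, ‖covDiff (parallel B) u (x, x + h)‖ₑ ^ q / ‖x + h - x‖ₑ ^ (d + s * q) ≤
      8 ^ q * ((2 * (cs * wt (s * (q - 1)) 2) * (w1 h * ∫⁻ t in Ioc 0 (2 * ‖h‖),
          wt ((1 - s) * (q - 1)) t * g t) + w2 h * ∫⁻ t in Ioc ‖h‖ (2 * ‖h‖), g t) +
        wt (-(d + s * q)) ‖h‖ * ENNReal.ofReal (min 2 (12 * β * ‖h‖ ^ 2)) ^ q * L) := by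
    intro h
    rcases eq_or_ne h 0 with rfl | hh
    -- On the diagonal the covariant difference vanishes, so the singular denominator plays no role.
    · refine le_trans (le_of_eq ?_) zero_le
      have : ∀ x, covDiff (parallel B) u (x, x) = 0 := fun x => by simp [covDiff, intPot_self]
      simp [this, hq0]
    have hpos : 0 < ‖h‖ := norm_pos_iff.2 hh
    simp only [add_sub_cancel_left, div_enorm_rpow_eq hh]
    rw [lintegral_const_mul' _ _ (wt_ne_top _ _)]
    refine (mul_le_mul' le_rfl
      (hUG.lintegral_covDiff_boundaryTrace_le hU hG hB hs hq eU eF hh)).trans_eq ?_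
    have k1 : w1 h = wt (-(d + s * q)) ‖h‖ * wt (s * (q - 1)) ‖h‖ := by
      simp only [hw1]
      rw [wt_mul_wt _ _ hpos]
      congr 1
      ring
    have k2 : w2 h = wt (-(d + s * q)) ‖h‖ * wt (q - 1) ‖h‖ := by
      simp only [hw2]
      rw [wt_mul_wt _ _ hpos]
      congr 1
      ring
    rw [k1, k2, wt_mul_left _ zero_le_two hpos.le]
    ring
  have m1 : Measurable fun h : Rn d => ∫⁻ t in Ioc 0 (2 * ‖h‖), wt ((1 - s) * (q - 1)) t * g t := by
    have : Measurable fun z : Rn d × ℝ => S1.indicator (fun z => wt ((1 - s) * (q - 1)) z.2 * g z.2) z :=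
      Measurable.indicator (by fun_prop) hS1m
    have k := this.lintegral_prod_right' (ν := (volume : Measure ℝ))
    convert k using 1
    funext h
    rw [← lintegral_indicator measurableSet_Ioc]
    rfl
  refine (lintegral_mono hbound).trans ?_
  rw [lintegral_const_mul' _ _ (by simp), lintegral_add_right _ (by fun_prop),
    lintegral_add_left (by fun_prop), lintegral_const_mul _ (by fun_prop), I1,
    lintegral_mul_const _ (by fun_prop), I3]
  refine mul_le_mul' le_rfl (add_le_add ?_ le_rfl)
  calc _ ≤ 2 * (cs * wt (s * (q - 1)) 2) * (tailConst d s * E) + tailConst d s * E := by gcongr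
    _ = _ := by ring

end

/-! ### Extension of `C¹` maps across the boundary -/

section Reflection

variable {d : ℕ} {F : Type*} [NormedAddCommGroup F] [NormedSpace ℝ F]

/-- The projection `(x, t) ↦ (x, 0)` to the boundary. -/
def toBdry (d : ℕ) : Rn (d + 1) →L[ℝ] Rn (d + 1) :=
  (ptEquiv d : (Rn d × ℝ) →L[ℝ] Rn (d + 1)).comp ((hor d).prod 0)

/-- The reflection `(x, t) ↦ (x, -t)`. -/
def reflect (d : ℕ) : Rn (d + 1) →L[ℝ] Rn (d + 1) :=
  (2 : ℝ) • toBdry d - ContinuousLinearMap.id ℝ _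

theorem toBdry_last (X : Rn (d + 1)) : toBdry d X (Fin.last d) = 0 := by simp [toBdry]

theorem reflect_last (X : Rn (d + 1)) : reflect d X (Fin.last d) = -X (Fin.last d) := by
  simp [reflect, toBdry_last]

theorem toBdry_of_last_eq_zero {X : Rn (d + 1)} (h : X (Fin.last d) = 0) : toBdry d X = X := by
  conv_rhs => rw [← pt_hor X, h]
  simp [toBdry]

theorem reflect_of_last_eq_zero {X : Rn (d + 1)} (h : X (Fin.last d) = 0) : reflect d X = X := by
  simp [reflect, toBdry_of_last_eq_zero h, two_smul]

theorem uniqueDiffOn_closedHalfSpace (d : ℕ) : UniqueDiffOn ℝ (closedHalfSpace d) := by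
  refine uniqueDiffOn_convex (convex_closedHalfSpace d) ⟨pt 0 1, ?_⟩
  exact interior_maximal (halfSpace_subset_closedHalfSpace d) (isOpen_halfSpace d)
    (pt_mem_halfSpace.2 one_pos)

/-- A map that is `C¹` up to the boundary of the half-space extends to a `C¹` map. -/
theorem exists_contDiff_eqOn_closedHalfSpace {f : Rn (d + 1) → F}
    (hf : ContDiffOn ℝ 1 f (closedHalfSpace d)) :
    ∃ g : Rn (d + 1) → F, ContDiff ℝ 1 g ∧ EqOn g f (closedHalfSpace d) := by
  classical
  set S := closedHalfSpace d with hS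
  set f' := fderivWithin ℝ f S with hf'
  have hc' : ContinuousOn f' S :=
    hf.continuousOn_fderivWithin (uniqueDiffOn_closedHalfSpace d) le_rfl
  have hd : ∀ X ∈ S, HasFDerivWithinAt f (f' X) S X := fun X hX =>
    (hf.differentiableOn one_ne_zero X hX).hasFDerivWithinAt
  set N : Set (Rn (d + 1)) := {X | X (Fin.last d) ≤ 0} with hN
  have hNc : IsClosed N := isClosed_le (by fun_prop) continuous_const
  have mP : MapsTo (toBdry d) N S := fun X _ => (toBdry_last X).ge
  have mR : MapsTo (reflect d) N S := fun X (hX : X (Fin.last d) ≤ 0) => by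
    change 0 ≤ reflect d X (Fin.last d)
    rw [reflect_last]
    linarith
  set g : Rn (d + 1) → F := fun X =>
    if 0 ≤ X (Fin.last d) then f X else (2 : ℝ) • f (toBdry d X) - f (reflect d X) with hg
  set g' : Rn (d + 1) → Rn (d + 1) →L[ℝ] F := fun X =>
    if 0 ≤ X (Fin.last d) then f' X else
      (2 : ℝ) • (f' (toBdry d X)).comp (toBdry d) - (f' (reflect d X)).comp (reflect d) with hg'
  have gS : ∀ X ∈ S, g X = f X := fun X hX => if_pos hX
  have gN : ∀ X ∈ N, g X = (2 : ℝ) • f (toBdry d X) - f (reflect d X) := by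
    intro X hX
    by_cases h0 : 0 ≤ X (Fin.last d)
    · have h1 : X (Fin.last d) = 0 := le_antisymm hX h0
      rw [gS X h0, toBdry_of_last_eq_zero h1, reflect_of_last_eq_zero h1, two_smul, add_sub_cancel_right]
    · exact if_neg h0
  -- The two formulas for the derivative match at the boundary because twice the projection minus
  -- the reflection is the identity.
  have key : ∀ X : Rn (d + 1), X (Fin.last d) = 0 → f' X =
      (2 : ℝ) • (f' (toBdry d X)).comp (toBdry d) - (f' (reflect d X)).comp (reflect d) := by
    intro X hX
    rw [toBdry_of_last_eq_zero hX, reflect_of_last_eq_zero hX]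
    ext v
    simp [reflect]
  have gS' : ∀ X ∈ S, g' X = f' X := fun X hX => if_pos hX
  have gN' : ∀ X ∈ N, g' X =
      (2 : ℝ) • (f' (toBdry d X)).comp (toBdry d) - (f' (reflect d X)).comp (reflect d) := by
    intro X hX
    by_cases h0 : 0 ≤ X (Fin.last d)
    · rw [gS' X h0, key X (le_antisymm hX h0)]
    · exact if_neg h0
  refine ⟨g, contDiff_one_iff_hasFDerivAt.2 ⟨g', ?_, fun X => ?_⟩, gS⟩
  · refine continuous_if_le continuous_const (by fun_prop) hc' ?_ fun X hX => key X hX.symm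
    have c1 : ContinuousOn (fun X => f' (toBdry d X)) N :=
      hc'.comp (toBdry d).continuous.continuousOn mP
    have c2 : ContinuousOn (fun X => f' (reflect d X)) N :=
      hc'.comp (reflect d).continuous.continuousOn mR
    exact ((c1.clm_comp continuousOn_const).const_smul (2 : ℝ)).sub (c2.clm_comp continuousOn_const)
  · have h1 : HasFDerivWithinAt g (g' X) S X := by
      by_cases hX : X ∈ S
      · rw [gS' X hX]
        exact (hd X hX).congr gS (gS X hX)
      · exact .of_notMem_closure (by rwa [(isClosed_closedHalfSpace d).closure_eq])
    have h2 : HasFDerivWithinAt g (g' X) N X := by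
      by_cases hX : X ∈ N
      · rw [gN' X hX]
        refine HasFDerivWithinAt.congr ?_ gN (gN X hX)
        exact (((hd _ (mP hX)).comp X (toBdry d).hasFDerivWithinAt mP).const_smul (2 : ℝ)).sub
          ((hd _ (mR hX)).comp X (reflect d).hasFDerivWithinAt mR)
      · exact .of_notMem_closure (by rwa [hNc.closure_eq])
    have h3 := h1.union h2
    have e : S ∪ N = univ := eq_univ_of_forall fun X => le_total 0 (X (Fin.last d))
    rwa [e, hasFDerivWithinAt_univ] at h3

end Reflection

/-! ### Pointwise bound of the magnetic field -/

/-- In the alternating sum of the exterior derivative, omitting each of the two slots gives one term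
of the antisymmetrized derivative. -/
theorem magneticField_apply {n : ℕ} {B : Rn n → Rn n} {X : Rn n} (hB : DifferentiableAt ℝ B X)
    (v w : Rn n) : magneticField B X ![v, w] = curl B X v w := by
  have h1 : DifferentiableAt ℝ (oneForm B) X :=
    (ContinuousAlternatingMap.ofSubsingletonLIE (𝕜 := ℝ) (E := Rn n) (F := ℝ)
      (0 : Fin 1)).toContinuousLinearEquiv.differentiableAt.comp X
      ((innerSL ℝ).differentiableAt.comp X hB)
  have h2 : ∀ z y : Rn n, fderiv ℝ (fun Y => inner ℝ (B Y) z) X y = inner ℝ (fderiv ℝ B X y) z := by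
    intro z y
    rw [fderiv_inner_apply ℝ hB (differentiableAt_const z)]
    simp
  have h3 : ∀ z : Rn n, (fun Y => oneForm B Y ![z]) = fun Y => inner ℝ (B Y) z := fun z => by
    funext Y
    simp [oneForm]
  have e0 : (0 : Fin 2).removeNth ![v, w] = ![w] := by
    ext i
    fin_cases i
    rfl
  have e1 : (1 : Fin 2).removeNth ![v, w] = ![v] := by
    ext i
    fin_cases i
    rfl
  rw [magneticField, extDeriv_apply h1, Fin.sum_univ_two, e0, e1, h3, h3, h2, h2]
  simp [curl, sub_eq_add_neg]

theorem continuous_curl {n : ℕ} {B : Rn n → Rn n} (hB : ContDiff ℝ 1 B) (v w : Rn n) :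
    Continuous fun X => curl B X v w := by
  have h := hB.continuous_fderiv one_ne_zero
  unfold curl
  exact ((h.clm_apply continuous_const).inner continuous_const).sub
    ((h.clm_apply continuous_const).inner continuous_const)

theorem closedHalfSpace_subset_closure (d : ℕ) : closedHalfSpace d ⊆ closure (halfSpace d) := by
  intro X hX
  have h : Filter.Tendsto (fun ε : ℝ => X + pt 0 ε) (nhdsWithin 0 (Ioi 0)) (nhds X) := by
    have : Continuous fun ε : ℝ => X + pt (0 : Rn d) ε := by fun_prop
    have h0 : X + pt 0 0 = X := by
      have := pt_hor X
      rw [← this, ← pt_add, add_zero, add_zero]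
    simpa only [h0] using (this.tendsto 0).mono_left nhdsWithin_le_nhds
  refine mem_closure_of_tendsto h ?_
  filter_upwards [self_mem_nhdsWithin] with ε hε
  have h1 : 0 ≤ X (Fin.last d) := hX
  have h2 : 0 < ε := hε
  change 0 < (X + pt (0 : Rn d) ε) (Fin.last d)
  simp only [PiLp.add_apply, pt_last]
  positivity

/-- An essential bound of `dA` bounds the exterior derivative of any `C¹` extension of `A`. -/
theorem CurlBound.of_eLpNorm_le {d : ℕ} {A B : Rn (d + 1) → Rn (d + 1)} {β : ℝ≥0}
    (hB : ContDiff ℝ 1 B) (hAB : EqOn B A (closedHalfSpace d))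
    (hA : eLpNorm (magneticField A) ⊤ (halfMeasure d) ≤ β) : CurlBound B β := by
  refine ⟨hB, β.2, ?_⟩
  set S : Set (Rn (d + 1)) := {X | ∀ v w, |curl B X v w| ≤ β * ‖v‖ * ‖w‖} with hS
  have hSc : IsClosed S := by
    have : S = ⋂ v, ⋂ w, {X | |curl B X v w| ≤ β * ‖v‖ * ‖w‖} := by
      ext X
      simp [hS]
    rw [this]
    exact isClosed_iInter fun v => isClosed_iInter fun w =>
      isClosed_le (continuous_curl hB v w).abs continuous_const
  have hae : ∀ᵐ X ∂halfMeasure d, X ∈ S := by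
    rw [eLpNorm_exponent_top] at hA
    filter_upwards [ae_le_eLpNormEssSup (f := magneticField A) (μ := halfMeasure d),
      ae_restrict_mem (measurableSet_halfSpace d)] with X hX hXm v w
    -- At an interior point `A` and its extension have the same germ, hence the same exterior
    -- derivative.
    have e : oneForm A =ᶠ[nhds X] oneForm B := by
      filter_upwards [(isOpen_halfSpace d).mem_nhds hXm] with Y hY
      rw [oneForm, oneForm, hAB (halfSpace_subset_closedHalfSpace d hY)]
    have e1 : magneticField A X = magneticField B X := e.extDeriv_eq
    rw [← magneticField_apply (hB.differentiable one_ne_zero X), ← e1, ← Real.norm_eq_abs]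
    have h1 := (magneticField A X).le_opNorm ![v, w]
    have h2 : ‖magneticField A X‖ ≤ β := by
      have := hX.trans hA
      rwa [enorm_le_coe] at this
    refine h1.trans ?_
    rw [Fin.prod_univ_two, mul_assoc]
    exact mul_le_mul_of_nonneg_right h2 (by positivity)
  have hHS : halfSpace d ⊆ S := by
    rw [ae_iff, Measure.restrict_apply' (measurableSet_halfSpace d)] at hae
    -- The exceptional set in the open half-space is open and null, hence empty; continuity then
    -- carries the bound to the boundary.
    have h0 := ((hSc.isOpen_compl.inter (isOpen_halfSpace d)).measure_eq_zero_iff _).1 hae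
    intro X hX
    by_contra h
    exact (h0 ▸ (⟨h, hX⟩ : X ∈ Sᶜ ∩ halfSpace d) : X ∈ (∅ : Set _))
  exact fun X hX => closure_minimal hHS hSc (closedHalfSpace_subset_closure d hX)

theorem CurlBound.mono {d : ℕ} {B : Rn (d + 1) → Rn (d + 1)} {β β' : ℝ} (h : CurlBound B β)
    (hβ : β ≤ β') : CurlBound B β' :=
  ⟨h.contDiff, h.nonneg.trans hβ, fun X hX v w => (h.bound X hX v w).trans (by gcongr)⟩

theorem parallel_congr {d : ℕ} {A B : Rn (d + 1) → Rn (d + 1)} (h : EqOn B A (closedHalfSpace d)) :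
    parallel B = parallel A := by
  funext x
  have e : B (bdry x) = A (bdry x) := h (pt_mem_closedHalfSpace.2 le_rfl)
  rw [parallel, parallel, e]

/-! ### Classical gradients are weak gradients -/

/-- The vector of partial derivatives of a real-linear form. -/
def gradVec {n : ℕ} (L : Rn n →L[ℝ] ℂ) : Cn n :=
  WithLp.toLp 2 fun j => L (EuclideanSpace.single j 1)

theorem gradVec_apply {n : ℕ} (L : Rn n →L[ℝ] ℂ) (j : Fin n) :
    gradVec L j = L (EuclideanSpace.single j 1) := rfl

theorem dotC_gradVec {n : ℕ} (v : Rn n) (L : Rn n →L[ℝ] ℂ) : dotC v (gradVec L) = L v := by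
  have h : v = ∑ j, v j • EuclideanSpace.single j (1 : ℝ) := by
    ext i
    simp [Finset.sum_apply, Pi.single_apply]
  conv_rhs => rw [h, map_sum]
  rw [dotC_apply]
  refine Finset.sum_congr rfl fun j _ => ?_
  rw [map_smul, gradVec_apply, Complex.real_smul]

theorem continuous_gradVec {n : ℕ} : Continuous (gradVec (n := n)) := by
  unfold gradVec
  exact (PiLp.continuous_toLp 2 _).comp
    (continuous_pi fun j => continuous_id.clm_apply continuous_const)

section Classical

variable {d : ℕ}

/-- Nothing is assumed at the boundary: test functions have compact support in the open half-space,
which makes every product in the integration by parts integrable. -/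
theorem HasWeakGradient.of_hasFDerivAt {U : Rn (d + 1) → ℂ} {U' : Rn (d + 1) → Rn (d + 1) →L[ℝ] ℂ}
    (hd : ∀ X ∈ halfSpace d, HasFDerivAt U (U' X) X) (hc : ContinuousOn U' (halfSpace d)) :
    HasWeakGradient U fun X => gradVec (U' X) where
  locInt := ContinuousOn.locallyIntegrableOn
    (fun X hX => (hd X hX).continuousAt.continuousWithinAt) (measurableSet_halfSpace d)
  locInt_grad := (continuous_gradVec.comp_continuousOn hc).locallyIntegrableOn
    (measurableSet_halfSpace d)
  integral_eq φ hφ hcs hs j := by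
    set e : Rn (d + 1) := EuclideanSpace.single j 1
    have hU : LocallyIntegrableOn U (halfSpace d) := ContinuousOn.locallyIntegrableOn
      (fun X hX => (hd X hX).continuousAt.continuousWithinAt) (measurableSet_halfSpace d)
    have hU' : LocallyIntegrableOn (fun X => U' X e) (halfSpace d) :=
      (hc.clm_apply continuousOn_const).locallyIntegrableOn (measurableSet_halfSpace d)
    have hsub : tsupport (fun X => fderiv ℝ φ X e) ⊆ tsupport φ :=
      tsupport_fderiv_apply_subset ℝ e
    have hφ' : Continuous fun X => fderiv ℝ φ X e :=
      (hφ.continuous_fderiv (by simp)).clm_apply continuous_const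
    have h := integral_bilinear_hasFDerivAt_right_eq_neg_left_of_integrable (μ := volume)
      (f := φ) (f' := fderiv ℝ φ) (g := U) (g' := U') (v := e) (B := ContinuousLinearMap.lsmul ℝ ℝ)
      (integrable_smul_of_tsupport hU hφ' (hcs.fderiv_apply ℝ e) (hsub.trans hs))
      (integrable_smul_of_tsupport hU' hφ.continuous hcs hs)
      (integrable_smul_of_tsupport hU hφ.continuous hcs hs)
      (fun X _ => (hφ.differentiable (by simp) X).hasFDerivAt) fun X hX => hd X (hs hX)
    simp only [ContinuousLinearMap.lsmul_apply] at h
    have z : ∀ X ∉ halfSpace d, φ X = 0 := fun X hX => by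
      by_contra hne
      exact hX (hs (subset_tsupport _ hne))
    have z' : ∀ X ∉ halfSpace d, fderiv ℝ φ X e = 0 := fun X hX => by
      by_contra hne
      exact hX (hs (hsub (subset_tsupport _ hne)))
    rw [setIntegral_eq_integral_of_forall_compl_eq_zero fun X hX => by rw [z' X hX, zero_smul],
      setIntegral_eq_integral_of_forall_compl_eq_zero fun X hX => by rw [z X hX, zero_smul]]
    simp only [gradVec_apply]
    exact (neg_eq_iff_eq_neg.2 h).symm

/-- Continuous fields that vanish off a compact set have finite weighted energy. -/
theorem energy_lt_top_of_isCompact {E : Type*} [NormedAddCommGroup E] {f : Rn (d + 1) → E}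
    (hf : Continuous f) {K : Set (Rn (d + 1))} (hK : IsCompact K)
    (h0 : ∀ X ∈ halfSpace d, X ∉ K → f X = 0) {γ q : ℝ} (hγ : -1 < γ) (hq : 0 < q) :
    energy γ q (fun X => ‖f X‖ₑ) < ⊤ := by
  obtain ⟨M, hM⟩ := hK.exists_bound_of_continuousOn hf.continuousOn
  obtain ⟨R, hR⟩ := hK.isBounded.subset_closedBall 0
  set R' := max R 0
  set S : Set (Rn d × ℝ) := Metric.closedBall 0 R' ×ˢ Ioc 0 R'
  have hS : ∀ X ∈ halfSpace d, f X ≠ 0 → (hor d X, X (Fin.last d)) ∈ S := by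
    intro X hX hne
    have hXK : X ∈ K := by
      by_contra h
      exact hne (h0 X hX h)
    have h1 : ‖X‖ ≤ R := by simpa using hR hXK
    refine ⟨mem_closedBall_zero_iff.2 (((norm_hor_le X).trans h1).trans (le_max_left _ _)), hX, ?_⟩
    exact ((le_abs_self _).trans ((abs_last_le X).trans h1)).trans (le_max_left _ _)
  -- The field is bounded and lives over a ball times `(0, R']`, so the energy is dominated by a
  -- product integral, finite because `γ > -1`.
  calc energy γ q (fun X => ‖f X‖ₑ)
      ≤ ∫⁻ z, (Metric.closedBall (0 : Rn d) R').indicator 1 z.1 *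
          ((Ioc 0 R').indicator (wt γ) z.2 * ENNReal.ofReal M ^ q)
          ∂(volume : Measure (Rn d)).prod halfLine := by
        rw [energy, lintegral_half_prod]
        refine lintegral_mono_ae ?_
        have : ∀ᵐ z : Rn d × ℝ ∂(volume : Measure (Rn d)).prod halfLine, z.2 ∈ Ioi (0 : ℝ) :=
          Measure.quasiMeasurePreserving_snd.ae (ae_restrict_mem measurableSet_Ioi)
        filter_upwards [this] with z hz
        have hz' : pt z.1 z.2 ∈ halfSpace d := pt_mem_halfSpace.2 hz
        by_cases hne : f (pt z.1 z.2) = 0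
        · simp [hne, ENNReal.zero_rpow_of_pos hq]
        · have h1 := hS _ hz' hne
          simp only [hor_pt, pt_last] at h1
          rw [indicator_of_mem h1.1, indicator_of_mem h1.2, Pi.one_apply, one_mul, pt_last]
          refine mul_le_mul' le_rfl (ENNReal.rpow_le_rpow ?_ hq.le)
          rw [← ofReal_norm]
          refine ENNReal.ofReal_le_ofReal (hM _ ?_)
          by_contra h
          exact hne (h0 _ hz' h)
    _ = volume (Metric.closedBall (0 : Rn d) R') *
          ((∫⁻ t in Ioc 0 R', wt γ t) * ENNReal.ofReal M ^ q) := by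
        rw [lintegral_prod_mul (f := (Metric.closedBall (0 : Rn d) R').indicator 1)
          (g := fun t => (Ioc 0 R').indicator (wt γ) t * ENNReal.ofReal M ^ q)
          (aemeasurable_const.indicator Metric.isClosed_closedBall.measurableSet)
          (((measurable_wt γ).indicator measurableSet_Ioc).mul_const _).aemeasurable,
          lintegral_indicator_one Metric.isClosed_closedBall.measurableSet,
          lintegral_mul_const _ ((measurable_wt γ).indicator measurableSet_Ioc),
          lintegral_indicator measurableSet_Ioc, Measure.restrict_restrict measurableSet_Ioc,
          inter_eq_left.2 Ioc_subset_Ioi_self]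
    _ < ⊤ := by
        have : ∫⁻ t in Ioc 0 R', wt γ t < ⊤ := by
          simp only [wt]
          rw [setLIntegral_rpow_Ioc hγ (le_max_right _ _)]
          exact ENNReal.ofReal_lt_top
        have h2 : ENNReal.ofReal M ^ q < ⊤ := ENNReal.rpow_lt_top_of_nonneg hq.le ENNReal.ofReal_ne_top
        exact ENNReal.mul_lt_top measure_closedBall_lt_top (ENNReal.mul_lt_top this h2)

/-! ### Limits at the boundary -/

/-- Convergence `t → 0+` off null sets. -/
def aeRight : Filter ℝ := nhdsWithin 0 (Ioi 0) ⊓ ae halfLine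

/-- A right neighbourhood of `0` has positive measure and therefore meets every conull set.
Consequently limits along this filter are unique. -/
instance : aeRight.NeBot := by
  refine Filter.inf_neBot_iff.2 fun {s} hs {t} ht => ?_
  obtain ⟨ε, hε, h⟩ := mem_nhdsGT_iff_exists_Ioo_subset.1 hs
  by_contra hne
  rw [not_nonempty_iff_eq_empty] at hne
  have h1 : Ioo 0 ε ⊆ tᶜ := fun x hx hxt => by
    have : x ∈ s ∩ t := ⟨h hx, hxt⟩
    rw [hne] at this
    exact this
  have h2 : halfLine (Ioo 0 ε) = 0 := measure_mono_null h1 (mem_ae_iff.1 ht)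
  rw [Measure.restrict_apply measurableSet_Ioo, inter_eq_left.2 Ioo_subset_Ioi_self,
    Real.volume_Ioo, ENNReal.ofReal_eq_zero] at h2
  have : 0 < ε := hε
  linarith

/-- The primitive is continuous at `0`, and `U` agrees with it off a null set, which the filter
ignores. This makes the trace computable from any representative. -/
theorem tendsto_aeRight_of_primitive {E : Type*} [NormedAddCommGroup E] [NormedSpace ℝ E]
    {U g : ℝ → E} {c : E} (hg : IntegrableOn g (Ioc 0 1))
    (h : ∀ᵐ t ∂halfLine, U t = c + ∫ τ in (0 : ℝ)..t, g τ) :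
    Filter.Tendsto U aeRight (nhds c) := by
  have h1 : Filter.Tendsto (fun t => c + ∫ τ in (0 : ℝ)..t, g τ) (nhdsWithin 0 (Ioi 0)) (nhds c) := by
    have hc := intervalIntegral.continuousOn_primitive_interval (a := 0) (b := 1) (f := g)
      (μ := volume) (by rwa [uIcc_of_le zero_le_one, integrableOn_Icc_iff_integrableOn_Ioc])
    have h2 := (hc 0 left_mem_uIcc).tendsto
    rw [intervalIntegral.integral_same] at h2
    have h3 : nhdsWithin (0 : ℝ) (Ioi 0) ≤ nhdsWithin 0 (uIcc 0 1) := by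
      rw [uIcc_of_le zero_le_one]
      exact nhdsWithin_le_of_mem (Icc_mem_nhdsGT one_pos)
    simpa using (h2.mono_left h3).const_add c
  refine (h1.mono_left inf_le_left).congr' ?_
  have : ∀ᶠ t in aeRight, U t = c + ∫ τ in (0 : ℝ)..t, g τ := Filter.Eventually.filter_mono inf_le_right h
  filter_upwards [this] with t ht using ht.symm

theorem boundaryTrace_congr_ae {U V : Rn (d + 1) → ℂ} {G H : Rn (d + 1) → Cn (d + 1)}
    (hUV : U =ᵐ[halfMeasure d] V) (hGH : G =ᵐ[halfMeasure d] H) :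
    boundaryTrace U G =ᵐ[volume] boundaryTrace V H := by
  have h : ∀ᵐ X ∂halfMeasure d, U X = V X ∧ G X = H X := hUV.and hGH
  rw [ae_half_iff] at h
  filter_upwards [Measure.ae_ae_of_ae_prod h] with x hx
  refine integral_congr_ae ?_
  filter_upwards [ae_restrict_of_ae_restrict_of_subset Ioc_subset_Ioi_self hx] with t ht
  simp only [ht.1, ht.2]

section Trace

variable {U : Rn (d + 1) → ℂ} {G : Rn (d + 1) → Cn (d + 1)} {s q : ℝ}

/-- Almost every vertical limit of `U` at the boundary is the boundary trace. -/
theorem HasWeakGradient.ae_tendsto_boundaryTrace (h : HasWeakGradient U G) (hU : Measurable U)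
    (hG : Measurable G) {B : Rn (d + 1) → Rn (d + 1)} (hB : Continuous B) (hs : 0 < s) (hq : 1 ≤ q)
    (eU : energy ((1 - s) * q - 1) q (fun X => ‖U X‖ₑ) < ⊤)
    (eF : energy ((1 - s) * q - 1) q (fun X => ‖covField B U G X‖ₑ) < ⊤) :
    ∀ᵐ x : Rn d, Filter.Tendsto (fun t => U (pt x t)) aeRight (nhds (boundaryTrace U G x)) := by
  filter_upwards [h.ae_eq_boundaryTrace_add hU hG, ae_integrableOn_vertical hB hU hG hs hq eU eF]
    with x h1 h2
  exact tendsto_aeRight_of_primitive (h2 1 one_pos).2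
    (h1 (h2 1 one_pos).1 fun T hT => (h2 T hT).2)

end Trace

end Classical

/-! ### Integrals of kernels supported in cones -/

section Kernel

variable {d : ℕ} {E : Type*} [NormedAddCommGroup E]

/-- A continuous kernel on the half-space, supported in `‖y - x‖ ≤ t`. -/
structure ConeKernel (L : Rn (d + 1) → Rn d → E) : Prop where
  continuousOn : ContinuousOn (fun z : Rn (d + 1) × Rn d => L z.1 z.2) (halfSpace d ×ˢ univ)
  eq_zero : ∀ X ∈ halfSpace d, ∀ y, X (Fin.last d) < ‖y - hor d X‖ → L X y = 0

theorem ConeKernel.continuous_right {L : Rn (d + 1) → Rn d → E} (hL : ConeKernel L)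
    {X : Rn (d + 1)} (hX : X ∈ halfSpace d) : Continuous (L X) := by
  rw [← continuousOn_univ]
  exact hL.continuousOn.comp (by fun_prop : ContinuousOn (fun y : Rn d => (X, y)) univ)
    fun y hy => ⟨hX, hy⟩

theorem ConeKernel.continuousAt_left {L : Rn (d + 1) → Rn d → E} (hL : ConeKernel L)
    {X : Rn (d + 1)} (hX : X ∈ halfSpace d) (y : Rn d) : ContinuousAt (fun X => L X y) X := by
  have : ContinuousOn (fun X => L X y) (halfSpace d) :=
    hL.continuousOn.comp (by fun_prop : ContinuousOn (fun X : Rn (d + 1) => (X, y)) _)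
      fun X hX => ⟨hX, mem_univ _⟩
  exact this.continuousAt ((isOpen_halfSpace d).mem_nhds hX)

/-- For `Y` within `t/2` of `X` the kernel at `Y` is supported within `3t/2` of the foot point of
`Y`, hence within `2t` of that of `X`. On the resulting compact set the kernel is bounded, which
yields a locally uniform dominating function. -/
theorem ConeKernel.exists_bound {L : Rn (d + 1) → Rn d → E} (hL : ConeKernel L) {u : Rn d → ℂ}
    (hu : LocallyIntegrable u) {X : Rn (d + 1)} (hX : X ∈ halfSpace d) :
    ∃ g : Rn d → ℝ, Integrable g ∧ ∃ s ∈ nhds X, ∀ Y ∈ s, ∀ y, ‖u y‖ * ‖L Y y‖ ≤ g y := by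
  set t := X (Fin.last d) with ht
  have ht0 : 0 < t := hX
  have hlast : ∀ Y ∈ Metric.closedBall X (t / 2), |Y (Fin.last d) - t| ≤ t / 2 := fun Y hY => by
    have := (abs_last_le (Y - X)).trans (mem_closedBall_iff_norm.1 hY)
    simpa using this
  have hsub : Metric.closedBall X (t / 2) ⊆ halfSpace d := fun Y hY => by
    have := abs_le.1 (hlast Y hY)
    change 0 < Y (Fin.last d)
    linarith
  obtain ⟨M, hM⟩ := ((isCompact_closedBall X (t / 2)).prod
    (isCompact_closedBall (hor d X) (2 * t))).exists_bound_of_continuousOn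
    (hL.continuousOn.mono (prod_mono hsub (subset_univ _)))
  refine ⟨(Metric.closedBall (hor d X) (2 * t)).indicator fun y => ‖u y‖ * M, ?_, _,
    Metric.closedBall_mem_nhds X (half_pos ht0), fun Y hY y => ?_⟩
  · rw [integrable_indicator_iff Metric.isClosed_closedBall.measurableSet]
    exact (hu.integrableOn_isCompact (isCompact_closedBall _ _)).norm.mul_const M
  · by_cases hy : y ∈ Metric.closedBall (hor d X) (2 * t)
    · rw [indicator_of_mem hy]
      exact mul_le_mul_of_nonneg_left (hM (Y, y) ⟨hY, hy⟩) (norm_nonneg _)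
    · rw [indicator_of_notMem hy, hL.eq_zero Y (hsub hY) y ?_, norm_zero, mul_zero]
      rw [mem_closedBall_iff_norm, not_le] at hy
      have h1 : ‖hor d Y - hor d X‖ ≤ t / 2 := by
        rw [← map_sub]
        exact (norm_hor_le _).trans (mem_closedBall_iff_norm.1 hY)
      have h2 : ‖y - hor d X‖ ≤ ‖y - hor d Y‖ + ‖hor d Y - hor d X‖ := norm_sub_le_norm_sub_add_norm_sub ..
      have h3 := abs_le.1 (hlast Y hY)
      linarith

variable [NormedSpace ℂ E]

theorem ConeKernel.integrable {L : Rn (d + 1) → Rn d → E} (hL : ConeKernel L) {u : Rn d → ℂ}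
    (hu : LocallyIntegrable u) {X : Rn (d + 1)} (hX : X ∈ halfSpace d) :
    Integrable fun y => u y • L X y := by
  obtain ⟨g, hg, s, hs, h⟩ := hL.exists_bound hu hX
  refine hg.mono' (hu.aestronglyMeasurable.smul (hL.continuous_right hX).aestronglyMeasurable)
    (.of_forall fun y => ?_)
  rw [norm_smul]
  exact h X (mem_of_mem_nhds hs) y

theorem ConeKernel.continuousOn_integral {L : Rn (d + 1) → Rn d → E} (hL : ConeKernel L)
    {u : Rn d → ℂ} (hu : LocallyIntegrable u) :
    ContinuousOn (fun X => ∫ y, u y • L X y) (halfSpace d) := by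
  intro X hX
  obtain ⟨g, hg, s, hs, h⟩ := hL.exists_bound hu hX
  refine (continuousAt_of_dominated (F := fun X y => u y • L X y) (bound := g) ?_ ?_ hg
    (.of_forall fun y => (hL.continuousAt_left hX y).const_smul (u y))).continuousWithinAt
  · filter_upwards [(isOpen_halfSpace d).mem_nhds hX] with Y hY
    exact hu.aestronglyMeasurable.smul (hL.continuous_right hY).aestronglyMeasurable
  · filter_upwards [hs] with Y hY
    refine .of_forall fun y => ?_
    rw [norm_smul]
    exact h Y hY y

/-- Differentiation under the integral sign. -/
theorem ConeKernel.hasFDerivAt_integral {K : Rn (d + 1) → Rn d → ℂ}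
    {K' : Rn (d + 1) → Rn d → Rn (d + 1) →L[ℝ] ℂ} (hK : ConeKernel K) (hK' : ConeKernel K')
    (hd : ∀ X ∈ halfSpace d, ∀ y, HasFDerivAt (fun X => K X y) (K' X y) X) {u : Rn d → ℂ}
    (hu : LocallyIntegrable u) {X : Rn (d + 1)} (hX : X ∈ halfSpace d) :
    HasFDerivAt (fun X => ∫ y, u y • K X y) (∫ y, u y • K' X y) X := by
  obtain ⟨g, hg, s, hs, h⟩ := hK'.exists_bound hu hX
  have hH := (isOpen_halfSpace d).mem_nhds hX
  refine hasFDerivAt_integral_of_dominated_of_fderiv_le (F := fun X y => u y • K X y)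
    (F' := fun X y => u y • K' X y) (bound := g) (Filter.inter_mem hs hH)
    ?_ (hK.integrable hu hX)
    (hu.aestronglyMeasurable.smul (hK'.continuous_right hX).aestronglyMeasurable) ?_ hg ?_
  · filter_upwards [hH] with Y hY
    exact hu.aestronglyMeasurable.smul (hK.continuous_right hY).aestronglyMeasurable
  · refine .of_forall fun y Y hY => ?_
    rw [norm_smul]
    exact h Y hY.1 y
  · exact .of_forall fun y Y hY => (hd Y hY.2 y).const_smul (u y)

end Kernel

/-! ### Mollifiers -/

/-- A kernel `κ(x, t)`, homogeneous of degree `-d` as far as size is concerned, such that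
`y ↦ κ(x - y, t)` is an average over the ball of centre `x` and radius `t`. -/
structure IsMollifier {d : ℕ} (κ : Rn (d + 1) → ℝ) (M : ℝ) : Prop where
  contDiffOn : ContDiffOn ℝ 1 κ (halfSpace d)
  eq_zero : ∀ Z ∈ halfSpace d, Z (Fin.last d) < ‖hor d Z‖ → κ Z = 0
  integral_eq_one : ∀ X ∈ halfSpace d, ∫ y, κ (X - pt y 0) = 1
  abs_le : ∀ Z ∈ halfSpace d, |κ Z| ≤ M * Z (Fin.last d) ^ (-(d : ℝ))
  norm_fderiv_le : ∀ Z ∈ halfSpace d, ‖fderiv ℝ κ Z‖ ≤ M * Z (Fin.last d) ^ (-(d : ℝ) - 1)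

theorem exists_isMollifier (d : ℕ) : ∃ (κ : Rn (d + 1) → ℝ) (M : ℝ), IsMollifier κ M := by
  let η : ContDiffBump (0 : Rn d) := ⟨1 / 2, 1, by norm_num, by norm_num⟩
  set f : Rn d → ℝ := η.normed volume with hf
  have hfc : ContDiff ℝ 1 f := η.contDiff_normed
  have hf0 : ∀ x, 1 < ‖x‖ → f x = 0 := fun x hx => by
    rw [← Function.notMem_support, hf, η.support_normed_eq, mem_ball_zero_iff]
    exact hx.le.not_gt
  -- The usual rescaling `t^{-d} f(x/t)` of a normalized bump supported in the unit ball.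
  set κ : Rn (d + 1) → ℝ := fun Z => Z (Fin.last d) ^ (-(d : ℝ)) * f ((Z (Fin.last d))⁻¹ • hor d Z)
    with hκ
  have hcd : ContDiffOn ℝ 1 κ (halfSpace d) := by
    intro Z hZ
    have hZ0 : Z (Fin.last d) ≠ 0 := (show 0 < Z (Fin.last d) from hZ).ne'
    have h1 : ContDiffAt ℝ 1 (fun Z : Rn (d + 1) => Z (Fin.last d)) Z := by fun_prop
    refine ContDiffAt.contDiffWithinAt ?_
    exact (h1.rpow_const_of_ne hZ0).mul
      (hfc.contDiffAt.comp Z ((h1.inv hZ0).smul (hor d).contDiff.contDiffAt))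
  have hκ0 : ∀ Z ∈ halfSpace d, Z (Fin.last d) < ‖hor d Z‖ → κ Z = 0 := by
    intro Z hZ h
    have hZ0 : 0 < Z (Fin.last d) := hZ
    simp only [hκ]
    rw [hf0, mul_zero]
    rw [norm_smul, norm_inv, Real.norm_of_nonneg hZ0.le, inv_mul_eq_div, lt_div_iff₀ hZ0, one_mul]
    exact h
  obtain ⟨M0, hM0⟩ := (isCompact_closedBall (0 : Rn d) 1).exists_bound_of_continuousOn
    hfc.continuous.continuousOn
  have hM0' : ∀ x, |f x| ≤ max M0 0 := fun x => by
    by_cases hx : ‖x‖ ≤ 1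
    · exact (hM0 x (by simpa using hx)).trans (le_max_left _ _)
    · rw [hf0 x (not_le.1 hx), abs_zero]
      exact le_max_right _ _
  have hc' : ContinuousOn (fderiv ℝ κ) (halfSpace d) :=
    hcd.continuousOn_fderiv_of_isOpen (isOpen_halfSpace d) le_rfl
  obtain ⟨M1, hM1⟩ := (isCompact_closedBall (0 : Rn d) 1).exists_bound_of_continuousOn
    (f := fun x => fderiv ℝ κ (pt x 1))
    (hc'.comp (by fun_prop : ContinuousOn (fun x : Rn d => pt x 1) _)
      fun x _ => pt_mem_halfSpace.2 one_pos)
  -- At height `1` the gradient is bounded on the unit ball by compactness, and outside it the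
  -- kernel vanishes on a neighbourhood.
  have hM1' : ∀ x, ‖fderiv ℝ κ (pt x 1)‖ ≤ max M1 0 := fun x => by
    by_cases hx : ‖x‖ ≤ 1
    · exact (hM1 x (by simpa using hx)).trans (le_max_left _ _)
    · have h1 : κ =ᶠ[nhds (pt x 1)] fun _ => 0 := by
        have ho : IsOpen {Z : Rn (d + 1) | Z (Fin.last d) < ‖hor d Z‖} :=
          isOpen_lt (by fun_prop) (by fun_prop)
        filter_upwards [(isOpen_halfSpace d).mem_nhds (pt_mem_halfSpace.2 one_pos),
          ho.mem_nhds (show pt x 1 ∈ _ by simpa using hx)] with Z h1 h2 using hκ0 Z h1 h2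
      rw [h1.fderiv_eq]
      simp
  refine ⟨κ, max M0 0 + max M1 0, hcd, hκ0, fun X hX => ?_, fun Z hZ => ?_, fun Z hZ => ?_⟩
  · have hX0 : 0 < X (Fin.last d) := hX
    set t := X (Fin.last d) with ht
    have e : ∀ y : Rn d, κ (X - pt y 0) = t ^ (-(d : ℝ)) * f (t⁻¹ • (hor d X - y)) := fun y => by
      simp [hκ, ht]
    simp only [e]
    rw [integral_const_mul, integral_sub_left_eq_self (fun y => f (t⁻¹ • y)),
      Measure.integral_comp_inv_smul_of_nonneg _ _ hX0.le, hf, η.integral_normed]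
    simp only [finrank_euclideanSpace, Fintype.card_fin, smul_eq_mul, mul_one]
    rw [Real.rpow_neg hX0.le, Real.rpow_natCast, inv_mul_cancel₀ (by positivity)]
  · have hZ0 : 0 < Z (Fin.last d) := hZ
    have hp : 0 ≤ Z (Fin.last d) ^ (-(d : ℝ)) := Real.rpow_nonneg hZ0.le _
    simp only [hκ]
    rw [abs_mul, abs_of_nonneg hp, mul_comm]
    exact mul_le_mul_of_nonneg_right ((hM0' _).trans (le_add_of_nonneg_right (le_max_right _ _))) hp
  · set t := Z (Fin.last d) with ht
    have hZ0 : 0 < t := hZ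
    -- Homogeneity of degree `-d` transfers the gradient bound from height `1` to height `t`, with
    -- the additional factor `t⁻¹`.
    have e : κ =ᶠ[nhds Z] fun Y => t ^ (-(d : ℝ)) • κ (t⁻¹ • Y) := by
      filter_upwards [(isOpen_halfSpace d).mem_nhds hZ] with Y hY
      have hY0 : 0 < Y (Fin.last d) := hY
      simp only [hκ, PiLp.smul_apply, smul_eq_mul, map_smul]
      rw [Real.mul_rpow (inv_nonneg.2 hZ0.le) hY0.le, Real.inv_rpow hZ0.le, ← mul_assoc, ← mul_assoc,
        mul_inv_cancel₀ (Real.rpow_pos_of_pos hZ0 _).ne', one_mul, smul_smul, mul_inv, inv_inv,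
        mul_right_comm, mul_inv_cancel₀ hZ0.ne', one_mul]
    have e1 : t⁻¹ • Z = pt (t⁻¹ • hor d Z) 1 := by
      conv_lhs => rw [← pt_hor Z, ← ht, ← pt_smul, inv_mul_cancel₀ hZ0.ne']
    have e2 : fderiv ℝ κ Z = t ^ (-(d : ℝ)) • t⁻¹ • fderiv ℝ κ (t⁻¹ • Z) := by
      rw [e.fderiv_eq, show (fun Y => t ^ (-(d : ℝ)) • κ (t⁻¹ • Y)) =
        t ^ (-(d : ℝ)) • fun Y => κ (t⁻¹ • Y) from rfl, fderiv_const_smul_field, Pi.smul_apply,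
        fderiv_comp_smul]
    rw [e2, norm_smul, norm_smul, e1, Real.norm_of_nonneg (by positivity),
      Real.norm_of_nonneg (by positivity), Real.rpow_sub_one hZ0.ne', div_eq_mul_inv]
    have h1 := (hM1' (t⁻¹ • hor d Z)).trans (le_add_of_nonneg_left (le_max_right M0 0))
    have h2 : 0 ≤ t ^ (-(d : ℝ)) * t⁻¹ := by positivity
    calc _ = t ^ (-(d : ℝ)) * t⁻¹ * ‖fderiv ℝ κ (pt (t⁻¹ • hor d Z) 1)‖ := by ring
      _ ≤ t ^ (-(d : ℝ)) * t⁻¹ * (max M0 0 + max M1 0) := mul_le_mul_of_nonneg_left h1 h2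
      _ = _ := by ring

/-! ### The extension operator -/

section Extension

variable {d : ℕ} {B : Rn (d + 1) → Rn (d + 1)} {β : ℝ} {κ : Rn (d + 1) → ℝ} {M b : ℝ} {u : Rn d → ℂ}

/-- The parallel transport factor `e^{i I_B(X, Y)}`. -/
def phase {n : ℕ} (B : Rn n → Rn n) (X Y : Rn n) : ℂ :=
  Complex.exp (Complex.I * (intPot B X Y : ℂ))

theorem norm_phase {n : ℕ} (B : Rn n → Rn n) (X Y : Rn n) : ‖phase B X Y‖ = 1 := by
  rw [phase, mul_comm, Complex.norm_exp_ofReal_mul_I]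

theorem continuous_phase {n : ℕ} {B : Rn n → Rn n} (hB : Continuous B) :
    Continuous fun z : Rn n × Rn n => phase B z.1 z.2 := by
  have := continuous_intPot hB
  unfold phase
  fun_prop

theorem norm_exp_sub_exp_le (θ φ : ℝ) :
    ‖Complex.exp (Complex.I * (θ : ℂ)) - Complex.exp (Complex.I * (φ : ℂ))‖ ≤ |θ - φ| := by
  have e : Complex.exp (Complex.I * (θ : ℂ)) - Complex.exp (Complex.I * (φ : ℂ)) =
      Complex.exp (Complex.I * (φ : ℂ)) * (Complex.exp (Complex.I * ((θ - φ : ℝ) : ℂ)) - 1) := by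
    rw [mul_sub, ← Complex.exp_add, mul_one]
    congr 2
    push_cast
    ring
  rw [e, norm_mul, mul_comm Complex.I (φ : ℂ), Complex.norm_exp_ofReal_mul_I, one_mul]
  exact Real.norm_exp_I_mul_ofReal_sub_one_le

/-- The integral kernel of the extension operator. -/
def extKernel (κ : Rn (d + 1) → ℝ) (B : Rn (d + 1) → Rn (d + 1)) (b : ℝ) (X : Rn (d + 1)) (y : Rn d) : ℂ :=
  ((Real.exp (-(b * X (Fin.last d))) * κ (X - pt y 0) : ℝ) : ℂ) * phase B X (pt y 0)

/-- The differential of the kernel of the extension operator. -/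
def extKernelDiff (κ : Rn (d + 1) → ℝ) (B : Rn (d + 1) → Rn (d + 1)) (b : ℝ) (X : Rn (d + 1))
    (y : Rn d) : Rn (d + 1) →L[ℝ] ℂ :=
  ((Real.exp (-(b * X (Fin.last d))) * κ (X - pt y 0) : ℝ) : ℂ) •
      (phase B X (pt y 0) * Complex.I) • Complex.ofRealCLM.comp (potDiff B X (pt y 0)) +
    phase B X (pt y 0) • Complex.ofRealCLM.comp
      (Real.exp (-(b * X (Fin.last d))) • fderiv ℝ κ (X - pt y 0) -
        (b * Real.exp (-(b * X (Fin.last d))) * κ (X - pt y 0)) • EuclideanSpace.proj (Fin.last d))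

theorem sub_pt_zero_mem {X : Rn (d + 1)} (hX : X ∈ halfSpace d) (y : Rn d) :
    X - pt y 0 ∈ halfSpace d := by
  have h : 0 < X (Fin.last d) := hX
  change 0 < (X - pt y 0) (Fin.last d)
  simpa using h

theorem IsMollifier.apply_eq_zero (hκ : IsMollifier κ M) {X : Rn (d + 1)} (hX : X ∈ halfSpace d)
    {y : Rn d} (h : X (Fin.last d) < ‖y - hor d X‖) : κ (X - pt y 0) = 0 := by
  refine hκ.eq_zero _ (sub_pt_zero_mem hX y) ?_
  rw [map_sub, hor_pt, norm_sub_rev]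
  simpa using h

theorem IsMollifier.fderiv_eq_zero (hκ : IsMollifier κ M) {X : Rn (d + 1)} (hX : X ∈ halfSpace d)
    {y : Rn d} (h : X (Fin.last d) < ‖y - hor d X‖) : fderiv ℝ κ (X - pt y 0) = 0 := by
  have h1 : κ =ᶠ[nhds (X - pt y 0)] fun _ => 0 := by
    have ho : IsOpen {Z : Rn (d + 1) | Z (Fin.last d) < ‖hor d Z‖} :=
      isOpen_lt (by fun_prop) (by fun_prop)
    have hm : (X - pt y 0) (Fin.last d) < ‖hor d (X - pt y 0)‖ := by
      rw [map_sub, hor_pt, norm_sub_rev]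
      simpa using h
    filter_upwards [(isOpen_halfSpace d).mem_nhds (sub_pt_zero_mem hX y), ho.mem_nhds hm]
      with Z h1 h2 using hκ.eq_zero Z h1 h2
  rw [h1.fderiv_eq]
  simp

theorem IsMollifier.hasFDerivAt (hκ : IsMollifier κ M) {X : Rn (d + 1)} (hX : X ∈ halfSpace d)
    (y : Rn d) : HasFDerivAt (fun X => κ (X - pt y 0)) (fderiv ℝ κ (X - pt y 0)) X := by
  have h1 := sub_pt_zero_mem hX y
  have h2 : HasFDerivAt κ (fderiv ℝ κ (X - pt y 0)) (X - pt y 0) :=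
    ((hκ.contDiffOn.contDiffAt ((isOpen_halfSpace d).mem_nhds h1)).differentiableAt
      one_ne_zero).hasFDerivAt
  exact h2.comp X ((hasFDerivAt_id X).sub_const (pt y 0))

theorem continuous_sub_pt_zero :
    Continuous fun z : Rn (d + 1) × Rn d => z.1 - pt z.2 0 := by fun_prop

theorem IsMollifier.continuousOn (hκ : IsMollifier κ M) :
    ContinuousOn (fun z : Rn (d + 1) × Rn d => κ (z.1 - pt z.2 0)) (halfSpace d ×ˢ univ) :=
  hκ.contDiffOn.continuousOn.comp continuous_sub_pt_zero.continuousOn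
    fun z hz => sub_pt_zero_mem hz.1 z.2

theorem IsMollifier.continuousOn_fderiv (hκ : IsMollifier κ M) :
    ContinuousOn (fun z : Rn (d + 1) × Rn d => fderiv ℝ κ (z.1 - pt z.2 0)) (halfSpace d ×ˢ univ) :=
  (hκ.contDiffOn.continuousOn_fderiv_of_isOpen (isOpen_halfSpace d) le_rfl).comp
    continuous_sub_pt_zero.continuousOn fun z hz => sub_pt_zero_mem hz.1 z.2

theorem IsMollifier.coneKernel (hκ : IsMollifier κ M) :
    ConeKernel fun (X : Rn (d + 1)) y => ((κ (X - pt y 0) : ℝ) : ℂ) where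
  continuousOn := Complex.continuous_ofReal.comp_continuousOn hκ.continuousOn
  eq_zero X hX y h := by simp only [hκ.apply_eq_zero hX h, Complex.ofReal_zero]

theorem IsMollifier.coneKernel_fderiv (hκ : IsMollifier κ M) :
    ConeKernel fun (X : Rn (d + 1)) y => Complex.ofRealCLM.comp (fderiv ℝ κ (X - pt y 0)) where
  continuousOn := continuousOn_const.clm_comp hκ.continuousOn_fderiv
  eq_zero X hX y h := by simp only [hκ.fderiv_eq_zero hX h, ContinuousLinearMap.comp_zero]

theorem IsMollifier.integrable_fderiv (hκ : IsMollifier κ M) {X : Rn (d + 1)} (hX : X ∈ halfSpace d) :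
    Integrable fun y => Complex.ofRealCLM.comp (fderiv ℝ κ (X - pt y 0)) := by
  have := hκ.coneKernel_fderiv.integrable (u := fun _ => 1) (locallyIntegrable_const 1) hX
  simpa using this

/-- Differentiating the constant `∫ κ(X - (y, 0)) dy = 1` under the integral. This cancellation
turns the gradient of the extension into an integral of differences of `u`. -/
theorem IsMollifier.integral_fderiv (hκ : IsMollifier κ M) {X : Rn (d + 1)} (hX : X ∈ halfSpace d) :
    ∫ y, Complex.ofRealCLM.comp (fderiv ℝ κ (X - pt y 0)) = 0 := by
  have h := hκ.coneKernel.hasFDerivAt_integral hκ.coneKernel_fderiv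
    (fun X hX y => Complex.ofRealCLM.hasFDerivAt.comp X (hκ.hasFDerivAt hX y))
    (u := fun _ => 1) (locallyIntegrable_const 1) hX
  simp only [one_smul] at h
  refine h.unique ((hasFDerivAt_const (1 : ℂ) X).congr_of_eventuallyEq ?_)
  filter_upwards [(isOpen_halfSpace d).mem_nhds hX] with Y hY
  rw [integral_complex_ofReal, hκ.integral_eq_one Y hY, Complex.ofReal_one]

theorem continuousOn_phase (hB : Continuous B) :
    ContinuousOn (fun z : Rn (d + 1) × Rn d => phase B z.1 (pt z.2 0)) (halfSpace d ×ˢ univ) :=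
  ((continuous_phase hB).comp (by fun_prop :
    Continuous fun z : Rn (d + 1) × Rn d => (z.1, pt z.2 0))).continuousOn

theorem continuousOn_exp_mul (hκ : IsMollifier κ M) (b : ℝ) :
    ContinuousOn (fun z : Rn (d + 1) × Rn d =>
      Real.exp (-(b * z.1 (Fin.last d))) * κ (z.1 - pt z.2 0)) (halfSpace d ×ˢ univ) :=
  (by fun_prop : Continuous fun z : Rn (d + 1) × Rn d =>
    Real.exp (-(b * z.1 (Fin.last d)))).continuousOn.mul hκ.continuousOn

theorem coneKernel_extKernel (hκ : IsMollifier κ M) (hB : Continuous B) (b : ℝ) :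
    ConeKernel (extKernel κ B b) where
  continuousOn := (Complex.continuous_ofReal.comp_continuousOn (continuousOn_exp_mul hκ b)).mul
    (continuousOn_phase hB)
  eq_zero X hX y h := by simp [extKernel, hκ.apply_eq_zero hX h]

theorem coneKernel_extKernelDiff (hκ : IsMollifier κ M) (hB : ContDiff ℝ 1 B) (b : ℝ) :
    ConeKernel (extKernelDiff κ B b) where
  continuousOn := by
    have h1 := Complex.continuous_ofReal.comp_continuousOn (continuousOn_exp_mul hκ b)
    have h2 : ContinuousOn (fun z : Rn (d + 1) × Rn d => potDiff B z.1 (pt z.2 0))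
        (halfSpace d ×ˢ univ) := ((continuous_potDiff hB).comp (by fun_prop :
          Continuous fun z : Rn (d + 1) × Rn d => (z.1, pt z.2 0))).continuousOn
    have h3 := continuousOn_phase (d := d) hB.continuous
    have h4 : ContinuousOn (fun z : Rn (d + 1) × Rn d => Real.exp (-(b * z.1 (Fin.last d))))
        (halfSpace d ×ˢ univ) := Continuous.continuousOn (by fun_prop)
    have h5 : ContinuousOn (fun z : Rn (d + 1) × Rn d =>
        (b * Real.exp (-(b * z.1 (Fin.last d))) * κ (z.1 - pt z.2 0)) •
          (EuclideanSpace.proj (Fin.last d) : Rn (d + 1) →L[ℝ] ℝ)) (halfSpace d ×ˢ univ) :=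
      ((continuousOn_const.mul h4).mul hκ.continuousOn).smul continuousOn_const
    unfold extKernelDiff
    exact (h1.smul ((h3.mul continuousOn_const).smul (continuousOn_const.clm_comp h2))).add
      (h3.smul (continuousOn_const.clm_comp ((h4.smul hκ.continuousOn_fderiv).sub h5)))
  eq_zero X hX y h := by
    ext v
    simp [extKernelDiff, hκ.apply_eq_zero hX h, hκ.fderiv_eq_zero hX h]

theorem hasFDerivAt_extKernel (hκ : IsMollifier κ M) (hB : ContDiff ℝ 1 B) (b : ℝ)
    {X : Rn (d + 1)} (hX : X ∈ halfSpace d) (y : Rn d) :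
    HasFDerivAt (fun X => extKernel κ B b X y) (extKernelDiff κ B b X y) X := by
  have h1 : HasFDerivAt (fun X : Rn (d + 1) => Real.exp (-(b * X (Fin.last d))))
      (Real.exp (-(b * X (Fin.last d))) • -(b • (EuclideanSpace.proj (Fin.last d) : Rn (d + 1) →L[ℝ] ℝ))) X :=
    (((EuclideanSpace.proj (Fin.last d) : Rn (d + 1) →L[ℝ] ℝ).hasFDerivAt.const_mul b).neg).exp
  have h2 := Complex.ofRealCLM.hasFDerivAt.comp X (h1.mul (hκ.hasFDerivAt hX y))
  have h3 : HasFDerivAt (fun X => phase B X (pt y 0))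
      ((phase B X (pt y 0) * Complex.I) • Complex.ofRealCLM.comp (potDiff B X (pt y 0))) X := by
    have := ((Complex.ofRealCLM.hasFDerivAt.comp X (hasFDerivAt_intPot hB X (pt y 0))).const_mul
      Complex.I).cexp
    rw [mul_smul]
    exact this
  refine (h2.mul h3).congr_fderiv ?_
  ext v
  simp [extKernelDiff]
  ring

/-- The extension `e^{-b t} ∫ κ(x - y, t) e^{i I_B((x, t), (y, 0))} u(y) dy` of `u`. -/
def extend (κ : Rn (d + 1) → ℝ) (B : Rn (d + 1) → Rn (d + 1)) (b : ℝ) (u : Rn d → ℂ)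
    (X : Rn (d + 1)) : ℂ :=
  ∫ y, u y • extKernel κ B b X y

/-- The gradient of the extension. -/
def extendGrad (κ : Rn (d + 1) → ℝ) (B : Rn (d + 1) → Rn (d + 1)) (b : ℝ) (u : Rn d → ℂ)
    (X : Rn (d + 1)) : Cn (d + 1) :=
  gradVec (∫ y, u y • extKernelDiff κ B b X y)

theorem hasWeakGradient_extend (hκ : IsMollifier κ M) (hB : ContDiff ℝ 1 B) (b : ℝ)
    (hu : LocallyIntegrable u) : HasWeakGradient (extend κ B b u) (extendGrad κ B b u) :=
  .of_hasFDerivAt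
    (fun _ hX => (coneKernel_extKernel hκ hB.continuous b).hasFDerivAt_integral
      (coneKernel_extKernelDiff hκ hB b) (fun _ hX y => hasFDerivAt_extKernel hκ hB b hX y) hu hX)
    ((coneKernel_extKernelDiff hκ hB b).continuousOn_integral hu)

/-- The potential term is brought under the integral, where it can cancel against the derivative of
the phase for each `y` separately. -/
theorem dotC_covField_extend (hκ : IsMollifier κ M) (hB : ContDiff ℝ 1 B) (b : ℝ)
    (hu : LocallyIntegrable u) {X : Rn (d + 1)} (hX : X ∈ halfSpace d) (v : Rn (d + 1)) :
    dotC v (covField B (extend κ B b u) (extendGrad κ B b u) X) =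
      ∫ y, u y * (extKernelDiff κ B b X y v + Complex.I * (inner ℝ (B X) v : ℝ) * extKernel κ B b X y) := by
  have i1 := (coneKernel_extKernelDiff hκ hB b).integrable hu hX
  have i2 := (coneKernel_extKernel hκ hB.continuous b).integrable hu hX
  rw [dotC_covField, extendGrad, dotC_gradVec, ContinuousLinearMap.integral_apply i1, extend,
    ← integral_const_mul]
  have i3 : Integrable fun y => (u y • extKernelDiff κ B b X y) v := by
    exact (ContinuousLinearMap.apply ℝ ℂ v).integrable_comp i1
  rw [← integral_add i3 (i2.const_mul _)]
  refine integral_congr_ae (.of_forall fun y => ?_)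
  simp
  ring

end Extension

/-! ### Pointwise bounds of the extension -/

section Pointwise

variable {d : ℕ} {B : Rn (d + 1) → Rn (d + 1)} {β : ℝ} {κ : Rn (d + 1) → ℝ} {M b : ℝ} {u : Rn d → ℂ}

/-- The normalized integral of the covariant differences over the ball of centre `x`, radius `t`. -/
def coneDiff (B : Rn (d + 1) → Rn (d + 1)) (u : Rn d → ℂ) (X : Rn (d + 1)) : ℝ≥0∞ :=
  wt (-(d : ℝ) - 1) (X (Fin.last d)) *
    ∫⁻ y in Metric.closedBall (hor d X) (X (Fin.last d)), ‖covDiff (parallel B) u (hor d X, y)‖ₑ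

/-- The damped mean of `|u|` over the ball of centre `x`, radius `t`. -/
def coneMean (b : ℝ) (u : Rn d → ℂ) (X : Rn (d + 1)) : ℝ≥0∞ :=
  wt (-(d : ℝ)) (X (Fin.last d)) * ENNReal.ofReal (Real.exp (-(b * X (Fin.last d) / 2))) *
    ∫⁻ y in Metric.closedBall (hor d X) (X (Fin.last d)), ‖u y‖ₑ

/-- The common end of the three pointwise bounds below: once the integrand is controlled by the two
model terms on the cone, only integration over the ball remains. -/
theorem enorm_integral_le_cone (hB : Continuous B) (hu : Measurable u) {X : Rn (d + 1)}
    (hX : X ∈ halfSpace d) {F : Rn d → ℂ} {c₁ c₂ : ℝ} (h1 : 0 ≤ c₁) (h2 : 0 ≤ c₂)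
    (h0 : ∀ y, X (Fin.last d) < ‖y - hor d X‖ → F y = 0)
    (hF : ∀ y, ‖y - hor d X‖ ≤ X (Fin.last d) →
      ‖F y‖ ≤ c₁ * X (Fin.last d) ^ (-(d : ℝ) - 1) * ‖covDiff (parallel B) u (hor d X, y)‖ +
        c₂ * X (Fin.last d) ^ (-(d : ℝ)) * Real.exp (-(b * X (Fin.last d) / 2)) * ‖u y‖) :
    ‖∫ y, F y‖ₑ ≤ ENNReal.ofReal c₁ * coneDiff B u X + ENNReal.ofReal c₂ * coneMean b u X := by
  have hX0 : 0 < X (Fin.last d) := hX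
  set t := X (Fin.last d) with ht
  set S := Metric.closedBall (hor d X) t with hS
  have e : ∫ y, F y = ∫ y in S, F y := by
    refine (setIntegral_eq_integral_of_forall_compl_eq_zero fun y hy => h0 y ?_).symm
    rwa [hS, mem_closedBall_iff_norm, not_le] at hy
  have hm1 : Measurable fun y => ‖covDiff (parallel B) u (hor d X, y)‖ₑ :=
    ((measurable_covDiff (continuous_parallel hB) hu).comp (by fun_prop)).enorm
  rw [e]
  refine (enorm_integral_le_lintegral_enorm _).trans ?_
  calc ∫⁻ y in S, ‖F y‖ₑ
      ≤ ∫⁻ y in S, (ENNReal.ofReal c₁ * wt (-(d : ℝ) - 1) t * ‖covDiff (parallel B) u (hor d X, y)‖ₑ +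
          ENNReal.ofReal c₂ * (wt (-(d : ℝ)) t * ENNReal.ofReal (Real.exp (-(b * t / 2)))) * ‖u y‖ₑ) := by
        refine setLIntegral_mono' Metric.isClosed_closedBall.measurableSet fun y hy => ?_
        rw [hS, mem_closedBall_iff_norm] at hy
        have hp := Real.rpow_nonneg hX0.le (-(d : ℝ))
        have hp1 := Real.rpow_nonneg hX0.le (-(d : ℝ) - 1)
        rw [wt, wt, ← ENNReal.ofReal_mul h1, ← ENNReal.ofReal_mul hp, ← ENNReal.ofReal_mul h2,
          ← ofReal_norm, ← ofReal_norm, ← ofReal_norm, ← ENNReal.ofReal_mul (by positivity),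
          ← ENNReal.ofReal_mul (by positivity), ← ENNReal.ofReal_add (by positivity) (by positivity)]
        refine ENNReal.ofReal_le_ofReal ((hF y hy).trans_eq ?_)
        ring
    _ = _ := by
        rw [lintegral_add_left (hm1.const_mul _), lintegral_const_mul _ hm1,
          lintegral_const_mul _ hu.enorm, coneDiff, coneMean]
        ring

theorem norm_pt_sub_le {X : Rn (d + 1)} (hX : X ∈ halfSpace d) {y : Rn d}
    (hy : ‖y - hor d X‖ ≤ X (Fin.last d)) : ‖pt y 0 - X‖ ≤ 2 * X (Fin.last d) := by
  have hX0 : 0 < X (Fin.last d) := hX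
  have e : pt y 0 - X = pt (y - hor d X) (-X (Fin.last d)) := by
    rw [← zero_sub, pt_sub, pt_hor]
  rw [e]
  refine (norm_pt_le _ _).trans ?_
  rw [abs_neg, abs_of_pos hX0]
  linarith

/-- Transporting `u(y)` to `X` through the foot point `(x, 0)` produces the covariant difference.
The detour changes the phase by the circulation around the triangle with vertices `X`, `(x, 0)`,
`(y, 0)`, at most `β · t · 2t`. -/
theorem CurlBound.norm_phase_mul_sub_le (hB : CurlBound B β) {X : Rn (d + 1)} (hX : X ∈ halfSpace d)
    {y : Rn d} (hy : ‖y - hor d X‖ ≤ X (Fin.last d)) (u : Rn d → ℂ) :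
    ‖phase B X (pt y 0) * u y - phase B X (pt (hor d X) 0) * u (hor d X)‖ ≤
      ‖covDiff (parallel B) u (hor d X, y)‖ + 2 * β * X (Fin.last d) ^ 2 * ‖u y‖ := by
  have hX0 : 0 < X (Fin.last d) := hX
  set t := X (Fin.last d) with ht
  set x := hor d X with hx
  have m : ∀ y : Rn d, pt y 0 ∈ closedHalfSpace d := fun y => pt_mem_closedHalfSpace.2 le_rfl
  have e : phase B X (pt y 0) * u y - phase B X (pt x 0) * u x =
      phase B X (pt x 0) * covDiff (parallel B) u (x, y) -
        (phase B X (pt x 0) * phase B (pt x 0) (pt y 0) - phase B X (pt y 0)) * u y := by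
    rw [covDiff_parallel]
    change _ = phase B X (pt x 0) * (phase B (pt x 0) (pt y 0) * u y - u x) - _
    ring
  have e2 : phase B X (pt x 0) * phase B (pt x 0) (pt y 0) =
      Complex.exp (Complex.I * ((intPot B X (pt x 0) + intPot B (pt x 0) (pt y 0) : ℝ) : ℂ)) := by
    rw [phase, phase, ← Complex.exp_add]
    congr 1
    push_cast
    ring
  have n1 : ‖pt x 0 - X‖ = t := by
    have : pt x 0 - X = pt 0 (-t) := by rw [← pt_hor X, ← pt_sub, sub_self, zero_sub]
    rw [this, norm_pt_zero_left, abs_neg, abs_of_pos hX0]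
  have n2 : ‖pt y 0 - pt x 0‖ ≤ 2 * t := by
    rw [← pt_sub, sub_zero, norm_pt_zero]
    linarith
  have h1 := hB.abs_triangle_le (halfSpace_subset_closedHalfSpace d hX) (m y) (m x)
    (norm_pt_sub_le hX hy) n2
  rw [n1] at h1
  rw [e, e2]
  refine (norm_sub_le _ _).trans (add_le_add ?_ ?_)
  · rw [norm_mul, norm_phase, one_mul]
  · rw [norm_mul]
    refine mul_le_mul_of_nonneg_right ?_ (norm_nonneg _)
    refine (norm_exp_sub_exp_le _ _).trans (h1.trans_eq ?_)
    ring

/-- Half of the exponential decay is spent on absorbing the factor `z`, by `z/2 + 1 ≤ e^{z/2}`. -/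
theorem mul_exp_neg_le {z : ℝ} : z * Real.exp (-z) ≤ 2 * Real.exp (-(z / 2)) := by
  have h : Real.exp (-(z / 2)) = Real.exp (z / 2) * Real.exp (-z) := by
    rw [← Real.exp_add]
    congr 1
    ring
  rw [h, ← mul_assoc]
  refine mul_le_mul_of_nonneg_right ?_ (Real.exp_pos _).le
  have := Real.add_one_le_exp (z / 2)
  linarith

/-- The bounds on the damping factors used below. -/
theorem exp_bounds {b t : ℝ} (hb : 0 ≤ b) (ht : 0 ≤ t) (hβ : β ≤ b ^ 2) :
    Real.exp (-(b * t)) ≤ 1 ∧ Real.exp (-(b * t)) ≤ Real.exp (-(b * t / 2)) ∧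
      β * t * Real.exp (-(b * t)) ≤ 2 * b * Real.exp (-(b * t / 2)) := by
  have h0 : 0 ≤ b * t := by positivity
  refine ⟨Real.exp_le_one_iff.2 (by linarith), Real.exp_le_exp.2 (by linarith), ?_⟩
  calc β * t * Real.exp (-(b * t)) ≤ b ^ 2 * t * Real.exp (-(b * t)) := by gcongr
    _ = b * (b * t * Real.exp (-(b * t))) := by ring
    _ ≤ b * (2 * Real.exp (-(b * t / 2))) := mul_le_mul_of_nonneg_left mul_exp_neg_le hb
    _ = _ := by ring

theorem enorm_extend_le (hκ : IsMollifier κ M) (hM : 0 ≤ M) (hB : Continuous B) (hu : Measurable u)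
    (hb : 0 ≤ b) {X : Rn (d + 1)} (hX : X ∈ halfSpace d) :
    ‖extend κ B b u X‖ₑ ≤ ENNReal.ofReal M * coneMean b u X := by
  have hX0 : 0 < X (Fin.last d) := hX
  have h := enorm_integral_le_cone (b := b) hB hu hX (F := fun y => u y • extKernel κ B b X y) le_rfl hM
    (fun y hy => by simp [extKernel, hκ.apply_eq_zero hX hy]) fun y hy => ?_
  · simpa [extend] using h
  · have h1 := hκ.abs_le _ (sub_pt_zero_mem hX y)
    have h2 := (exp_bounds hb hX0.le (sq_nonneg b)).2.1
    simp only [PiLp.sub_apply, pt_last, sub_zero] at h1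
    rw [norm_smul, extKernel, norm_mul, norm_phase, Complex.norm_real, norm_mul,
      Real.norm_of_nonneg (Real.exp_pos _).le, Real.norm_eq_abs, mul_one, zero_mul, zero_mul, zero_add]
    calc ‖u y‖ * (Real.exp (-(b * X (Fin.last d))) * |κ (X - pt y 0)|)
        ≤ ‖u y‖ * (Real.exp (-(b * X (Fin.last d) / 2)) * (M * X (Fin.last d) ^ (-(d : ℝ)))) := by
          gcongr
      _ = _ := by ring

/-- As the mollifier has integral one, the transported boundary value can be subtracted inside the
integral. Compared with the gradient bound there is an additional factor `t`, which is what
identifies the trace. -/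
theorem enorm_extend_sub_le (hκ : IsMollifier κ M) (hM : 0 ≤ M) (hB : CurlBound B β)
    (hu : Measurable u) (hui : LocallyIntegrable u) (hb : 0 ≤ b) (hβ : β ≤ b ^ 2)
    {X : Rn (d + 1)} (hX : X ∈ halfSpace d) :
    ‖extend κ B b u X - (Real.exp (-(b * X (Fin.last d))) : ℝ) *
        (phase B X (pt (hor d X) 0) * u (hor d X))‖ₑ ≤
      ENNReal.ofReal (M * X (Fin.last d)) * (coneDiff B u X + ENNReal.ofReal (4 * b) * coneMean b u X) := by
  have hX0 : 0 < X (Fin.last d) := hX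
  set t := X (Fin.last d) with ht
  set c := (Real.exp (-(b * t)) : ℝ) * (phase B X (pt (hor d X) 0) * u (hor d X)) with hc
  have i1 := (coneKernel_extKernel hκ hB.contDiff.continuous b).integrable hui hX
  have i2 : Integrable fun y => ((κ (X - pt y 0) : ℝ) : ℂ) := by
    have := hκ.coneKernel.integrable (u := fun _ => 1) (locallyIntegrable_const 1) hX
    simpa using this
  have e : extend κ B b u X - c = ∫ y, (u y • extKernel κ B b X y - c * ((κ (X - pt y 0) : ℝ) : ℂ)) := by
    rw [integral_sub i1 (i2.const_mul c), integral_const_mul, integral_complex_ofReal,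
      hκ.integral_eq_one X hX, Complex.ofReal_one, mul_one, extend]
  rw [e, mul_add, ← mul_assoc, ← ENNReal.ofReal_mul (by positivity)]
  refine enorm_integral_le_cone hB.contDiff.continuous hu hX (by positivity) (by positivity)
    (fun y hy => by simp [extKernel, hκ.apply_eq_zero hX hy]) fun y hy => ?_
  have h1 := hκ.abs_le _ (sub_pt_zero_mem hX y)
  simp only [PiLp.sub_apply, pt_last, sub_zero] at h1
  obtain ⟨x1, x2, x3⟩ := exp_bounds hb hX0.le hβ
  have h3 := hB.norm_phase_mul_sub_le hX hy u
  have e2 : u y • extKernel κ B b X y - c * ((κ (X - pt y 0) : ℝ) : ℂ) =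
      ((Real.exp (-(b * t)) * κ (X - pt y 0) : ℝ) : ℂ) *
        (phase B X (pt y 0) * u y - phase B X (pt (hor d X) 0) * u (hor d X)) := by
    rw [hc, extKernel]
    push_cast
    rw [smul_eq_mul]
    ring
  rw [e2, norm_mul, Complex.norm_real, norm_mul, Real.norm_of_nonneg (Real.exp_pos _).le,
    Real.norm_eq_abs, ← ht, Real.rpow_sub_one hX0.ne']
  rw [← ht] at h3
  have hp := Real.rpow_nonneg hX0.le (-(d : ℝ))
  calc Real.exp (-(b * t)) * |κ (X - pt y 0)| *
        ‖phase B X (pt y 0) * u y - phase B X (pt (hor d X) 0) * u (hor d X)‖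
      ≤ Real.exp (-(b * t)) * (M * t ^ (-(d : ℝ))) *
          (‖covDiff (parallel B) u (hor d X, y)‖ + 2 * β * t ^ 2 * ‖u y‖) := by gcongr
    _ = M * t ^ (-(d : ℝ)) * (Real.exp (-(b * t)) * ‖covDiff (parallel B) u (hor d X, y)‖ +
          2 * t * (β * t * Real.exp (-(b * t))) * ‖u y‖) := by ring
    _ ≤ M * t ^ (-(d : ℝ)) * (1 * ‖covDiff (parallel B) u (hor d X, y)‖ +
          2 * t * (2 * b * Real.exp (-(b * t / 2))) * ‖u y‖) := by gcongr
    _ = _ := by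
        field_simp
        ring

/-- Differentiating the mollifier gives differences of transported values because its gradient has
mean zero. Differentiating the phase gives, together with the potential, only a curl term.
Differentiating the damping gives a factor `b`. Every factor `β t` is absorbed by the damping into a
multiple of `b`. -/
theorem enorm_dotC_covField_extend_le (hκ : IsMollifier κ M) (hM : 0 ≤ M) (hB : CurlBound B β)
    (hu : Measurable u) (hui : LocallyIntegrable u) (hb : 0 ≤ b) (hβ : β ≤ b ^ 2)
    {X : Rn (d + 1)} (hX : X ∈ halfSpace d) {v : Rn (d + 1)} (hv : ‖v‖ = 1) :
    ‖dotC v (covField B (extend κ B b u) (extendGrad κ B b u) X)‖ₑ ≤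
      ENNReal.ofReal M * coneDiff B u X + ENNReal.ofReal (9 * b * M) * coneMean b u X := by
  have hX0 : 0 < X (Fin.last d) := hX
  set t := X (Fin.last d) with ht
  have hBc := hB.contDiff.continuous
  set w : Rn d → ℂ := fun y => phase B X (pt y 0) * u y with hw
  set E := Real.exp (-(b * t)) with hE
  set D : Rn d → ℝ := fun y => fderiv ℝ κ (X - pt y 0) v with hD
  set J : Rn d → ℝ := fun y => potDiff B X (pt y 0) v + inner ℝ (B X) v with hJ
  set Φ : Rn d → ℂ := fun y => ((E * D y : ℝ) : ℂ) * (w y - w (hor d X)) +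
    (-(b * E * κ (X - pt y 0) * v (Fin.last d) : ℝ) +
      ((E * κ (X - pt y 0) * J y : ℝ) : ℂ) * Complex.I) * w y with hΦ
  have i1 : Integrable fun y => u y *
      (extKernelDiff κ B b X y v + Complex.I * (inner ℝ (B X) v : ℝ) * extKernel κ B b X y) := by
    have j1 := (ContinuousLinearMap.apply ℝ ℂ v).integrable_comp
      ((coneKernel_extKernelDiff hκ hB.contDiff b).integrable hui hX)
    have j2 := ((coneKernel_extKernel hκ hBc b).integrable hui hX).const_mul
      (Complex.I * (inner ℝ (B X) v : ℝ))
    refine (j1.add j2).congr (.of_forall fun y => ?_)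
    simp
    ring
  have i2 : Integrable fun y => ((D y : ℝ) : ℂ) :=
    (ContinuousLinearMap.apply ℝ ℂ v).integrable_comp (hκ.integrable_fderiv hX)
  have z2 : ∫ y, ((D y : ℝ) : ℂ) = 0 := by
    have := ContinuousLinearMap.integral_apply (hκ.integrable_fderiv hX) v
    rw [hκ.integral_fderiv hX] at this
    exact this.symm
  have e : dotC v (covField B (extend κ B b u) (extendGrad κ B b u) X) = ∫ y, Φ y := by
    rw [dotC_covField_extend hκ hB.contDiff b hui hX]
    -- `Φ` is the integrand minus a constant multiple of the derivative of the mollifier, whose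
    -- integral is zero.
    have : ∀ y, Φ y = u y *
      (extKernelDiff κ B b X y v + Complex.I * (inner ℝ (B X) v : ℝ) * extKernel κ B b X y) -
        (E * w (hor d X)) * ((D y : ℝ) : ℂ) := by
      intro y
      simp [hΦ, hw, hJ, hD, extKernelDiff, extKernel, ← ht, ← hE]
      ring
    simp only [this]
    rw [integral_sub i1 (i2.const_mul _), integral_const_mul, z2, mul_zero, sub_zero]
  rw [e]
  refine enorm_integral_le_cone hBc hu hX hM (by positivity)
    (fun y hy => by simp [hΦ, hD, hκ.apply_eq_zero hX hy, hκ.fderiv_eq_zero hX hy]) fun y hy => ?_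
  have hm := sub_pt_zero_mem hX y
  have h1 := hκ.abs_le _ hm
  have h2 := hκ.norm_fderiv_le _ hm
  simp only [PiLp.sub_apply, pt_last, sub_zero] at h1 h2
  rw [← ht] at h1 h2
  obtain ⟨x1, x2, x3⟩ := exp_bounds hb hX0.le hβ
  rw [← hE] at x1 x2 x3
  have h3 := hB.norm_phase_mul_sub_le hX hy u
  rw [← ht] at h3
  have h4 : |D y| ≤ M * t ^ (-(d : ℝ) - 1) := by
    have := (fderiv ℝ κ (X - pt y 0)).le_opNorm v
    rw [hv, mul_one] at this
    exact this.trans h2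
  have h5 : |J y| ≤ β * (2 * t) := by
    refine (hB.abs_potDiff_add_inner_le (halfSpace_subset_closedHalfSpace d hX)
      (pt_mem_closedHalfSpace.2 le_rfl) v).trans ?_
    rw [hv, mul_one]
    exact mul_le_mul_of_nonneg_left (norm_pt_sub_le hX hy) hB.nonneg
  have h6 : |v (Fin.last d)| ≤ 1 := (abs_last_le v).trans_eq hv
  have hwn : ‖w y‖ = ‖u y‖ := by rw [hw, norm_mul, norm_phase, one_mul]
  have hE0 : 0 < E := Real.exp_pos _
  have hp := Real.rpow_nonneg hX0.le (-(d : ℝ))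
  have hp1 := Real.rpow_nonneg hX0.le (-(d : ℝ) - 1)
  have hβ0 := hB.nonneg
  rw [← ht]
  calc ‖Φ y‖ ≤ E * |D y| * ‖w y - w (hor d X)‖ +
        (b * E * |κ (X - pt y 0)| * |v (Fin.last d)| + E * |κ (X - pt y 0)| * |J y|) * ‖w y‖ := by
        refine (norm_add_le _ _).trans (add_le_add ?_ ?_)
        · rw [norm_mul, Complex.norm_real, norm_mul, Real.norm_of_nonneg hE0.le, Real.norm_eq_abs]
        · rw [norm_mul]
          refine mul_le_mul_of_nonneg_right ((norm_add_le _ _).trans (add_le_add ?_ ?_)) (norm_nonneg _)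
          · rw [norm_neg, Complex.norm_real, Real.norm_eq_abs, abs_mul, abs_mul, abs_mul,
              abs_of_nonneg hb, abs_of_pos hE0]
          · rw [norm_mul, Complex.norm_real, Complex.norm_I, mul_one, Real.norm_eq_abs, abs_mul,
              abs_mul, abs_of_pos hE0]
    _ ≤ E * (M * t ^ (-(d : ℝ) - 1)) * (‖covDiff (parallel B) u (hor d X, y)‖ + 2 * β * t ^ 2 * ‖u y‖) +
        (b * E * (M * t ^ (-(d : ℝ))) * 1 + E * (M * t ^ (-(d : ℝ))) * (β * (2 * t))) * ‖u y‖ := by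
        rw [hwn]
        gcongr
    -- The phase comparison and the curl term each give `2 β t`. Their sum `4 β t E` is absorbed as
    -- `8 b`, and the derivative of the damping adds `b`, whence the constant `9`.
    _ = M * (E * t ^ (-(d : ℝ) - 1) * ‖covDiff (parallel B) u (hor d X, y)‖ +
        t ^ (-(d : ℝ)) * (4 * (β * t * E) + b * E) * ‖u y‖) := by
        rw [Real.rpow_sub_one hX0.ne']
        field_simp
        ring
    _ ≤ M * (1 * t ^ (-(d : ℝ) - 1) * ‖covDiff (parallel B) u (hor d X, y)‖ +
        t ^ (-(d : ℝ)) * (4 * (2 * b * Real.exp (-(b * t / 2))) + b * Real.exp (-(b * t / 2))) * ‖u y‖) := by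
        gcongr
    _ = _ := by ring

/-- Testing on the standard basis suffices; the dimensional factor is harmless. -/
theorem enorm_le_of_dotC {n : ℕ} {F : Cn n} {c : ℝ≥0∞}
    (h : ∀ v : Rn n, ‖v‖ = 1 → ‖dotC v F‖ₑ ≤ c) : ‖F‖ₑ ≤ n * c := by
  have h1 : ∀ j, ‖F j‖ₑ ≤ c := fun j => by
    have := h (EuclideanSpace.single j 1) (by simp)
    rwa [dotC_apply, Finset.sum_eq_single j (by simp +contextual) (by simp), PiLp.single_apply,
      if_pos rfl, Complex.ofReal_one, one_mul] at this
  have e : F = ∑ j, F j • EuclideanSpace.single j (1 : ℂ) := by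
    ext i
    simp [Finset.sum_apply, Pi.single_apply]
  calc ‖F‖ₑ = ‖∑ j, F j • EuclideanSpace.single j (1 : ℂ)‖ₑ := by rw [← e]
    _ ≤ ∑ j, ‖F j • EuclideanSpace.single j (1 : ℂ)‖ₑ := enorm_sum_le _ _
    _ ≤ ∑ _j : Fin n, c := Finset.sum_le_sum fun j _ => by
        have e1 : ‖EuclideanSpace.single j (1 : ℂ)‖ₑ = 1 := by
          rw [← ofReal_norm]
          simp
        rw [enorm_smul, e1, mul_one]
        exact h1 j
    _ = n * c := by simp

end Pointwise

/-! ### Energy of the extension -/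

section ConeEnergy

variable {d : ℕ} {γ q s b : ℝ}

/-- The volume of the unit ball. -/
def ballVol (d : ℕ) : ℝ≥0∞ := volume (Metric.ball (0 : Rn d) 1)

theorem ballVol_lt_top (d : ℕ) : ballVol d < ⊤ := measure_ball_lt_top

theorem volume_closedBall (x : Rn d) {t : ℝ} (ht : 0 ≤ t) :
    volume (Metric.closedBall x t) = wt d t * ballVol d := by
  rw [Measure.addHaar_closedBall _ _ ht, finrank_euclideanSpace, Fintype.card_fin, wt,
    Real.rpow_natCast, ballVol]

theorem rpow_setLIntegral_closedBall_le {f : Rn d → ℝ≥0∞} (hf : Measurable f) (hq : 1 ≤ q) (x : Rn d)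
    {t : ℝ} (ht : 0 ≤ t) : (∫⁻ y in Metric.closedBall x t, f y) ^ q ≤
      ballVol d ^ (q - 1) * wt (d * (q - 1)) t * ∫⁻ y in Metric.closedBall x t, f y ^ q := by
  refine (lintegral_rpow_le_measure_rpow_mul hf.aemeasurable hq).trans_eq ?_
  rw [Measure.restrict_apply_univ, volume_closedBall x ht, ENNReal.mul_rpow_of_nonneg _ _ (by linarith),
    wt, ENNReal.ofReal_rpow_of_nonneg (by positivity) (by linarith), ← Real.rpow_mul ht, wt,
    mul_comm (ENNReal.ofReal _)]

/-- The strip `‖y - x‖ ≤ t`. -/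
def strip (d : ℕ) (t : ℝ) : Set (Rn d × Rn d) := {z | ‖z.2 - z.1‖ ≤ t}

theorem measurableSet_strip (d : ℕ) (t : ℝ) : MeasurableSet (strip d t) :=
  (isClosed_le (by fun_prop) continuous_const).measurableSet

theorem lintegral_closedBall_eq_strip (f : Rn d × Rn d → ℝ≥0∞) (x : Rn d) (t : ℝ) :
    ∫⁻ y in Metric.closedBall x t, f (x, y) = ∫⁻ y, (strip d t).indicator f (x, y) := by
  rw [← lintegral_indicator Metric.isClosed_closedBall.measurableSet]
  refine lintegral_congr fun y => ?_
  have : y ∈ Metric.closedBall x t ↔ (x, y) ∈ strip d t := mem_closedBall_iff_norm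
  by_cases h : y ∈ Metric.closedBall x t
  · rw [indicator_of_mem h, indicator_of_mem (this.1 h)]
  · rw [indicator_of_notMem h, indicator_of_notMem (mt this.2 h)]

theorem measurable_cone_lintegral {f : Rn d × Rn d → ℝ≥0∞} (hf : Measurable f) :
    Measurable fun X : Rn (d + 1) =>
      ∫⁻ y in Metric.closedBall (hor d X) (X (Fin.last d)), f (hor d X, y) := by
  set S : Set (Rn (d + 1) × Rn d) := {z | ‖z.2 - hor d z.1‖ ≤ z.1 (Fin.last d)} with hS
  have hSm : MeasurableSet S := (isClosed_le (by fun_prop) (by fun_prop)).measurableSet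
  have h1 : Measurable (S.indicator fun z => f (hor d z.1, z.2)) :=
    Measurable.indicator (hf.comp (by fun_prop)) hSm
  have e : (fun X : Rn (d + 1) =>
      ∫⁻ y in Metric.closedBall (hor d X) (X (Fin.last d)), f (hor d X, y)) =
      fun X => ∫⁻ y, S.indicator (fun z => f (hor d z.1, z.2)) (X, y) := by
    funext X
    rw [lintegral_closedBall_eq_strip]
    rfl
  rw [e]
  exact h1.lintegral_prod_right' (ν := (volume : Measure (Rn d)))

/-- Jensen on the ball, whose volume is a multiple of `t^d`, followed by Tonelli, which collects the
balls over all `x` into the strip `|y - x| ≤ t`. -/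
theorem energy_cone_le {a : ℝ → ℝ≥0∞} (ha : Measurable a) {f : Rn d × Rn d → ℝ≥0∞}
    (hf : Measurable f) (hq : 1 ≤ q) :
    energy γ q (fun X : Rn (d + 1) => a (X (Fin.last d)) *
      ∫⁻ y in Metric.closedBall (hor d X) (X (Fin.last d)), f (hor d X, y)) ≤
    ballVol d ^ (q - 1) * ∫⁻ t in Ioi (0 : ℝ), wt γ t * a t ^ q * wt (d * (q - 1)) t *
      ∫⁻ z, (strip d t).indicator (fun z => f z ^ q) z := by
  have hq0 : 0 ≤ q := by linarith
  have hb : ballVol d ^ (q - 1) ≠ ⊤ :=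
    ENNReal.rpow_ne_top_of_nonneg (by linarith) (ballVol_lt_top d).ne
  have hm : Measurable fun X : Rn (d + 1) => a (X (Fin.last d)) *
      ∫⁻ y in Metric.closedBall (hor d X) (X (Fin.last d)), f (hor d X, y) :=
    (ha.comp (by fun_prop)).mul (measurable_cone_lintegral hf)
  rw [energy_eq_symm _ _ hm, ← lintegral_const_mul' _ _ hb]
  refine setLIntegral_mono' measurableSet_Ioi fun t (ht : 0 < t) => ?_
  have hfq : Measurable fun z => f z ^ q := hf.pow_const q
  have e : ∫⁻ z, (strip d t).indicator (fun z => f z ^ q) z =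
      ∫⁻ x, ∫⁻ y in Metric.closedBall x t, f (x, y) ^ q := by
    rw [Measure.volume_eq_prod, lintegral_prod _ (hfq.indicator (measurableSet_strip d t)).aemeasurable]
    exact lintegral_congr fun x => (lintegral_closedBall_eq_strip (fun z => f z ^ q) x t).symm
  have hm2 : Measurable fun x => ∫⁻ y in Metric.closedBall x t, f (x, y) ^ q := by
    have e' : (fun x => ∫⁻ y in Metric.closedBall x t, f (x, y) ^ q) =
        fun x => ∫⁻ y, (strip d t).indicator (fun z => f z ^ q) (x, y) :=
      funext fun x => lintegral_closedBall_eq_strip (fun z => f z ^ q) x t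
    rw [e']
    exact (hfq.indicator (measurableSet_strip d t)).lintegral_prod_right' (ν := (volume : Measure (Rn d)))
  rw [e]
  simp only [pt_last, hor_pt]
  calc wt γ t * ∫⁻ x, (a t * ∫⁻ y in Metric.closedBall x t, f (x, y)) ^ q
      ≤ wt γ t * ∫⁻ x, a t ^ q * (ballVol d ^ (q - 1) * wt (d * (q - 1)) t) *
          ∫⁻ y in Metric.closedBall x t, f (x, y) ^ q := by
        refine mul_le_mul' le_rfl (lintegral_mono fun x => ?_)
        rw [ENNReal.mul_rpow_of_nonneg _ _ hq0, mul_assoc]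
        exact mul_le_mul' le_rfl
          (rpow_setLIntegral_closedBall_le (hf.comp (by fun_prop)) hq x ht.le)
    _ = _ := by
        rw [lintegral_const_mul _ hm2]
        ring

theorem lintegral_strip_snd {g : Rn d → ℝ≥0∞} (hg : Measurable g) {t : ℝ} (ht : 0 ≤ t) :
    ∫⁻ z, (strip d t).indicator (fun z : Rn d × Rn d => g z.2) z = wt d t * ballVol d * ∫⁻ y, g y := by
  rw [Measure.volume_eq_prod, lintegral_prod_symm _ ((Measurable.indicator (by fun_prop)
    (measurableSet_strip d t)).aemeasurable), ← lintegral_const_mul _ hg]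
  refine lintegral_congr fun y => ?_
  have : ∀ x, (strip d t).indicator (fun z : Rn d × Rn d => g z.2) (x, y) =
      (Metric.closedBall y t).indicator (fun _ => g y) x := fun x => by
    have h : (x, y) ∈ strip d t ↔ x ∈ Metric.closedBall y t := by
      rw [mem_closedBall_iff_norm, norm_sub_rev]
      rfl
    by_cases hx : x ∈ Metric.closedBall y t
    · rw [indicator_of_mem hx, indicator_of_mem (h.2 hx)]
    · rw [indicator_of_notMem hx, indicator_of_notMem (mt h.1 hx)]
  simp only [this]
  rw [lintegral_indicator_const Metric.isClosed_closedBall.measurableSet, volume_closedBall y ht,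
    mul_comm]

/-- A moment of the exponential. -/
theorem lintegral_wt_mul_exp {a r : ℝ} (ha : 0 < a) (hr : 0 < r) :
    ∫⁻ t in Ioi (0 : ℝ), wt (a - 1) t * ENNReal.ofReal (Real.exp (-(r * t))) =
      ENNReal.ofReal ((1 / r) ^ a * Real.Gamma a) := by
  rw [← Real.integral_rpow_mul_exp_neg_mul_Ioi ha hr, ofReal_integral_eq_lintegral_ofReal]
  · refine setLIntegral_congr_fun measurableSet_Ioi fun t (ht : 0 < t) => ?_
    rw [wt, ← ENNReal.ofReal_mul (Real.rpow_nonneg ht.le _)]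
  -- Integrability is read off from the value: the integral of a nonintegrable function is `0` by
  -- convention, whereas this one is positive.
  · by_contra h
    have h1 := integral_undef h
    rw [Real.integral_rpow_mul_exp_neg_mul_Ioi ha hr] at h1
    have := Real.Gamma_pos_of_pos ha
    have : 0 < (1 / r) ^ a * Real.Gamma a := by positivity
    linarith
  · filter_upwards [ae_restrict_mem measurableSet_Ioi] with t (ht : 0 < t)
    have := Real.rpow_nonneg ht.le (a - 1)
    positivity

/-- The constant in the energy bound of `coneMean`. -/
def meanConst (d : ℕ) (s q : ℝ) : ℝ≥0∞ :=
  ballVol d ^ q * ENNReal.ofReal ((2 / q) ^ ((1 - s) * q) * Real.Gamma ((1 - s) * q))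

theorem meanConst_lt_top (d : ℕ) (s : ℝ) (hq : 1 ≤ q) : meanConst d s q < ⊤ :=
  ENNReal.mul_lt_top (ENNReal.rpow_lt_top_of_nonneg (by linarith) (ballVol_lt_top d).ne)
    ENNReal.ofReal_lt_top

/-- All the powers of `t` with `d` in the exponent cancel, leaving `∫ t^{(1-s)q-1} e^{-bqt/2} dt`, a
Gamma integral. It converges at `0` because `s < 1` and at infinity because of the damping, and it
scales as `b^{-(1-s)q}`. -/
theorem energy_coneMean_le {u : Rn d → ℂ} (hu : Measurable u) (hb : 0 < b) (hs1 : s < 1) (hq : 1 ≤ q) :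
    energy ((1 - s) * q - 1) q (coneMean b u) ≤
      meanConst d s q * wt (-((1 - s) * q)) b * ∫⁻ x, ‖u x‖ₑ ^ q := by
  have hq0 : 0 < q := by linarith
  have ha : 0 < (1 - s) * q := mul_pos (by linarith) hq0
  have h := energy_cone_le (d := d) (γ := (1 - s) * q - 1)
    (a := fun t => wt (-(d : ℝ)) t * ENNReal.ofReal (Real.exp (-(b * t / 2))))
    (by fun_prop) (f := fun z => ‖u z.2‖ₑ) (by fun_prop) hq
  refine h.trans_eq ?_
  have e : ∀ t ∈ Ioi (0 : ℝ), wt ((1 - s) * q - 1) t *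
      (wt (-(d : ℝ)) t * ENNReal.ofReal (Real.exp (-(b * t / 2)))) ^ q * wt (d * (q - 1)) t *
        ∫⁻ z, (strip d t).indicator (fun z : Rn d × Rn d => ‖u z.2‖ₑ ^ q) z =
      wt ((1 - s) * q - 1) t * ENNReal.ofReal (Real.exp (-(b * q / 2 * t))) *
        (ballVol d * ∫⁻ x, ‖u x‖ₑ ^ q) := by
    intro t (ht : 0 < t)
    rw [lintegral_strip_snd (g := fun y => ‖u y‖ₑ ^ q) (by fun_prop) ht.le,
      ENNReal.mul_rpow_of_nonneg _ _ hq0.le, wt_rpow _ hq0.le ht,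
      ENNReal.ofReal_rpow_of_nonneg (Real.exp_pos _).le hq0.le, ← Real.exp_mul]
    have e1 : wt (-(d : ℝ) * q) t * wt (d * (q - 1)) t * wt d t = 1 := by
      rw [wt_mul_wt _ _ ht, wt_mul_wt _ _ ht, ← wt_zero t]
      congr 1
      ring
    have e2 : -(b * t / 2) * q = -(b * q / 2 * t) := by ring
    rw [e2]
    calc _ = (wt (-(d : ℝ) * q) t * wt (d * (q - 1)) t * wt d t) * (wt ((1 - s) * q - 1) t *
          ENNReal.ofReal (Real.exp (-(b * q / 2 * t))) * (ballVol d * ∫⁻ x, ‖u x‖ₑ ^ q)) := by ring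
      _ = _ := by rw [e1, one_mul]
  rw [setLIntegral_congr_fun measurableSet_Ioi e, lintegral_mul_const _ (by fun_prop),
    lintegral_wt_mul_exp ha (by positivity)]
  have e3 : (1 / (b * q / 2)) ^ ((1 - s) * q) * Real.Gamma ((1 - s) * q) =
      (2 / q) ^ ((1 - s) * q) * Real.Gamma ((1 - s) * q) * b ^ (-((1 - s) * q)) := by
    have : 1 / (b * q / 2) = 2 / q * b⁻¹ := by field_simp
    rw [this, Real.mul_rpow (by positivity) (by positivity), Real.inv_rpow hb.le, Real.rpow_neg hb.le]
    ring
  have e4 : ballVol d ^ q = ballVol d ^ (q - 1) * ballVol d := by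
    conv_rhs => rw [← ENNReal.rpow_one (ballVol d), ← ENNReal.rpow_mul, mul_comm 1, mul_one]
    rw [← ENNReal.rpow_add_of_nonneg _ _ (by linarith) zero_le_one, sub_add_cancel]
  have := Real.Gamma_pos_of_pos ha
  rw [e3, ENNReal.ofReal_mul (by positivity), meanConst, e4, wt]
  ring

theorem setLIntegral_wt_Ioi {a r : ℝ} (ha : 0 < a) (hr : 0 < r) :
    ∫⁻ t in {t | 0 < t ∧ r ≤ t}, wt (-a - 1) t = ENNReal.ofReal (1 / a) * wt (-a) r := by
  have e : {t | 0 < t ∧ r ≤ t} = Ici r := by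
    ext t
    exact ⟨fun h => h.2, fun h => ⟨hr.trans_le h, h⟩⟩
  have hi := integrableOn_Ioi_rpow_of_lt (a := -a - 1) (by linarith) hr
  rw [e, ← restrict_Ioi_eq_restrict_Ici]
  simp only [wt]
  rw [← ofReal_integral_eq_lintegral_ofReal hi, integral_Ioi_rpow_of_lt (by linarith) hr,
    ← ENNReal.ofReal_mul (by positivity)]
  · congr 1
    rw [sub_add_cancel]
    field_simp
  · filter_upwards [ae_restrict_mem measurableSet_Ioi] with t (ht : r < t)
    exact Real.rpow_nonneg (hr.trans ht).le _

theorem covDiff_self {n : ℕ} (a : Rn n → Rn n) (u : Rn n → ℂ) (x : Rn n) : covDiff a u (x, x) = 0 := by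
  simp [covDiff, intPot_self]

/-- The powers of `t` combine to `t^{-(d+sq)-1}`. A pair `(x, y)` is seen exactly at the heights `t
≥ |y - x|`, and integrating over them reproduces the Gagliardo kernel. -/
theorem energy_coneDiff_le {B : Rn (d + 1) → Rn (d + 1)} (hB : Continuous B) {u : Rn d → ℂ}
    (hu : Measurable u) (hs : 0 < s) (hq : 1 ≤ q) :
    energy ((1 - s) * q - 1) q (coneDiff B u) ≤
      ballVol d ^ (q - 1) * ENNReal.ofReal (1 / (d + s * q)) *
        ∫⁻ z : Rn d × Rn d, ‖covDiff (parallel B) u z‖ₑ ^ q / ‖z.2 - z.1‖ₑ ^ (d + s * q) := by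
  have hq0 : 0 < q := by linarith
  have ha : 0 < d + s * q := by positivity
  have hm : Measurable (covDiff (parallel B) u) := measurable_covDiff (continuous_parallel hB) hu
  have h := energy_cone_le (d := d) (γ := (1 - s) * q - 1)
    (a := wt (-(d : ℝ) - 1)) (by fun_prop) (f := fun z => ‖covDiff (parallel B) u z‖ₑ) (by fun_prop) hq
  refine h.trans ?_
  rw [mul_assoc]
  refine mul_le_mul' le_rfl ?_
  have e : ∀ t ∈ Ioi (0 : ℝ), wt ((1 - s) * q - 1) t * wt (-(d : ℝ) - 1) t ^ q * wt (d * (q - 1)) t =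
      wt (-(d + s * q) - 1) t := by
    intro t (ht : 0 < t)
    rw [wt_rpow _ hq0.le ht, wt_mul_wt _ _ ht, wt_mul_wt _ _ ht]
    congr 1
    ring
  set S : Set ((Rn d × Rn d) × ℝ) := {p | 0 < p.2 ∧ ‖p.1.2 - p.1.1‖ ≤ p.2} with hS
  have hSm : MeasurableSet S := (measurableSet_lt measurable_const measurable_snd).inter
    (measurableSet_le (by fun_prop) measurable_snd)
  have hswap := lintegral_lintegral_indicator_swap (μ := (volume : Measure (Rn d × Rn d)))
    (w := fun z => ‖covDiff (parallel B) u z‖ₑ ^ q) (by fun_prop)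
    (g := wt (-(d + s * q) - 1)) (by fun_prop) hSm fun z hz => hz.1
  have e2 : ∫⁻ t in Ioi (0 : ℝ), wt ((1 - s) * q - 1) t * wt (-(d : ℝ) - 1) t ^ q * wt (d * (q - 1)) t *
      ∫⁻ z, (strip d t).indicator (fun z => ‖covDiff (parallel B) u z‖ₑ ^ q) z =
      ∫⁻ t in Ioi (0 : ℝ), wt (-(d + s * q) - 1) t *
        ∫⁻ z, {z | (z, t) ∈ S}.indicator (fun z => ‖covDiff (parallel B) u z‖ₑ ^ q) z := by
    refine setLIntegral_congr_fun measurableSet_Ioi fun t (ht : 0 < t) => ?_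
    have : {z | (z, t) ∈ S} = strip d t := by
      ext z
      exact ⟨fun h => h.2, fun h => ⟨ht, h⟩⟩
    simp only [e t ht, this]
  rw [e2, ← hswap, ← lintegral_const_mul' _ _ ENNReal.ofReal_ne_top]
  refine lintegral_mono fun z => ?_
  by_cases hz : z.2 - z.1 = 0
  · have : covDiff (parallel B) u z = 0 := by
      have hz' : z = (z.1, z.1) := Prod.ext rfl (sub_eq_zero.1 hz)
      rw [hz', covDiff_self]
    simp [this, hq0]
  · rw [div_enorm_rpow_eq hz]
    have := setLIntegral_wt_Ioi ha (norm_pos_iff.2 hz)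
    have e3 : {t | (z, t) ∈ S} = {t | 0 < t ∧ ‖z.2 - z.1‖ ≤ t} := rfl
    rw [e3, this]
    exact le_of_eq (by ring)

end ConeEnergy

/-! ### Energy estimate and trace of the extension -/

section ExtensionEnergy

variable {d : ℕ} {γ q : ℝ}

theorem energy_mono {f g : Rn (d + 1) → ℝ≥0∞} (hq : 0 ≤ q) (h : ∀ X ∈ halfSpace d, f X ≤ g X) :
    energy γ q f ≤ energy γ q g :=
  setLIntegral_mono' (measurableSet_halfSpace d) fun X hX =>
    mul_le_mul' le_rfl (ENNReal.rpow_le_rpow (h X hX) hq)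

theorem energy_congr {f g : Rn (d + 1) → ℝ≥0∞} (h : f =ᵐ[halfMeasure d] g) :
    energy γ q f = energy γ q g :=
  lintegral_congr_ae (by filter_upwards [h] with X hX; rw [hX])

theorem energy_const_mul {f : Rn (d + 1) → ℝ≥0∞} {c : ℝ≥0∞} (hc : c ≠ ⊤) (hq : 0 ≤ q) :
    energy γ q (fun X => c * f X) = c ^ q * energy γ q f := by
  rw [energy, energy, ← lintegral_const_mul' _ _ (ENNReal.rpow_ne_top_of_nonneg hq hc)]
  refine lintegral_congr fun X => ?_
  rw [ENNReal.mul_rpow_of_nonneg _ _ hq]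
  ring

theorem energy_add_le {f g : Rn (d + 1) → ℝ≥0∞} (hf : Measurable f) (hq : 1 ≤ q) :
    energy γ q (fun X => f X + g X) ≤ 2 ^ q * (energy γ q f + energy γ q g) := by
  have h2 : (2 : ℝ≥0∞) ^ q ≠ ⊤ := ENNReal.rpow_ne_top_of_nonneg (by linarith) (by simp)
  rw [energy, energy, energy, ← lintegral_add_left (by fun_prop), ← lintegral_const_mul' _ _ h2]
  refine lintegral_mono fun X => ?_
  refine (mul_le_mul' le_rfl (rpow_add_le hq _ _)).trans_eq ?_
  ring

variable {s b β M : ℝ} {B : Rn (d + 1) → Rn (d + 1)} {κ : Rn (d + 1) → ℝ} {u : Rn d → ℂ}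

theorem measurable_coneDiff (hB : Continuous B) (hu : Measurable u) : Measurable (coneDiff B u) := by
  unfold coneDiff
  exact (by fun_prop : Measurable fun X : Rn (d + 1) => wt (-(d : ℝ) - 1) (X (Fin.last d))).mul
    (measurable_cone_lintegral (measurable_covDiff (continuous_parallel hB) hu).enorm)

theorem measurable_coneMean (hu : Measurable u) : Measurable (coneMean b u) := by
  unfold coneMean
  exact (by fun_prop : Measurable fun X : Rn (d + 1) => wt (-(d : ℝ)) (X (Fin.last d)) *
    ENNReal.ofReal (Real.exp (-(b * X (Fin.last d) / 2)))).mul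
    (measurable_cone_lintegral (f := fun z => ‖u z.2‖ₑ) (by fun_prop))

theorem energy_extend_le (hκ : IsMollifier κ M) (hM : 0 ≤ M) (hB : Continuous B) (hu : Measurable u)
    (hb : 0 < b) (hs1 : s < 1) (hq : 1 ≤ q) :
    energy ((1 - s) * q - 1) q (fun X => ‖extend κ B b u X‖ₑ) ≤
      ENNReal.ofReal M ^ q * (meanConst d s q * wt (-((1 - s) * q)) b * ∫⁻ x, ‖u x‖ₑ ^ q) := by
  refine (energy_mono (by linarith) fun X hX => enorm_extend_le hκ hM hB hu hb.le hX).trans ?_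
  rw [energy_const_mul ENNReal.ofReal_ne_top (by linarith)]
  exact mul_le_mul' le_rfl (energy_coneMean_le hu hb hs1 hq)

theorem energy_covField_extend_le (hκ : IsMollifier κ M) (hM : 0 ≤ M) (hB : CurlBound B β)
    (hu : Measurable u) (hui : LocallyIntegrable u) (hb : 0 < b) (hβ : β ≤ b ^ 2) (hs : 0 < s)
    (hs1 : s < 1) (hq : 1 ≤ q) :
    energy ((1 - s) * q - 1) q (fun X => ‖covField B (extend κ B b u) (extendGrad κ B b u) X‖ₑ) ≤
      ((d + 1 : ℕ) : ℝ≥0∞) ^ q * (2 ^ q *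
        (ENNReal.ofReal M ^ q * (ballVol d ^ (q - 1) * ENNReal.ofReal (1 / (d + s * q)) *
          ∫⁻ z : Rn d × Rn d, ‖covDiff (parallel B) u z‖ₑ ^ q / ‖z.2 - z.1‖ₑ ^ (d + s * q)) +
        ENNReal.ofReal (9 * M) ^ q * meanConst d s q * (wt (s * q) b * ∫⁻ x, ‖u x‖ₑ ^ q))) := by
  have hq0 : 0 ≤ q := by linarith
  have h1 : energy ((1 - s) * q - 1) q
      (fun X => ‖covField B (extend κ B b u) (extendGrad κ B b u) X‖ₑ) ≤
      energy ((1 - s) * q - 1) q (fun X => ((d + 1 : ℕ) : ℝ≥0∞) * (ENNReal.ofReal M * coneDiff B u X +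
        ENNReal.ofReal (9 * b * M) * coneMean b u X)) :=
    energy_mono hq0 fun X hX => enorm_le_of_dotC fun v hv =>
      enorm_dotC_covField_extend_le hκ hM hB hu hui hb.le hβ hX hv
  refine h1.trans ?_
  rw [energy_const_mul (ENNReal.natCast_ne_top _) hq0]
  refine mul_le_mul' le_rfl ((energy_add_le
    ((measurable_coneDiff hB.contDiff.continuous hu).const_mul _) hq).trans ?_)
  rw [energy_const_mul ENNReal.ofReal_ne_top hq0, energy_const_mul ENNReal.ofReal_ne_top hq0]
  refine mul_le_mul' le_rfl (add_le_add
    (mul_le_mul' le_rfl (energy_coneDiff_le hB.contDiff.continuous hu hs hq)) ?_)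
  refine (mul_le_mul' le_rfl (energy_coneMean_le hu hb hs1 hq)).trans_eq ?_
  have e1 : ENNReal.ofReal (9 * b * M) ^ q = ENNReal.ofReal (9 * M) ^ q * wt q b := by
    have h9 : 0 ≤ 9 * M := by positivity
    rw [mul_right_comm, ENNReal.ofReal_mul h9, ENNReal.mul_rpow_of_nonneg _ _ hq0,
      ENNReal.ofReal_rpow_of_nonneg hb.le hq0, wt]
  -- The factor `b` in front of the mean contributes `b^q`, and its energy `b^{-(1-s)q}`.
  have e2 : wt (s * q) b = wt q b * wt (-((1 - s) * q)) b := by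
    rw [wt_mul_wt _ _ hb]
    congr 1
    ring
  rw [e1, e2]
  ring

/-- If the limit were nonzero, `Q(t)` would be at least `|c| / (2 M t)` near `0`, contradicting its
integrability since `1/t` is not integrable at `0`. -/
theorem eq_zero_of_tendsto_of_lintegral_lt_top {w : ℝ → ℂ} {c : ℂ} {Q : ℝ → ℝ≥0∞}
    (hM : 0 < M) (hw : Filter.Tendsto w aeRight (nhds c))
    (h : ∀ᵐ t ∂halfLine, ‖w t‖ₑ ≤ ENNReal.ofReal (M * t) * Q t) (hQ : ∫⁻ t in Ioc 0 1, Q t < ⊤) :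
    c = 0 := by
  by_contra hc
  set δ := ‖c‖ / 2 with hδ
  have hc0 : 0 < ‖c‖ := norm_pos_iff.2 hc
  have hev : ∀ᶠ t in aeRight, δ < ‖w t‖ :=
    hw.norm.eventually (lt_mem_nhds (by rw [hδ]; linarith))
  obtain ⟨S, hS, T, hT, hST⟩ := Filter.mem_inf_iff.1 hev
  obtain ⟨ε, hε, hεS⟩ := mem_nhdsGT_iff_exists_Ioo_subset.1 hS
  have hε0 : 0 < ε := hε
  set r := min (ε / 2) 1 with hr
  have hr0 : 0 < r := by positivity
  have hsub : Ioc 0 r ⊆ Ioc 0 1 := Ioc_subset_Ioc_right (min_le_right _ _)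
  have hae : ∀ᵐ t ∂volume.restrict (Ioc 0 r), ENNReal.ofReal (δ / M * t⁻¹) ≤ Q t := by
    have h1 : ∀ᵐ t ∂halfLine, t ∈ T := hT
    filter_upwards [ae_restrict_of_ae_restrict_of_subset Ioc_subset_Ioi_self (h.and h1),
      ae_restrict_mem measurableSet_Ioc] with t ht htr
    have htS : t ∈ S := hεS ⟨htr.1, by
      have := htr.2.trans (min_le_left _ _)
      linarith⟩
    have h2 : t ∈ {t | δ < ‖w t‖} := by
      rw [hST]
      exact ⟨htS, ht.2⟩
    have h3 : ENNReal.ofReal δ ≤ ENNReal.ofReal (M * t) * Q t := by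
      refine (ENNReal.ofReal_le_ofReal (le_of_lt h2)).trans ?_
      rw [ofReal_norm]
      exact ht.1
    have hMt : 0 < M * t := mul_pos hM htr.1
    have e : δ / M * t⁻¹ = (M * t)⁻¹ * δ := by
      field_simp
    rw [e, ENNReal.ofReal_mul (by positivity), ENNReal.ofReal_inv_of_pos hMt]
    rw [ENNReal.inv_mul_le_iff (by simpa using hMt) ENNReal.ofReal_ne_top]
    exact h3
  have hfin : ∫⁻ t in Ioc 0 r, ENNReal.ofReal (δ / M * t⁻¹) < ⊤ :=
    (lintegral_mono_ae hae).trans_lt ((lintegral_mono_set hsub).trans_lt hQ)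
  have hint : IntegrableOn (fun t : ℝ => δ / M * t⁻¹) (Ioc 0 r) := by
    refine ⟨Measurable.aestronglyMeasurable (by fun_prop), ?_⟩
    rw [hasFiniteIntegral_iff_ofReal]
    · exact hfin
    · filter_upwards [ae_restrict_mem measurableSet_Ioc] with t ht
      have := ht.1
      positivity
  have hint2 : IntervalIntegrable (fun t : ℝ => t⁻¹) volume 0 r := by
    rw [intervalIntegrable_iff_integrableOn_Ioc_of_le hr0.le]
    have := hint.const_mul (δ / M)⁻¹
    refine this.congr (.of_forall fun t => ?_)
    have : δ / M ≠ 0 := by positivity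
    simp only
    rw [inv_mul_cancel_left₀ this]
  rw [intervalIntegrable_inv_iff] at hint2
  rcases hint2 with h0 | h0
  · exact hr0.ne h0
  · exact h0 left_mem_uIcc

theorem energy_coneDiff_add_lt_top (hB : CurlBound B β) (hs : 0 < s) (hs1 : s < 1) (hq : 1 ≤ q)
    (hu : Measurable u) (hb : 0 < b) (hu1 : ∫⁻ x, ‖u x‖ₑ ^ q < ⊤)
    (hu2 : ∫⁻ z : Rn d × Rn d, ‖covDiff (parallel B) u z‖ₑ ^ q / ‖z.2 - z.1‖ₑ ^ (d + s * q) < ⊤) :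
    energy ((1 - s) * q - 1) q
      (fun X => coneDiff B u X + ENNReal.ofReal (4 * b) * coneMean b u X) < ⊤ := by
  have hBc := hB.contDiff.continuous
  have hq0 : 0 ≤ q := by linarith
  have h1 : energy ((1 - s) * q - 1) q (coneDiff B u) < ⊤ := by
    refine (energy_coneDiff_le hBc hu hs hq).trans_lt ?_
    refine ENNReal.mul_lt_top (ENNReal.mul_lt_top ?_ ENNReal.ofReal_lt_top) hu2
    exact ENNReal.rpow_lt_top_of_nonneg (by linarith) (ballVol_lt_top d).ne
  have h2 : energy ((1 - s) * q - 1) q (coneMean b u) < ⊤ := by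
    refine (energy_coneMean_le hu hb hs1 hq).trans_lt ?_
    exact ENNReal.mul_lt_top (ENNReal.mul_lt_top (meanConst_lt_top d s hq) (wt_ne_top _ _).lt_top) hu1
  refine (energy_add_le (measurable_coneDiff hBc hu) hq).trans_lt ?_
  rw [energy_const_mul ENNReal.ofReal_ne_top hq0]
  exact ENNReal.mul_lt_top (ENNReal.rpow_lt_top_of_nonneg hq0 (by simp)) (ENNReal.add_lt_top.2
    ⟨h1, ENNReal.mul_lt_top (ENNReal.rpow_lt_top_of_nonneg hq0 ENNReal.ofReal_ne_top) h2⟩)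

theorem tendsto_exp_mul_phase (hB : Continuous B) (b : ℝ) (u : Rn d → ℂ) (x : Rn d) :
    Filter.Tendsto (fun t : ℝ => ((Real.exp (-(b * t)) : ℝ) : ℂ) * (phase B (pt x t) (pt x 0) * u x))
      aeRight (nhds (u x)) := by
  have h1 : Continuous fun t : ℝ => ((pt x t, pt x 0) : Rn (d + 1) × Rn (d + 1)) :=
    (continuous_pt_comp continuous_const continuous_id).prodMk continuous_const
  have h2 : Continuous fun t : ℝ => phase B (pt x t) (pt x 0) := by
    have := (continuous_phase hB).comp h1
    exact this
  have h3 : Continuous fun t : ℝ => ((Real.exp (-(b * t)) : ℝ) : ℂ) :=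
    Complex.continuous_ofReal.comp (by fun_prop)
  have h4 := (h3.mul (h2.mul continuous_const)).tendsto (0 : ℝ) (f := fun t : ℝ =>
    ((Real.exp (-(b * t)) : ℝ) : ℂ) * (phase B (pt x t) (pt x 0) * u x))
  have h0 : ((Real.exp (-(b * 0)) : ℝ) : ℂ) * (phase B (pt x 0) (pt x 0) * u x) = u x := by
    simp [phase, intPot_self]
  simp only [h0] at h4
  exact h4.mono_left (inf_le_left.trans nhdsWithin_le_nhds)

/-- The boundary trace of the extension of `u` is `u`. -/
theorem HasWeakGradient.boundaryTrace_extend {U : Rn (d + 1) → ℂ} {G : Rn (d + 1) → Cn (d + 1)}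
    (h : HasWeakGradient U G) (hU : Measurable U) (hG : Measurable G)
    (hκ : IsMollifier κ M) (hM : 0 < M) (hB : CurlBound B β) (hs : 0 < s) (hs1 : s < 1) (hq : 1 ≤ q)
    (eU : energy ((1 - s) * q - 1) q (fun X => ‖U X‖ₑ) < ⊤)
    (eF : energy ((1 - s) * q - 1) q (fun X => ‖covField B U G X‖ₑ) < ⊤)
    (hu : Measurable u) (hui : LocallyIntegrable u) (hb : 0 < b) (hβ : β ≤ b ^ 2)
    (hu1 : ∫⁻ x, ‖u x‖ₑ ^ q < ⊤)
    (hu2 : ∫⁻ z : Rn d × Rn d, ‖covDiff (parallel B) u z‖ₑ ^ q / ‖z.2 - z.1‖ₑ ^ (d + s * q) < ⊤)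
    (hUu : U =ᵐ[halfMeasure d] extend κ B b u) : boundaryTrace U G =ᵐ[volume] u := by
  have hBc := hB.contDiff.continuous
  have hq0 : 0 ≤ q := by linarith
  have hQm : Measurable fun X => coneDiff B u X + ENNReal.ofReal (4 * b) * coneMean b u X :=
    (measurable_coneDiff hBc hu).add ((measurable_coneMean hu).const_mul _)
  have hQ := energy_coneDiff_add_lt_top (β := β) hB hs hs1 hq hu hb hu1 hu2
  have hUu' := hUu
  rw [Filter.EventuallyEq, ae_half_iff] at hUu'
  filter_upwards [h.ae_tendsto_boundaryTrace hU hG hBc hs hq eU eF, Measure.ae_ae_of_ae_prod hUu',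
    ae_setLIntegral_line_lt_top hQm hs hq hQ] with x h1 h2 h3
  have h4 := tendsto_exp_mul_phase hBc b u x
  rw [← sub_eq_zero]
  -- The difference of `U` and the damped transported value of `u` has the limit `boundaryTrace U G
  -- x - u x`, and the mollifier estimate bounds it by `M t` times a function integrable on almost
  -- every line.
  refine eq_zero_of_tendsto_of_lintegral_lt_top hM (h1.sub h4) ?_ (h3 1 one_pos)
  filter_upwards [h2, ae_restrict_mem measurableSet_Ioi] with t ht (ht0 : 0 < t)
  have := enorm_extend_sub_le hκ hM.le hB hu hui hb.le hβ (pt_mem_halfSpace.2 ht0 : pt x t ∈ halfSpace d)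
  simp only [pt_last, hor_pt] at this
  rw [ht]
  exact this

end ExtensionEnergy

/-! ### The trace estimate -/

section TraceEstimate

variable {d : ℕ} {s q β : ℝ}

theorem ofReal_rpow_half {β : ℝ} (hβ : 0 ≤ β) {r : ℝ} (hr : 0 ≤ r) :
    ENNReal.ofReal β ^ (r / 2) = wt r (√β) := by
  rw [wt, ENNReal.ofReal_rpow_of_nonneg hβ (by positivity), Real.sqrt_eq_rpow, ← Real.rpow_mul hβ]
  congr 2
  ring

theorem wt_inv (a : ℝ) {b : ℝ} (hb : 0 ≤ b) : wt a b⁻¹ = wt (-a) b := by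
  rw [wt, wt, Real.inv_rpow hb, Real.rpow_neg hb]

/-- The constant in the `L^q` bound of the trace. -/
def traceLpConst (s q : ℝ) : ℝ≥0∞ :=
  ENNReal.ofReal ((1 - s) * q) * 2 ^ q *
    (1 + ENNReal.ofReal (1 / ((1 - s) * q)) * ENNReal.ofReal (1 / s) ^ (q - 1))

/-- The constant in the trace estimate. -/
def traceConst (d : ℕ) (s q : ℝ) : ℝ≥0∞ :=
  8 ^ q * ((2 * (ENNReal.ofReal (1 / s) ^ (q - 1) * wt (s * (q - 1)) 2) + 1) * tailConst d s +
    phaseConst d s q * traceLpConst s q) + traceLpConst s q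

theorem traceLpConst_lt_top (hq : 1 ≤ q) : traceLpConst s q < ⊤ := by
  have h1 : ENNReal.ofReal (1 / s) ^ (q - 1) < ⊤ :=
    ENNReal.rpow_lt_top_of_nonneg (by linarith) ENNReal.ofReal_ne_top
  have h2 : (2 : ℝ≥0∞) ^ q < ⊤ := ENNReal.rpow_lt_top_of_nonneg (by linarith) (by simp)
  exact ENNReal.mul_lt_top (ENNReal.mul_lt_top ENNReal.ofReal_lt_top h2)
    (ENNReal.add_lt_top.2 ⟨ENNReal.one_lt_top, ENNReal.mul_lt_top ENNReal.ofReal_lt_top h1⟩)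

theorem traceConst_lt_top (hd : 1 ≤ d) (hs : 0 < s) (hs1 : s < 1) (hq : 1 ≤ q) :
    traceConst d s q < ⊤ := by
  have h1 : ENNReal.ofReal (1 / s) ^ (q - 1) < ⊤ :=
    ENNReal.rpow_lt_top_of_nonneg (by linarith) ENNReal.ofReal_ne_top
  have h2 : (8 : ℝ≥0∞) ^ q < ⊤ := ENNReal.rpow_lt_top_of_nonneg (by linarith) (by simp)
  have h3 := traceLpConst_lt_top (s := s) hq
  refine ENNReal.add_lt_top.2 ⟨ENNReal.mul_lt_top h2 (ENNReal.add_lt_top.2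
    ⟨ENNReal.mul_lt_top (ENNReal.add_lt_top.2 ⟨ENNReal.mul_lt_top (by simp)
      (ENNReal.mul_lt_top h1 (wt_ne_top _ _).lt_top), ENNReal.one_lt_top⟩) (tailConst_lt_top d hs),
      ENNReal.mul_lt_top (phaseConst_lt_top hd hs hs1 hq) h3⟩), h3⟩

variable {U : Rn (d + 1) → ℂ} {G : Rn (d + 1) → Cn (d + 1)} {B : Rn (d + 1) → Rn (d + 1)}

/-- The estimate at scale `T` is used with `T = β^{-1/2}`, which balances its two terms. For `β = 0`
the left side vanishes because the exponent is positive. -/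
theorem HasWeakGradient.rpow_mul_lintegral_boundaryTrace_le (h : HasWeakGradient U G)
    (hU : Measurable U) (hG : Measurable G) (hB : Continuous B) (hs : 0 < s) (hs1 : s < 1)
    (hq : 1 ≤ q) (hβ : 0 ≤ β)
    (eU : energy ((1 - s) * q - 1) q (fun X => ‖U X‖ₑ) < ⊤)
    (eF : energy ((1 - s) * q - 1) q (fun X => ‖covField B U G X‖ₑ) < ⊤) :
    ENNReal.ofReal β ^ (s * q / 2) * ∫⁻ x, ‖boundaryTrace U G x‖ₑ ^ q ≤
      traceLpConst s q * (energy ((1 - s) * q - 1) q (fun X => ‖covField B U G X‖ₑ) +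
        ENNReal.ofReal β ^ (q / 2) * energy ((1 - s) * q - 1) q (fun X => ‖U X‖ₑ)) := by
  have hq0 : 0 < q := by linarith
  rcases hβ.eq_or_lt with rfl | hβ0
  · have : 0 < s * q / 2 := by positivity
    simp [ENNReal.zero_rpow_of_pos this]
  have hb : 0 < √β := Real.sqrt_pos.2 hβ0
  have hT := h.lintegral_boundaryTrace_le hU hG hB hs hs1 hq eU eF (inv_pos.2 hb)
  rw [ofReal_rpow_half hβ (by positivity), ofReal_rpow_half hβ hq0.le]
  rw [wt_inv _ hb.le, wt_inv _ hb.le] at hT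
  set b := √β
  obtain ⟨N, hN⟩ : ∃ N, N = ∫⁻ x, ‖boundaryTrace U G x‖ₑ ^ q := ⟨_, rfl⟩
  obtain ⟨e1, he1⟩ : ∃ N, N = energy ((1 - s) * q - 1) q (fun X => ‖U X‖ₑ) := ⟨_, rfl⟩
  obtain ⟨e2, he2⟩ : ∃ N, N = energy ((1 - s) * q - 1) q (fun X => ‖covField B U G X‖ₑ) := ⟨_, rfl⟩
  rw [← hN, ← he1, ← he2] at hT ⊢
  have k1 : wt (s * q) b = wt q b * wt (-((1 - s) * q)) b := by
    rw [wt_mul_wt _ _ hb]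
    congr 1
    ring
  have k2 := wt_mul_wt_neg q hb
  rw [k1, mul_assoc]
  refine (mul_le_mul' le_rfl hT).trans ?_
  obtain ⟨c1, hc1⟩ : ∃ c, c = ENNReal.ofReal ((1 - s) * q) * 2 ^ q := ⟨_, rfl⟩
  obtain ⟨c2, hc2⟩ : ∃ c, c = ENNReal.ofReal (1 / ((1 - s) * q)) * ENNReal.ofReal (1 / s) ^ (q - 1) :=
    ⟨_, rfl⟩
  rw [traceLpConst, ← hc1, ← hc2]
  calc wt q b * (c1 * (e1 + c2 * wt (-q) b * e2))
      = c1 * (wt q b * e1 + c2 * (wt q b * wt (-q) b) * e2) := by ring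
    _ = c1 * (1 * (wt q b * e1) + c2 * e2) := by rw [k2, mul_one, one_mul]
    _ ≤ c1 * ((1 + c2) * (wt q b * e1) + (1 + c2) * e2) := by
        gcongr
        · exact le_self_add
        · exact le_add_self
    _ = _ := by ring

/-- The trace estimate. -/
theorem HasWeakGradient.trace_estimate (h : HasWeakGradient U G)
    (hU : Measurable U) (hG : Measurable G) (hB : CurlBound B β) (hs : 0 < s) (hs1 : s < 1)
    (hq : 1 ≤ q) (eU : energy ((1 - s) * q - 1) q (fun X => ‖U X‖ₑ) < ⊤)
    (eF : energy ((1 - s) * q - 1) q (fun X => ‖covField B U G X‖ₑ) < ⊤) :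
    (∫⁻ z : Rn d × Rn d, ‖covDiff (parallel B) (boundaryTrace U G) z‖ₑ ^ q /
        ‖z.2 - z.1‖ₑ ^ (d + s * q)) +
      ENNReal.ofReal β ^ (s * q / 2) * ∫⁻ x, ‖boundaryTrace U G x‖ₑ ^ q ≤
      traceConst d s q * (energy ((1 - s) * q - 1) q (fun X => ‖covField B U G X‖ₑ) +
        ENNReal.ofReal β ^ (q / 2) * energy ((1 - s) * q - 1) q (fun X => ‖U X‖ₑ)) := by
  have h1 := h.lintegral_covDiff_div_le hU hG hB hs hs1 hq eU eF
  have h2 := h.rpow_mul_lintegral_boundaryTrace_le hU hG hB.contDiff.continuous hs hs1 hq hB.nonneg eU eF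
  rw [mul_assoc (phaseConst d s q)] at h1
  rw [traceConst, add_mul]
  refine add_le_add (h1.trans ?_) h2
  calc _ ≤ 8 ^ q * ((2 * (ENNReal.ofReal (1 / s) ^ (q - 1) * wt (s * (q - 1)) 2) + 1) *
          tailConst d s * (energy ((1 - s) * q - 1) q (fun X => ‖covField B U G X‖ₑ) +
            ENNReal.ofReal β ^ (q / 2) * energy ((1 - s) * q - 1) q (fun X => ‖U X‖ₑ)) +
        phaseConst d s q * (traceLpConst s q *
          (energy ((1 - s) * q - 1) q (fun X => ‖covField B U G X‖ₑ) +
            ENNReal.ofReal β ^ (q / 2) * energy ((1 - s) * q - 1) q (fun X => ‖U X‖ₑ)))) :=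
        mul_le_mul' le_rfl (add_le_add (mul_le_mul' le_rfl le_self_add) (mul_le_mul' le_rfl h2))
    _ = _ := by ring

end TraceEstimate

/-! ### Membership in the Sobolev spaces -/

section Membership

variable {d : ℕ} {A B : Rn (d + 1) → Rn (d + 1)} {γ s : ℝ} {p : ℝ≥0∞}

theorem one_le_toReal_of_fact [hp1 : Fact (1 ≤ p)] (hp : p ≠ ⊤) : 1 ≤ p.toReal := by
  have := ENNReal.toReal_mono hp hp1.out
  simpa using this

theorem memLp_iff_lintegral_lt_top [hp1 : Fact (1 ≤ p)] (hp : p ≠ ⊤) {α E : Type*}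
    [MeasurableSpace α] {μ : Measure α} [NormedAddCommGroup E] {f : α → E}
    (hf : AEStronglyMeasurable f μ) : MemLp f p μ ↔ ∫⁻ x, ‖f x‖ₑ ^ p.toReal ∂μ < ⊤ := by
  have hp0 : p ≠ 0 := (zero_lt_one.trans_le hp1.out).ne'
  rw [← eLpNorm_lt_top_iff_lintegral_rpow_enorm_lt_top hp0 hp]
  exact ⟨fun h => h.eLpNorm_lt_top, fun h => ⟨hf, h⟩⟩

theorem lintegral_weightedMeasure (γ q : ℝ) (f : Rn (d + 1) → ℝ≥0∞) :
    ∫⁻ X, f X ^ q ∂weightedMeasure d γ = energy γ q f := by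
  rw [weightedMeasure, lintegral_withDensity_eq_lintegral_mul_non_measurable₀ _
    (measurable_weight d γ).aemeasurable (by simp)]
  rfl

theorem memLp_weightedMeasure_iff [Fact (1 ≤ p)] (hp : p ≠ ⊤) {E : Type*} [NormedAddCommGroup E]
    {f : Rn (d + 1) → E} (hf : AEStronglyMeasurable f (halfMeasure d)) :
    MemLp f p (weightedMeasure d γ) ↔ energy γ p.toReal (fun X => ‖f X‖ₑ) < ⊤ := by
  rw [memLp_iff_lintegral_lt_top hp (hf.mono_ac (weightedMeasure_ac d γ)), lintegral_weightedMeasure]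

theorem lintegral_gagliardoMeasure {n : ℕ} {a : Rn n → Rn n} (ha : Continuous a) (s : ℝ) (p : ℝ≥0∞)
    {u : Rn n → ℂ} (hu : Measurable u) :
    ∫⁻ z, ‖covDiff a u z‖ₑ ^ p.toReal ∂gagliardoMeasure n s p = gagliardo a s p u := by
  have hm := measurable_covDiff ha hu
  rw [gagliardoMeasure, lintegral_withDensity_eq_lintegral_mul _ (by fun_prop) (by fun_prop), gagliardo]
  simp only [Pi.mul_apply, mul_comm, div_eq_mul_inv]

theorem gagliardo_congr {n : ℕ} (a : Rn n → Rn n) (s : ℝ) (p : ℝ≥0∞) {u v : Rn n → ℂ}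
    (h : u =ᵐ[volume] v) : gagliardo a s p u = gagliardo a s p v := by
  have h1 := (Measure.quasiMeasurePreserving_fst (μ := (volume : Measure (Rn n)))
    (ν := (volume : Measure (Rn n)))).ae_eq_comp h
  have h2 := (Measure.quasiMeasurePreserving_snd (μ := (volume : Measure (Rn n)))
    (ν := (volume : Measure (Rn n)))).ae_eq_comp h
  refine lintegral_congr_ae ?_
  filter_upwards [h1, h2] with z e1 e2
  simp only [Function.comp_apply] at e1 e2
  simp only [covDiff, e1, e2]

theorem mem_fracMagneticSobolev [Fact (1 ≤ p)] (hp : p ≠ ⊤) {n : ℕ} {a : Rn n → Rn n}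
    (ha : Continuous a) {u : Rn n →ₘ[volume] ℂ} (h1 : ∫⁻ x, ‖u x‖ₑ ^ p.toReal < ⊤)
    (h2 : gagliardo a s p u < ⊤) : u ∈ fracMagneticSobolev a s p := by
  refine ⟨(memLp_iff_lintegral_lt_top hp u.aestronglyMeasurable).2 h1, ?_⟩
  rw [memLp_iff_lintegral_lt_top hp (measurable_covDiff ha u.measurable).aestronglyMeasurable,
    lintegral_gagliardoMeasure ha s p u.measurable]
  exact h2

theorem fracMagneticSobolev_lt_top [Fact (1 ≤ p)] (hp : p ≠ ⊤) {n : ℕ} {a : Rn n → Rn n}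
    (u : fracMagneticSobolev a s p) :
    ∫⁻ x, ‖u.1 x‖ₑ ^ p.toReal < ⊤ ∧ gagliardo a s p u.1 < ⊤ := by
  have h := fracMagneticSobolev_enorm_rpow a s p hp u
  have h1 : ‖u‖ₑ ^ p.toReal < ⊤ := ENNReal.rpow_lt_top_of_nonneg (by simp) enorm_ne_top
  rw [h] at h1
  exact ENNReal.add_lt_top.1 h1

theorem HasWeakGradient.congr_grad {U : Rn (d + 1) → ℂ} {G H : Rn (d + 1) → Cn (d + 1)}
    (hU : HasWeakGradient U G) (h : G =ᵐ[halfMeasure d] H) : HasWeakGradient U H where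
  locInt := hU.locInt
  locInt_grad := by
    rw [locallyIntegrableOn_iff (isOpen_halfSpace d).isLocallyClosed]
    intro K hK hc
    exact (hU.locInt_grad.integrableOn_compact_subset hK hc).congr
      (ae_mono (Measure.restrict_mono hK le_rfl) h)
  integral_eq φ hφ hc hs j := by
    rw [hU.integral_eq φ hφ hc hs j]
    congr 1
    refine integral_congr_ae ?_
    filter_upwards [h] with X hX
    rw [hX]

theorem covGradient_ae_eq (hAB : EqOn B A (closedHalfSpace d)) {U V : Rn (d + 1) → ℂ}
    {G : Rn (d + 1) → Cn (d + 1)} (hUV : V =ᵐ[halfMeasure d] U)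
    (hG : weakGradient V =ᵐ[halfMeasure d] G) :
    covGradient A V =ᵐ[halfMeasure d] covField B U G := by
  filter_upwards [hUV, hG, ae_restrict_mem (measurableSet_halfSpace d)] with X h1 h2 h3
  rw [covGradient, covField, h1, h2, hAB (halfSpace_subset_closedHalfSpace d h3)]

theorem mem_magneticSobolev [Fact (1 ≤ p)] (hp : p ≠ ⊤) (hAB : EqOn B A (closedHalfSpace d))
    (hB : Continuous B) {U : Rn (d + 1) → ℂ} {G : Rn (d + 1) → Cn (d + 1)}
    (h : HasWeakGradient U G) {V : Rn (d + 1) →ₘ[halfMeasure d] ℂ} (hUV : U =ᵐ[halfMeasure d] V)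
    (eU : energy γ p.toReal (fun X => ‖U X‖ₑ) < ⊤)
    (eF : energy γ p.toReal (fun X => ‖covField B U G X‖ₑ) < ⊤) : V ∈ magneticSobolev A γ p := by
  have h1 := covGradient_ae_eq hAB hUV.symm (h.weakGradient_ae hUV)
  have mU : AEStronglyMeasurable U (halfMeasure d) := V.aestronglyMeasurable.congr hUV.symm
  have mG : AEStronglyMeasurable G (halfMeasure d) := h.locInt_grad.aestronglyMeasurable
  have mF : AEStronglyMeasurable (covField B U G) (halfMeasure d) := by
    refine AEStronglyMeasurable.congr (f := covField B (mU.mk U) (mG.mk G))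
      (measurable_covField hB.measurable mU.stronglyMeasurable_mk.measurable
        mG.stronglyMeasurable_mk.measurable).aestronglyMeasurable ?_
    filter_upwards [mU.ae_eq_mk, mG.ae_eq_mk] with X e1 e2
    rw [covField, covField, e1, e2]
  refine ⟨⟨G, h.congr hUV⟩, ?_, ?_⟩
  · exact ((memLp_weightedMeasure_iff hp mU).2 eU).ae_eq ((weightedMeasure_ac d γ).ae_le hUV)
  · exact ((memLp_weightedMeasure_iff hp mF).2 eF).ae_eq ((weightedMeasure_ac d γ).ae_le h1.symm)

/-- Functions of the magnetic Sobolev space have a measurable weak gradient and finite energies. -/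
theorem magneticSobolev_exists_gradient [Fact (1 ≤ p)] (hp : p ≠ ⊤)
    (hAB : EqOn B A (closedHalfSpace d)) (V : magneticSobolev A γ p) :
    ∃ G : Rn (d + 1) → Cn (d + 1), Measurable G ∧ HasWeakGradient V.1 G ∧
      weakGradient V.1 =ᵐ[halfMeasure d] G ∧
      covGradient A V.1 =ᵐ[halfMeasure d] covField B V.1 G ∧
      energy γ p.toReal (fun X => ‖V.1 X‖ₑ) < ⊤ ∧
      energy γ p.toReal (fun X => ‖covField B V.1 G X‖ₑ) < ⊤ := by
  obtain ⟨hG, h1, h2⟩ := V.2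
  have hw := hasWeakGradient_weakGradient hG
  have mG : AEStronglyMeasurable (weakGradient V.1) (halfMeasure d) := hw.locInt_grad.aestronglyMeasurable
  have hc := covGradient_ae_eq hAB Filter.EventuallyEq.rfl mG.ae_eq_mk
  refine ⟨mG.mk _, mG.stronglyMeasurable_mk.measurable, hw.congr_grad mG.ae_eq_mk, mG.ae_eq_mk, hc,
    (memLp_weightedMeasure_iff hp V.1.aestronglyMeasurable).1 h1, ?_⟩
  have h3 := (memLp_iff_lintegral_lt_top hp h2.aestronglyMeasurable).1 h2
  rw [lintegral_weightedMeasure γ p.toReal (fun X => ‖covGradient A V.1 X‖ₑ)] at h3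
  rwa [energy_congr (g := fun X => ‖covGradient A V.1 X‖ₑ)]
  filter_upwards [hc] with X hX
  rw [hX]

theorem norm_le_of_enorm_rpow_le {E F : Type*} [NormedAddCommGroup E] [NormedAddCommGroup F]
    {x : E} {y : F} {K : ℝ≥0∞} (hK : K ≠ ⊤) {q : ℝ} (hq : 0 < q) (h : ‖y‖ₑ ^ q ≤ K * ‖x‖ₑ ^ q) :
    ‖y‖ ≤ (K ^ (1 / q)).toReal * ‖x‖ := by
  have h1 : ‖y‖ₑ ≤ K ^ (1 / q) * ‖x‖ₑ := by
    have := ENNReal.rpow_le_rpow h (by positivity : 0 ≤ 1 / q)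
    rwa [ENNReal.mul_rpow_of_nonneg _ _ (by positivity), ← ENNReal.rpow_mul, ← ENNReal.rpow_mul,
      mul_one_div_cancel hq.ne', ENNReal.rpow_one, ENNReal.rpow_one] at this
  have hK' : K ^ (1 / q) ≠ ⊤ := ENNReal.rpow_ne_top_of_nonneg (by positivity) hK
  have h2 := ENNReal.toReal_mono (ENNReal.mul_ne_top hK' enorm_ne_top) h1
  rwa [ENNReal.toReal_mul, toReal_enorm, toReal_enorm] at h2

/-- The norm of `W^{1,p}_{A,γ}` in terms of energies. -/
theorem magneticSobolev_enorm_rpow_eq [Fact (1 ≤ p)] (hp : p ≠ ⊤) (V : magneticSobolev A γ p) :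
    ‖V‖ₑ ^ p.toReal = energy γ p.toReal (fun X => ‖V.1 X‖ₑ) +
      energy γ p.toReal (fun X => ‖covGradient A V.1 X‖ₑ) := by
  have hm : AEMeasurable (fun X => wt γ (X (Fin.last d)) * ‖V.1 X‖ₑ ^ p.toReal) (halfMeasure d) :=
    Measurable.aemeasurable (by
      have := V.1.measurable
      fun_prop)
  rw [magneticSobolev_enorm_rpow A γ p hp, energy, energy, ← lintegral_add_left' hm]
  refine lintegral_congr fun X => ?_
  rw [wt]
  ring

end Membership

/-! ### The trace operator -/

section TraceOperator

variable {d : ℕ} {A B : Rn (d + 1) → Rn (d + 1)} {s β : ℝ} {p : ℝ≥0∞}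

theorem boundaryTrace_add {U V : Rn (d + 1) → ℂ} {G H : Rn (d + 1) → Cn (d + 1)} {x : Rn d}
    (hU : IntegrableOn (fun t => U (pt x t)) (Ioc 0 1))
    (hV : IntegrableOn (fun t => V (pt x t)) (Ioc 0 1))
    (hG : IntegrableOn (fun t => G (pt x t) (Fin.last d)) (Ioc 0 1))
    (hH : IntegrableOn (fun t => H (pt x t) (Fin.last d)) (Ioc 0 1)) :
    boundaryTrace (U + V) (G + H) x = boundaryTrace U G x + boundaryTrace V H x := by
  have hw : ∀ {g : ℝ → ℂ}, IntegrableOn g (Ioc 0 1) →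
      IntegrableOn (fun t : ℝ => (1 - t) • g t) (Ioc 0 1) := fun {g} hg => by
    rw [← integrableOn_Icc_iff_integrableOn_Ioc] at hg ⊢
    exact hg.continuousOn_smul (Continuous.continuousOn (by fun_prop)) isCompact_Icc
  have e := integral_add (hU.sub (hw hG)) (hV.sub (hw hH))
  simp only [Pi.sub_apply] at e
  rw [boundaryTrace, boundaryTrace, boundaryTrace, ← e]
  refine integral_congr_ae (.of_forall fun t => ?_)
  simp only [Pi.add_apply, PiLp.add_apply, smul_add]
  ring

theorem boundaryTrace_smul (c : ℂ) (U : Rn (d + 1) → ℂ) (G : Rn (d + 1) → Cn (d + 1)) (x : Rn d) :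
    boundaryTrace (c • U) (c • G) x = c • boundaryTrace U G x := by
  rw [boundaryTrace, boundaryTrace, ← integral_smul]
  refine integral_congr_ae (.of_forall fun t => ?_)
  simp only [Pi.smul_apply, PiLp.smul_apply, smul_sub]
  rw [smul_comm]

/-- The boundary trace of a function computed from its weak gradient. -/
def weakTrace (V : Rn (d + 1) → ℂ) : Rn d → ℂ := boundaryTrace V (weakGradient V)

theorem weakTrace_ae_eq {U V : Rn (d + 1) → ℂ} {G : Rn (d + 1) → Cn (d + 1)}
    (hU : HasWeakGradient U G) (h : U =ᵐ[halfMeasure d] V) :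
    weakTrace V =ᵐ[volume] boundaryTrace U G :=
  boundaryTrace_congr_ae h.symm (hU.weakGradient_ae h)

variable [Fact (1 ≤ p)]

theorem aestronglyMeasurable_weakTrace (hp : p ≠ ⊤) {γ : ℝ} (V : magneticSobolev A γ p) :
    AEStronglyMeasurable (weakTrace V.1) (volume : Measure (Rn d)) := by
  obtain ⟨G, hG, hVG, h1, -⟩ := magneticSobolev_exists_gradient hp (B := A) (fun _ _ => rfl) V
  exact (stronglyMeasurable_boundaryTrace V.1.measurable hG).aestronglyMeasurable.congr
    (weakTrace_ae_eq hVG Filter.EventuallyEq.rfl).symm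

/-- Additivity is not formal, since integrals are additive only on integrable functions; finite
energy provides this on almost every vertical line. -/
theorem weakTrace_add_ae (hp : p ≠ ⊤) (hs : 0 < s) (hAB : EqOn B A (closedHalfSpace d))
    (hB : Continuous B) (V W : magneticSobolev A ((1 - s) * p.toReal - 1) p) :
    weakTrace (V + W).1 =ᵐ[volume] weakTrace V.1 + weakTrace W.1 := by
  have hq := one_le_toReal_of_fact hp
  obtain ⟨G, hG, hVG, h1, -, eV, eG⟩ := magneticSobolev_exists_gradient hp hAB V
  obtain ⟨H, hH, hWH, h2, -, eW, eH⟩ := magneticSobolev_exists_gradient hp hAB W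
  have h : (V.1 : Rn (d + 1) → ℂ) + (W.1 : Rn (d + 1) → ℂ) =ᵐ[halfMeasure d] (V + W).1 :=
    (AEEqFun.coeFn_add V.1 W.1).symm
  filter_upwards [weakTrace_ae_eq (hVG.add hWH) h, weakTrace_ae_eq hVG Filter.EventuallyEq.rfl,
    weakTrace_ae_eq hWH Filter.EventuallyEq.rfl,
    ae_integrableOn_vertical hB V.1.measurable hG hs hq eV eG,
    ae_integrableOn_vertical hB W.1.measurable hH hs hq eW eH] with x k1 k2 k3 k4 k5
  rw [k1, Pi.add_apply, k2, k3]
  exact boundaryTrace_add (k4 1 one_pos).1 (k5 1 one_pos).1 (k4 1 one_pos).2 (k5 1 one_pos).2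

theorem weakTrace_smul_ae (hp : p ≠ ⊤) {γ : ℝ} (c : ℂ) (V : magneticSobolev A γ p) :
    weakTrace (c • V).1 =ᵐ[volume] c • weakTrace V.1 := by
  obtain ⟨G, hG, hVG, h1, -⟩ := magneticSobolev_exists_gradient hp (B := A) (fun _ _ => rfl) V
  have h : c • (V.1 : Rn (d + 1) → ℂ) =ᵐ[halfMeasure d] (c • V).1 := (AEEqFun.coeFn_smul c V.1).symm
  filter_upwards [weakTrace_ae_eq (hVG.const_smul c) h,
    weakTrace_ae_eq hVG Filter.EventuallyEq.rfl] with x k1 k2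
  rw [k1, Pi.smul_apply, k2, boundaryTrace_smul]

theorem weakTrace_estimate (hp : p ≠ ⊤) (hs : 0 < s) (hs1 : s < 1)
    (hAB : EqOn B A (closedHalfSpace d)) (hB : CurlBound B β)
    (V : magneticSobolev A ((1 - s) * p.toReal - 1) p) :
    gagliardo (parallel A) s p (weakTrace V.1) +
      ENNReal.ofReal β ^ (s * p.toReal / 2) * ∫⁻ x, ‖weakTrace V.1 x‖ₑ ^ p.toReal ≤
    traceConst d s p.toReal *
      (energy ((1 - s) * p.toReal - 1) p.toReal (fun X => ‖covGradient A V.1 X‖ₑ) +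
        ENNReal.ofReal β ^ (p.toReal / 2) *
          energy ((1 - s) * p.toReal - 1) p.toReal (fun X => ‖V.1 X‖ₑ)) := by
  have hq := one_le_toReal_of_fact hp
  obtain ⟨G, hG, hVG, -, hc, eV, eG⟩ := magneticSobolev_exists_gradient hp hAB V
  have ht := weakTrace_ae_eq hVG Filter.EventuallyEq.rfl
  have h := hVG.trace_estimate V.1.measurable hG hB hs hs1 hq eV eG
  have e1 : ∫⁻ x, ‖weakTrace V.1 x‖ₑ ^ p.toReal = ∫⁻ x, ‖boundaryTrace V.1 G x‖ₑ ^ p.toReal :=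
    lintegral_congr_ae (by filter_upwards [ht] with x hx; rw [hx])
  have e2 := energy_congr (γ := (1 - s) * p.toReal - 1) (q := p.toReal)
    (f := fun X => ‖covGradient A V.1 X‖ₑ) (g := fun X => ‖covField B V.1 G X‖ₑ)
    (by filter_upwards [hc] with X hX; rw [hX])
  rw [gagliardo_congr (parallel A) s p ht, e1, e2, ← parallel_congr hAB]
  exact h

/-- The trace operator. -/
theorem exists_traceOperator (hd : 1 ≤ d) (hp : p ≠ ⊤) (hs : 0 < s) (hs1 : s < 1)
    (hAB : EqOn B A (closedHalfSpace d)) (hB : CurlBound B β) :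
    ∃ Tr : magneticSobolev A ((1 - s) * p.toReal - 1) p →L[ℂ] fracMagneticSobolev (parallel A) s p,
      ∀ V, ((Tr V).1 : Rn d → ℂ) =ᵐ[volume] weakTrace V.1 := by
  have hq := one_le_toReal_of_fact hp
  have hq0 : 0 < p.toReal := by linarith
  have ha : Continuous (parallel A) := parallel_congr hAB ▸ continuous_parallel hB.contDiff.continuous
  have hC := traceConst_lt_top hd hs hs1 hq
  -- For continuity the bound `β` is enlarged to `β + 1 ≥ 1`, so that the estimate also controls the
  -- `L^p` norm of the trace when `β = 0`. The operator norm may depend on `β`.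
  have hB' : CurlBound B (β + 1) := hB.mono (by linarith)
  have hβ1 : 1 ≤ ENNReal.ofReal (β + 1) := by
    rw [ENNReal.one_le_ofReal]
    linarith [hB.nonneg]
  obtain ⟨b, hb⟩ : ∃ b, b = ENNReal.ofReal (β + 1) ^ (p.toReal / 2) := ⟨_, rfl⟩
  have hb1 : 1 ≤ b := hb ▸ ENNReal.one_le_rpow hβ1 (by positivity)
  have hbt : b ≠ ⊤ := hb ▸ ENNReal.rpow_ne_top_of_nonneg (by positivity) ENNReal.ofReal_ne_top
  have key : ∀ V : magneticSobolev A ((1 - s) * p.toReal - 1) p,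
      (∫⁻ x, ‖weakTrace V.1 x‖ₑ ^ p.toReal) + gagliardo (parallel A) s p (weakTrace V.1) ≤
        traceConst d s p.toReal * b * ‖V‖ₑ ^ p.toReal := by
    intro V
    have h := weakTrace_estimate hp hs hs1 hAB hB' V
    rw [← hb] at h
    have h1 : (1 : ℝ≥0∞) ≤ ENNReal.ofReal (β + 1) ^ (s * p.toReal / 2) :=
      ENNReal.one_le_rpow hβ1 (by positivity)
    rw [add_comm]
    refine (add_le_add le_rfl (le_mul_of_one_le_left' h1)).trans (h.trans ?_)
    rw [magneticSobolev_enorm_rpow_eq hp V, mul_assoc, mul_add b, add_comm]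
    exact mul_le_mul' le_rfl (add_le_add le_rfl (le_mul_of_one_le_left' hb1))
  have hfin : ∀ V : magneticSobolev A ((1 - s) * p.toReal - 1) p,
      (∫⁻ x, ‖weakTrace V.1 x‖ₑ ^ p.toReal) < ⊤ ∧ gagliardo (parallel A) s p (weakTrace V.1) < ⊤ := by
    intro V
    refine ENNReal.add_lt_top.1 ((key V).trans_lt (ENNReal.mul_lt_top
      (ENNReal.mul_lt_top hC hbt.lt_top) ?_))
    exact ENNReal.rpow_lt_top_of_nonneg hq0.le enorm_ne_top
  let tr : magneticSobolev A ((1 - s) * p.toReal - 1) p → (Rn d →ₘ[volume] ℂ) := fun V =>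
    AEEqFun.mk (weakTrace V.1) (aestronglyMeasurable_weakTrace hp V)
  have htr : ∀ V, tr V =ᵐ[volume] weakTrace V.1 := fun V => AEEqFun.coeFn_mk _ _
  have e1 : ∀ V, ∫⁻ x, ‖tr V x‖ₑ ^ p.toReal = ∫⁻ x, ‖weakTrace V.1 x‖ₑ ^ p.toReal := fun V =>
    lintegral_congr_ae (by filter_upwards [htr V] with x hx; rw [hx])
  have hmem : ∀ V, tr V ∈ fracMagneticSobolev (parallel A) s p := fun V =>
    mem_fracMagneticSobolev hp ha (by rw [e1]; exact (hfin V).1)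
      (by rw [gagliardo_congr _ s p (htr V)]; exact (hfin V).2)
  let L : magneticSobolev A ((1 - s) * p.toReal - 1) p →ₗ[ℂ] fracMagneticSobolev (parallel A) s p :=
    { toFun := fun V => ⟨tr V, hmem V⟩
      map_add' := fun V W => by
        refine Subtype.ext (AEEqFun.ext ?_)
        filter_upwards [htr (V + W), htr V, htr W, AEEqFun.coeFn_add (tr V) (tr W),
          weakTrace_add_ae hp hs hAB hB.contDiff.continuous V W] with x k1 k2 k3 k4 k5
        change tr (V + W) x = (tr V + tr W) x
        rw [k1, k4, k5, Pi.add_apply, Pi.add_apply, k2, k3]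
      map_smul' := fun c V => by
        refine Subtype.ext (AEEqFun.ext ?_)
        filter_upwards [htr (c • V), htr V, AEEqFun.coeFn_smul c (tr V),
          weakTrace_smul_ae hp c V] with x k1 k2 k3 k4
        change tr (c • V) x = (c • tr V) x
        rw [k1, k3, k4, Pi.smul_apply, Pi.smul_apply, k2] }
  refine ⟨L.mkContinuous ((traceConst d s p.toReal * b) ^ (1 / p.toReal)).toReal fun V => ?_, htr⟩
  refine norm_le_of_enorm_rpow_le (ENNReal.mul_lt_top hC hbt.lt_top).ne hq0 ?_
  rw [fracMagneticSobolev_enorm_rpow (parallel A) s p hp]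
  change (∫⁻ x, ‖tr V x‖ₑ ^ p.toReal) + gagliardo (parallel A) s p (tr V) ≤ _
  rw [e1, gagliardo_congr _ s p (htr V)]
  exact key V

end TraceOperator

/-! ### The extension operator between Sobolev spaces -/

section ExtensionOperator

variable {d : ℕ} {A B : Rn (d + 1) → Rn (d + 1)} {s q β b M : ℝ} {κ : Rn (d + 1) → ℝ}

/-- The constant in the extension estimate. -/
def extConst (d : ℕ) (s q M : ℝ) : ℝ≥0∞ :=
  ((d + 1 : ℕ) : ℝ≥0∞) ^ q * (2 ^ q *
    (ENNReal.ofReal M ^ q * (ballVol d ^ (q - 1) * ENNReal.ofReal (1 / (d + s * q))) +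
      ENNReal.ofReal (9 * M) ^ q * meanConst d s q)) + ENNReal.ofReal M ^ q * meanConst d s q

theorem extConst_lt_top (d : ℕ) (s M : ℝ) (hq : 1 ≤ q) : extConst d s q M < ⊤ := by
  have h : ∀ {x : ℝ≥0∞}, x ≠ ⊤ → x ^ q < ⊤ := fun hx =>
    ENNReal.rpow_lt_top_of_nonneg (by linarith) hx
  have h1 : ballVol d ^ (q - 1) < ⊤ :=
    ENNReal.rpow_lt_top_of_nonneg (by linarith) (ballVol_lt_top d).ne
  have h2 := meanConst_lt_top d s hq
  exact ENNReal.add_lt_top.2 ⟨ENNReal.mul_lt_top (h (ENNReal.natCast_ne_top _))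
    (ENNReal.mul_lt_top (h (by simp)) (ENNReal.add_lt_top.2
      ⟨ENNReal.mul_lt_top (h ENNReal.ofReal_ne_top) (ENNReal.mul_lt_top h1 ENNReal.ofReal_lt_top),
        ENNReal.mul_lt_top (h ENNReal.ofReal_ne_top) h2⟩)),
    ENNReal.mul_lt_top (h ENNReal.ofReal_ne_top) h2⟩

theorem extension_estimate {u : Rn d → ℂ} (hκ : IsMollifier κ M) (hM : 0 ≤ M) (hB : CurlBound B β)
    (hu : Measurable u) (hui : LocallyIntegrable u) (hb : 0 < b) (hβ : β ≤ b ^ 2) (hs : 0 < s)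
    (hs1 : s < 1) (hq : 1 ≤ q) :
    energy ((1 - s) * q - 1) q (fun X => ‖covField B (extend κ B b u) (extendGrad κ B b u) X‖ₑ) +
        wt q b * energy ((1 - s) * q - 1) q (fun X => ‖extend κ B b u X‖ₑ) ≤
      extConst d s q M *
        ((∫⁻ z : Rn d × Rn d, ‖covDiff (parallel B) u z‖ₑ ^ q / ‖z.2 - z.1‖ₑ ^ (d + s * q)) +
          wt (s * q) b * ∫⁻ x, ‖u x‖ₑ ^ q) := by
  obtain ⟨S, hS⟩ : ∃ S, S = ∫⁻ z : Rn d × Rn d,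
    ‖covDiff (parallel B) u z‖ₑ ^ q / ‖z.2 - z.1‖ₑ ^ (d + s * q) := ⟨_, rfl⟩
  obtain ⟨N, hN⟩ : ∃ N, N = ∫⁻ x, ‖u x‖ₑ ^ q := ⟨_, rfl⟩
  have h1 := energy_covField_extend_le hκ hM hB hu hui hb hβ hs hs1 hq
  have h2 := energy_extend_le hκ hM hB.contDiff.continuous hu hb hs1 hq
  have e : wt q b * wt (-((1 - s) * q)) b = wt (s * q) b := by
    rw [wt_mul_wt _ _ hb]
    congr 1
    ring
  rw [← hS, ← hN] at h1 ⊢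
  rw [← hN] at h2
  rw [extConst, add_mul]
  refine add_le_add (h1.trans ?_) ((mul_le_mul' le_rfl h2).trans ?_)
  · refine le_trans (mul_le_mul' le_rfl ((mul_le_mul' le_rfl ?_).trans (mul_assoc _ _ _).ge))
      (mul_assoc _ _ _).ge
    rw [add_mul, ← mul_assoc (ENNReal.ofReal M ^ q)]
    exact add_le_add (mul_le_mul' le_rfl le_self_add) (mul_le_mul' le_rfl le_add_self)
  · have : wt q b * (ENNReal.ofReal M ^ q * (meanConst d s q * wt (-((1 - s) * q)) b * N)) =
        ENNReal.ofReal M ^ q * meanConst d s q * (wt (s * q) b * N) := by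
      rw [← e]
      ring
    rw [this]
    exact mul_le_mul' le_rfl le_add_self

theorem extend_congr_ae {u v : Rn d → ℂ} (h : u =ᵐ[volume] v) : extend κ B b u = extend κ B b v := by
  ext X
  refine integral_congr_ae ?_
  filter_upwards [h] with y hy
  rw [hy]

theorem extend_add (hκ : IsMollifier κ M) (hB : Continuous B) {u v : Rn d → ℂ}
    (hu : LocallyIntegrable u) (hv : LocallyIntegrable v) {X : Rn (d + 1)} (hX : X ∈ halfSpace d) :
    extend κ B b (u + v) X = extend κ B b u X + extend κ B b v X := by
  have hL := coneKernel_extKernel hκ hB b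
  rw [extend, extend, extend, ← integral_add (hL.integrable hu hX) (hL.integrable hv hX)]
  simp only [Pi.add_apply, add_smul]

theorem extend_smul (c : ℂ) (u : Rn d → ℂ) (X : Rn (d + 1)) :
    extend κ B b (c • u) X = c • extend κ B b u X := by
  rw [extend, extend, ← integral_smul]
  simp only [Pi.smul_apply, smul_assoc]

variable {p : ℝ≥0∞} [hp1 : Fact (1 ≤ p)]

theorem fracMagneticSobolev_locallyIntegrable {n : ℕ} {a : Rn n → Rn n}
    (u : fracMagneticSobolev a s p) : LocallyIntegrable u.1 :=
  u.2.1.locallyIntegrable hp1.out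

/-- The extension operator, together with its estimate. -/
theorem exists_extensionOperator (hp : p ≠ ⊤) (hs : 0 < s) (hs1 : s < 1)
    (hAB : EqOn B A (closedHalfSpace d)) (hB : CurlBound B β) (hκ : IsMollifier κ M) (hM : 0 ≤ M)
    (hb : 0 < b) (hβ : β ≤ b ^ 2) :
    ∃ Ext : fracMagneticSobolev (parallel A) s p →L[ℂ] magneticSobolev A ((1 - s) * p.toReal - 1) p,
      ∀ u, ((Ext u).1 : Rn (d + 1) → ℂ) =ᵐ[halfMeasure d] extend κ B b u.1 ∧
        energy ((1 - s) * p.toReal - 1) p.toReal (fun X => ‖covGradient A (Ext u).1 X‖ₑ) +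
            wt p.toReal b *
              energy ((1 - s) * p.toReal - 1) p.toReal (fun X => ‖(Ext u).1 X‖ₑ) ≤
          extConst d s p.toReal M *
            (gagliardo (parallel A) s p u.1 + wt (s * p.toReal) b * ∫⁻ x, ‖u.1 x‖ₑ ^ p.toReal) := by
  have hq := one_le_toReal_of_fact hp
  have hq0 : 0 < p.toReal := by linarith
  have hBc := hB.contDiff.continuous
  have hC := extConst_lt_top d s M hq
  have hw : ∀ u : fracMagneticSobolev (parallel A) s p,
      HasWeakGradient (extend κ B b u.1) (extendGrad κ B b u.1) := fun u =>
    hasWeakGradient_extend hκ hB.contDiff b (fracMagneticSobolev_locallyIntegrable u)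
  let e : fracMagneticSobolev (parallel A) s p → (Rn (d + 1) →ₘ[halfMeasure d] ℂ) := fun u =>
    AEEqFun.mk (extend κ B b u.1) (hw u).locInt.aestronglyMeasurable
  have he : ∀ u, e u =ᵐ[halfMeasure d] extend κ B b u.1 := fun u => AEEqFun.coeFn_mk _ _
  have hc : ∀ u, covGradient A (e u) =ᵐ[halfMeasure d]
      covField B (extend κ B b u.1) (extendGrad κ B b u.1) := fun u =>
    covGradient_ae_eq hAB (he u) ((hw u).weakGradient_ae (he u).symm)
  have est : ∀ u : fracMagneticSobolev (parallel A) s p,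
      energy ((1 - s) * p.toReal - 1) p.toReal
          (fun X => ‖covField B (extend κ B b u.1) (extendGrad κ B b u.1) X‖ₑ) +
        wt p.toReal b * energy ((1 - s) * p.toReal - 1) p.toReal (fun X => ‖extend κ B b u.1 X‖ₑ) ≤
      extConst d s p.toReal M *
        (gagliardo (parallel A) s p u.1 + wt (s * p.toReal) b * ∫⁻ x, ‖u.1 x‖ₑ ^ p.toReal) := by
    intro u
    have hg : ∀ w : Rn d → ℂ, gagliardo (parallel B) s p w = gagliardo (parallel A) s p w := fun w => by
      rw [parallel_congr hAB]
    rw [← hg]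
    exact extension_estimate hκ hM hB u.1.measurable (fracMagneticSobolev_locallyIntegrable u) hb hβ
      hs hs1 hq
  -- Because `b > 0`, the weighted estimate also controls the unweighted energy of the extension.
  have hw0 : wt p.toReal b ≠ 0 := wt_ne_zero _ hb
  have hfin : ∀ u : fracMagneticSobolev (parallel A) s p,
      energy ((1 - s) * p.toReal - 1) p.toReal
          (fun X => ‖covField B (extend κ B b u.1) (extendGrad κ B b u.1) X‖ₑ) < ⊤ ∧
        energy ((1 - s) * p.toReal - 1) p.toReal (fun X => ‖extend κ B b u.1 X‖ₑ) < ⊤ := by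
    intro u
    obtain ⟨h1, h2⟩ := fracMagneticSobolev_lt_top hp u
    obtain ⟨h3, h4⟩ := ENNReal.add_lt_top.1 ((est u).trans_lt (ENNReal.mul_lt_top hC
      (ENNReal.add_lt_top.2 ⟨h2, ENNReal.mul_lt_top (wt_ne_top _ _).lt_top h1⟩)))
    exact ⟨h3, ENNReal.lt_top_of_mul_ne_top_right h4.ne hw0⟩
  have hmem : ∀ u, e u ∈ magneticSobolev A ((1 - s) * p.toReal - 1) p := fun u =>
    mem_magneticSobolev hp hAB hBc (hw u) (he u).symm (hfin u).2 (hfin u).1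
  let L : fracMagneticSobolev (parallel A) s p →ₗ[ℂ] magneticSobolev A ((1 - s) * p.toReal - 1) p :=
    { toFun := fun u => ⟨e u, hmem u⟩
      map_add' := fun u v => by
        refine Subtype.ext (AEEqFun.ext ?_)
        filter_upwards [he (u + v), he u, he v, AEEqFun.coeFn_add (e u) (e v),
          ae_restrict_mem (measurableSet_halfSpace d)] with X k1 k2 k3 k4 hX
        change e (u + v) X = (e u + e v) X
        rw [k1, k4, Pi.add_apply, k2, k3, ← extend_add hκ hBc (fracMagneticSobolev_locallyIntegrable u)
          (fracMagneticSobolev_locallyIntegrable v) hX]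
        exact congrFun (extend_congr_ae (AEEqFun.coeFn_add u.1 v.1)) X
      map_smul' := fun c u => by
        refine Subtype.ext (AEEqFun.ext ?_)
        filter_upwards [he (c • u), he u, AEEqFun.coeFn_smul c (e u)] with X k1 k2 k3
        change e (c • u) X = (c • e u) X
        rw [k1, k3, Pi.smul_apply, k2, ← extend_smul]
        exact congrFun (extend_congr_ae (AEEqFun.coeFn_smul c u.1)) X }
  have est' : ∀ u : fracMagneticSobolev (parallel A) s p,
      energy ((1 - s) * p.toReal - 1) p.toReal (fun X => ‖covGradient A (e u) X‖ₑ) +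
        wt p.toReal b * energy ((1 - s) * p.toReal - 1) p.toReal (fun X => ‖e u X‖ₑ) ≤
      extConst d s p.toReal M *
        (gagliardo (parallel A) s p u.1 + wt (s * p.toReal) b * ∫⁻ x, ‖u.1 x‖ₑ ^ p.toReal) := by
    intro u
    have e1 := energy_congr (γ := (1 - s) * p.toReal - 1) (q := p.toReal)
      (f := fun X => ‖covGradient A (e u) X‖ₑ)
      (g := fun X => ‖covField B (extend κ B b u.1) (extendGrad κ B b u.1) X‖ₑ)
      (by filter_upwards [hc u] with X hX; rw [hX])
    have e2 := energy_congr (γ := (1 - s) * p.toReal - 1) (q := p.toReal)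
      (f := fun X => ‖e u X‖ₑ) (g := fun X => ‖extend κ B b u.1 X‖ₑ)
      (by filter_upwards [he u] with X hX; rw [hX])
    rw [e1, e2]
    exact est u
  -- The two factors pass from the norms weighted by powers of `b` to the plain ones, on the
  -- half-space and on the boundary. Only continuity is at stake, so dependence on `b` is allowed.
  obtain ⟨K, hK⟩ : ∃ K, K = (1 + (wt p.toReal b)⁻¹) *
    (extConst d s p.toReal M * (1 + wt (s * p.toReal) b)) := ⟨_, rfl⟩
  have hKt : K ≠ ⊤ := by
    rw [hK]
    refine (ENNReal.mul_lt_top (ENNReal.add_lt_top.2 ⟨ENNReal.one_lt_top, ?_⟩)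
      (ENNReal.mul_lt_top hC
        (ENNReal.add_lt_top.2 ⟨ENNReal.one_lt_top, (wt_ne_top _ _).lt_top⟩))).ne
    exact ENNReal.inv_lt_top.2 (pos_iff_ne_zero.2 hw0)
  refine ⟨L.mkContinuous (K ^ (1 / p.toReal)).toReal fun u => norm_le_of_enorm_rpow_le hKt hq0 ?_,
    fun u => ⟨he u, est' u⟩⟩
  rw [magneticSobolev_enorm_rpow_eq hp, fracMagneticSobolev_enorm_rpow (parallel A) s p hp, hK]
  change energy _ _ (fun X => ‖e u X‖ₑ) + energy _ _ (fun X => ‖covGradient A (e u) X‖ₑ) ≤ _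
  have h := est' u
  obtain ⟨x, hx⟩ : ∃ x, x = energy ((1 - s) * p.toReal - 1) p.toReal (fun X => ‖e u X‖ₑ) := ⟨_, rfl⟩
  obtain ⟨y, hy⟩ : ∃ y, y = energy ((1 - s) * p.toReal - 1) p.toReal
    (fun X => ‖covGradient A (e u) X‖ₑ) := ⟨_, rfl⟩
  rw [← hx, ← hy] at h ⊢
  calc x + y ≤ (1 + (wt p.toReal b)⁻¹) * (y + wt p.toReal b * x) := by
        rw [add_mul, one_mul, mul_add _ y, ← mul_assoc, ENNReal.inv_mul_cancel hw0 (wt_ne_top _ _),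
          one_mul, add_comm x]
        exact add_le_add le_self_add le_add_self
    _ ≤ _ := by
        rw [mul_assoc]
        refine mul_le_mul' le_rfl (h.trans ?_)
        rw [mul_assoc]
        refine mul_le_mul' le_rfl ?_
        rw [add_mul, one_mul, mul_add (wt _ _), add_comm (∫⁻ x, ‖u.1 x‖ₑ ^ p.toReal)]
        exact add_le_add le_self_add le_self_add

end ExtensionOperator

/-! ### Traces of extensions and of functions that are `C¹` up to the boundary -/

section TraceValues

variable {d : ℕ} {A B : Rn (d + 1) → Rn (d + 1)} {s β b M : ℝ} {κ : Rn (d + 1) → ℝ}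
  {p : ℝ≥0∞} [Fact (1 ≤ p)]

theorem weakTrace_extend (hp : p ≠ ⊤) (hs : 0 < s) (hs1 : s < 1)
    (hAB : EqOn B A (closedHalfSpace d)) (hB : CurlBound B β) (hκ : IsMollifier κ M) (hM : 0 < M)
    (hb : 0 < b) (hβ : β ≤ b ^ 2) (u : fracMagneticSobolev (parallel A) s p)
    (V : magneticSobolev A ((1 - s) * p.toReal - 1) p)
    (hV : V.1 =ᵐ[halfMeasure d] extend κ B b u.1) : weakTrace V.1 =ᵐ[volume] u.1 := by
  obtain ⟨G, hG, hVG, -, -, eV, eG⟩ := magneticSobolev_exists_gradient hp hAB V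
  obtain ⟨h1, h2⟩ := fracMagneticSobolev_lt_top hp u
  have hg : ∀ w : Rn d → ℂ, gagliardo (parallel B) s p w = gagliardo (parallel A) s p w := fun w => by
    rw [parallel_congr hAB]
  rw [← hg] at h2
  exact (weakTrace_ae_eq hVG Filter.EventuallyEq.rfl).trans
    (hVG.boundaryTrace_extend V.1.measurable hG hκ hM hB hs hs1 (one_le_toReal_of_fact hp) eV eG
      u.1.measurable (fracMagneticSobolev_locallyIntegrable u) hb hβ h1 h2 hV)

/-- The trace of a compactly supported function that is `C¹` up to the boundary is its restriction. -/
theorem exists_mem_weakTrace_eq_restrict (hp : p ≠ ⊤) (hs : 0 < s) (hs1 : s < 1)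
    (hAB : EqOn B A (closedHalfSpace d)) (hB : Continuous B) {U : Rn (d + 1) → ℂ}
    (hU : ContDiffOn ℝ 1 U (closedHalfSpace d)) {K : Set (Rn (d + 1))} (hK : IsCompact K)
    (hUK : ∀ X ∈ closedHalfSpace d, X ∉ K → U X = 0) :
    ∃ V : magneticSobolev A ((1 - s) * p.toReal - 1) p,
      (V.1 : Rn (d + 1) → ℂ) =ᵐ[halfMeasure d] U ∧ weakTrace V.1 =ᵐ[volume] fun x => U (bdry x) := by
  have hq := one_le_toReal_of_fact hp
  have hγ : -1 < (1 - s) * p.toReal - 1 := by nlinarith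
  obtain ⟨W, hW, hWU⟩ := exists_contDiff_eqOn_closedHalfSpace hU
  obtain ⟨G, hGdef⟩ : ∃ G : Rn (d + 1) → Cn (d + 1), G = fun X => gradVec (fderiv ℝ W X) := ⟨_, rfl⟩
  have hGc : Continuous G := by
    have := continuous_gradVec.comp (hW.continuous_fderiv one_ne_zero)
    rw [hGdef]
    exact this
  have hWG : HasWeakGradient W G := by
    rw [hGdef]
    exact .of_hasFDerivAt (fun X _ => (hW.differentiable one_ne_zero X).hasFDerivAt)
      (hW.continuous_fderiv one_ne_zero).continuousOn
  have hFc : Continuous (covField B W G) := by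
    have := hW.continuous
    unfold covField
    refine hGc.add ((PiLp.continuous_toLp 2 _).comp (continuous_pi fun j => ?_))
    fun_prop
  have hW0 : ∀ X ∈ halfSpace d, X ∉ K → W X = 0 := fun X hX hXK => by
    have hX' := halfSpace_subset_closedHalfSpace d hX
    rw [hWU hX', hUK X hX' hXK]
  have hF0 : ∀ X ∈ halfSpace d, X ∉ K → covField B W G X = 0 := fun X hX hXK => by
    have h1 : W =ᶠ[nhds X] fun _ => 0 := by
      filter_upwards [(isOpen_halfSpace d).mem_nhds hX, hK.isClosed.isOpen_compl.mem_nhds hXK]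
        with Y h1 h2 using hW0 Y h1 h2
    ext j
    simp [covField, hGdef, gradVec, h1.fderiv_eq, h1.eq_of_nhds]
  have hq0 : 0 < p.toReal := by linarith
  have eW := energy_lt_top_of_isCompact hW.continuous hK hW0 hγ hq0
  have eF := energy_lt_top_of_isCompact hFc hK hF0 hγ hq0
  have hmk := AEEqFun.coeFn_mk W (μ := halfMeasure d) hW.continuous.aestronglyMeasurable
  refine ⟨⟨AEEqFun.mk W hW.continuous.aestronglyMeasurable,
    mem_magneticSobolev hp hAB hB hWG hmk.symm eW eF⟩, ?_, ?_⟩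
  · filter_upwards [hmk, ae_restrict_mem (measurableSet_halfSpace d)] with X h1 h2
    exact h1.trans (hWU (halfSpace_subset_closedHalfSpace d h2))
  · refine (weakTrace_ae_eq hWG hmk.symm).trans ?_
    -- On almost every vertical line both the trace and the classical boundary value are the limit
    -- of `W` at height `0`.
    filter_upwards [hWG.ae_tendsto_boundaryTrace hW.continuous.measurable hGc.measurable hB hs hq
      eW eF] with x hx
    have h1 : Continuous fun t => W (pt x t) :=
      hW.continuous.comp (continuous_pt_comp continuous_const continuous_id)
    have h2 : Filter.Tendsto (fun t => W (pt x t)) aeRight (nhds (W (pt x 0))) :=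
      (h1.tendsto 0).mono_left (inf_le_left.trans nhdsWithin_le_nhds)
    rw [tendsto_nhds_unique hx h2, bdry_eq_pt]
    exact hWU (pt_mem_closedHalfSpace.2 le_rfl)

theorem setLIntegral_div_weight_eq {q : ℝ} (c : ℝ≥0∞) (f : Rn (d + 1) → ℝ≥0∞)
    {g : Rn (d + 1) → ℝ≥0∞} (hg : AEMeasurable g (halfMeasure d)) :
    ∫⁻ X in halfSpace d, (f X ^ q + c * g X ^ q) /
        ENNReal.ofReal (X (Fin.last d) ^ (1 - (1 - s) * q)) =
      energy ((1 - s) * q - 1) q f + c * energy ((1 - s) * q - 1) q g := by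
  have hm : AEMeasurable (fun X => wt ((1 - s) * q - 1) (X (Fin.last d)) * g X ^ q) (halfMeasure d) :=
    (by fun_prop : Measurable fun X : Rn (d + 1) => wt ((1 - s) * q - 1) (X (Fin.last d))).aemeasurable.mul
      (hg.pow_const q)
  rw [energy, energy, ← lintegral_const_mul'' _ hm, ← lintegral_add_right' _ (hm.const_mul c)]
  refine setLIntegral_congr_fun (measurableSet_halfSpace d) fun X hX => ?_
  have hX0 : 0 < X (Fin.last d) := hX
  have e : (ENNReal.ofReal (X (Fin.last d) ^ (1 - (1 - s) * q)))⁻¹ =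
      wt ((1 - s) * q - 1) (X (Fin.last d)) := by
    rw [wt, ← ENNReal.ofReal_inv_of_pos (Real.rpow_pos_of_pos hX0 _), ← Real.rpow_neg hX0.le]
    congr 2
    ring
  simp only [div_eq_mul_inv, e]
  ring

theorem IsMollifier.mono {M N : ℝ} (h : IsMollifier κ M) (hMN : M ≤ N) : IsMollifier κ N where
  contDiffOn := h.contDiffOn
  eq_zero := h.eq_zero
  integral_eq_one := h.integral_eq_one
  abs_le Z hZ := (h.abs_le Z hZ).trans
    (mul_le_mul_of_nonneg_right hMN (Real.rpow_nonneg (le_of_lt hZ) _))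
  norm_fderiv_le Z hZ := (h.norm_fderiv_le Z hZ).trans
    (mul_le_mul_of_nonneg_right hMN (Real.rpow_nonneg (le_of_lt hZ) _))

end TraceValues

end MagneticTrace

end

/-! ### The trace theorem -/

theorem mainTheorem4 (d : ℕ) (hd : 1 ≤ d) (s : ℝ) (hs0 : 0 < s) (hs1 : s < 1)
    (p : ℝ≥0∞) [Fact (1 ≤ p)] (hp : p ≠ ⊤) :
    ∃ C : ℝ≥0, 0 < C ∧
      ∀ (A : Rn (d + 1) → Rn (d + 1)) (β : ℝ≥0),
        ContDiffOn ℝ 1 A (closedHalfSpace d) →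
        eLpNorm (magneticField A) ⊤ (halfMeasure d) ≤ (β : ℝ≥0∞) →
        ∃ Tr : magneticSobolev A ((1 - s) * p.toReal - 1) p →L[ℂ]
            fracMagneticSobolev (parallel A) s p,
          -- the trace of `C¹_c` functions (on the closed half-space) is the restriction
          (∀ U : Rn (d + 1) → ℂ, ContDiffOn ℝ 1 U (closedHalfSpace d) →
            (∃ K : Set (Rn (d + 1)), IsCompact K ∧ ∀ X ∈ closedHalfSpace d, X ∉ K → U X = 0) →
            ∃ V : magneticSobolev A ((1 - s) * p.toReal - 1) p,
              (V.1 : Rn (d + 1) → ℂ) =ᵐ[halfMeasure d] U ∧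
              ((Tr V).1 : Rn d → ℂ) =ᵐ[volume] fun x => U (bdry x)) ∧
          -- the trace estimate
          (∀ U : magneticSobolev A ((1 - s) * p.toReal - 1) p,
            gagliardo (parallel A) s p (Tr U).1 +
                (β : ℝ≥0∞) ^ (s * p.toReal / 2) * ∫⁻ x, ‖(Tr U).1 x‖ₑ ^ p.toReal ≤
              C * ∫⁻ X in halfSpace d,
                (‖covGradient A U.1 X‖ₑ ^ p.toReal +
                  (β : ℝ≥0∞) ^ (p.toReal / 2) * ‖U.1 X‖ₑ ^ p.toReal) /
                    ENNReal.ofReal (X (Fin.last d) ^ (1 - (1 - s) * p.toReal))) ∧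
          ∃ Ext : fracMagneticSobolev (parallel A) s p →L[ℂ]
              magneticSobolev A ((1 - s) * p.toReal - 1) p,
            (∀ u, Tr (Ext u) = u) ∧
            -- the extension estimate
            (0 < β → ∀ u : fracMagneticSobolev (parallel A) s p,
              ∫⁻ X in halfSpace d,
                (‖covGradient A (Ext u).1 X‖ₑ ^ p.toReal +
                  (β : ℝ≥0∞) ^ (p.toReal / 2) * ‖(Ext u).1 X‖ₑ ^ p.toReal) /
                    ENNReal.ofReal (X (Fin.last d) ^ (1 - (1 - s) * p.toReal)) ≤
              C * (gagliardo (parallel A) s p u.1 +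
                (β : ℝ≥0∞) ^ (s * p.toReal / 2) * ∫⁻ x, ‖u.1 x‖ₑ ^ p.toReal)) := by
  have hq := one_le_toReal_of_fact hp
  -- The mollifier is fixed before the field, so the constants depend on `d`, `s` and `p` only.
  obtain ⟨κ, M₀, hκ₀⟩ := exists_isMollifier d
  obtain ⟨M, hM, hM₀⟩ : ∃ M : ℝ, 0 < M ∧ M₀ ≤ M := ⟨max M₀ 1, by simp, by simp⟩
  have hκ := hκ₀.mono hM₀
  have hC1 := traceConst_lt_top hd hs0 hs1 hq
  have hC2 := extConst_lt_top d s M hq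
  -- The summand `1` only ensures positivity.
  obtain ⟨C, hC⟩ : ∃ C : ℝ≥0, (C : ℝ≥0∞) = traceConst d s p.toReal + extConst d s p.toReal M + 1 :=
    ⟨_, ENNReal.coe_toNNReal
      (ENNReal.add_lt_top.2 ⟨ENNReal.add_lt_top.2 ⟨hC1, hC2⟩, ENNReal.one_lt_top⟩).ne⟩
  have hCpos : (0 : ℝ≥0∞) < C := by
    rw [hC]
    positivity
  refine ⟨C, by exact_mod_cast hCpos, fun A β hA hβ => ?_⟩
  obtain ⟨B, hB, hAB⟩ := exists_contDiff_eqOn_closedHalfSpace hA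
  have hcurl : CurlBound B β := .of_eLpNorm_le hB hAB hβ
  obtain ⟨Tr, hTr⟩ := exists_traceOperator (s := s) hd hp hs0 hs1 hAB hcurl
  have hβC : (β : ℝ≥0∞) = ENNReal.ofReal (β : ℝ) := (ENNReal.ofReal_coe_nnreal).symm
  have hint : ∀ V : magneticSobolev A ((1 - s) * p.toReal - 1) p,
      ∫⁻ X in halfSpace d, (‖covGradient A V.1 X‖ₑ ^ p.toReal +
          (β : ℝ≥0∞) ^ (p.toReal / 2) * ‖V.1 X‖ₑ ^ p.toReal) /
            ENNReal.ofReal (X (Fin.last d) ^ (1 - (1 - s) * p.toReal)) =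
        energy ((1 - s) * p.toReal - 1) p.toReal (fun X => ‖covGradient A V.1 X‖ₑ) +
          (β : ℝ≥0∞) ^ (p.toReal / 2) *
            energy ((1 - s) * p.toReal - 1) p.toReal (fun X => ‖V.1 X‖ₑ) := fun V =>
    setLIntegral_div_weight_eq _ _ V.1.aestronglyMeasurable.enorm
  refine ⟨Tr, fun U hU hK => ?_, fun U => ?_, ?_⟩
  · obtain ⟨K, hK, hUK⟩ := hK
    obtain ⟨V, hVU, hV⟩ := exists_mem_weakTrace_eq_restrict hp hs0 hs1 hAB hB.continuous hU hK hUK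
    exact ⟨V, hVU, (hTr V).trans hV⟩
  · have h := weakTrace_estimate hp hs0 hs1 hAB hcurl U
    have e1 : ∫⁻ x, ‖(Tr U).1 x‖ₑ ^ p.toReal = ∫⁻ x, ‖weakTrace U.1 x‖ₑ ^ p.toReal :=
      lintegral_congr_ae (by filter_upwards [hTr U] with x hx; rw [hx])
    rw [gagliardo_congr (parallel A) s p (hTr U), e1, hint, hC, hβC]
    exact h.trans (mul_le_mul' (le_self_add.trans le_self_add) le_rfl)
  -- The damping rate is `√β`. When `β = 0` no quantitative estimate is claimed, and `b = 1`
  -- provides a bounded extension.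
  · obtain ⟨b, hb, hβb, hb'⟩ : ∃ b : ℝ, 0 < b ∧ (β : ℝ) ≤ b ^ 2 ∧ (0 < β → b = √β) := by
      rcases eq_or_lt_of_le (show 0 ≤ β from zero_le) with h | h
      · exact ⟨1, one_pos, by simp [← h], fun h' => absurd h' (by simp [← h])⟩
      · exact ⟨√β, Real.sqrt_pos.2 h, by rw [Real.sq_sqrt β.coe_nonneg], fun _ => rfl⟩
    obtain ⟨Ext, hExt⟩ := exists_extensionOperator hp hs0 hs1 hAB hcurl hκ hM.le hb hβb
    refine ⟨Ext, fun u => ?_, fun hβ0 u => ?_⟩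
    · exact Subtype.ext (AEEqFun.ext ((hTr (Ext u)).trans
        (weakTrace_extend hp hs0 hs1 hAB hcurl hκ hM hb hβb u (Ext u) (hExt u).1)))
    · have h := (hExt u).2
      rw [hint, hC, hβC, ofReal_rpow_half β.coe_nonneg (by positivity),
        ofReal_rpow_half β.coe_nonneg (by positivity), ← hb' hβ0]
      exact h.trans (mul_le_mul' (le_add_self.trans le_self_add) le_rfl)
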